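/- Let $y_0>0$, $0<\xi_*<\xi^*<y_0/\sqrt2$, $\mathcal O=[\xi_*,\xi^*]$ and $\mathbb T=\mathbb R/2\pi\mathbb Z$, with $\int_{\mathbb T}f(\eta)\,d\eta:=\frac1{2\pi}\int_0^{2\pi}f(\eta)\,d\eta$. **Point vortices.** For $\xi_0\in\mathcal O$ let $(\mathtt I,\phi)$ be the solution on $\mathbb R$, with $\mathtt I>0$ and $\mathtt I\sin^2\phi<y_0^2$, of $$\dot{\mathtt I}=-\Big[\tfrac{1}{y_0^2-\mathtt I\sin^2\phi}+\tfrac1{y_0^2+\mathtt I\cos^2\phi}\Big]\sin(2\phi)\,\mathtt I,\qquad \dot\phi=\tfrac1{\mathtt I}+\tfrac{\sin^2\phi}{y_0^2-\mathtt I\sin^2\phi}-\tfrac{\cos^2\phi}{y_0^2+\mathtt I\cos^2\phi},\qquad \mathtt I(0)=\xi_0^2,\ \phi(0)=\tfrac\pi2,$$ which describes $z_1-z_2=\sqrt{\mathtt I}\,e^{i\phi}$ for a leapfrogging quartet $z_1,z_2,\overline{z_1},\overline{z_2}$ of point vortices. Let $T(\xi_0)>0$ be its period, $\mathtt I(t+T)=\mathtt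 I(t)$ and $\phi(t+T)=\phi(t)+2\pi$; put $\omega_0=2\pi/T(\xi_0)$, $q(\omega_0t)=\mathtt I(t)$, $\Theta(\omega_0 t)=\phi(t)$, $\mathtt w_3=i\sqrt q\sin\Theta+iy_0$, $\mathtt w_4=\sqrt q\cos\Theta+iy_0$ and $$\mathtt g(\varphi,\theta)=\mathrm{Re}\Big\{\Big(\tfrac1{q(\varphi)}-\tfrac{e^{2i\Theta(\varphi)}}{\mathtt w_3(\varphi)^2}-\tfrac{e^{2i\Theta(\varphi)}}{\mathtt w_4(\varphi)^2}\Big)e^{2i\theta}\Big\}.$$ **Contour dynamics functional.** For $\varepsilon>0$ and $r:\mathbb T^2\to\mathbb R$ with $1+2\varepsilon r>0$ put $R=\sqrt{1+2\varepsilon r}$, $L_\varepsilon(z)=\log|1+\varepsilon z|-\varepsilon\,\mathrm{Re}\,z$ and $$G(r)=\varepsilon^3\omega_0\,\partial_\varphi r-\varepsilon^3\omega_0\,\dot\Theta(\varphi)\,\partial_\theta r+\sum_{n=1}^4\partial_\theta\Psi_n(\varepsilon,r),$$ where, for $k=0,1$, $$\Psi_1=\int_{\mathbb T}\int_0^{R(\varphi,\eta)}\log\big|R(\varphi,\theta)e^{i\theta}-le^{i\eta}\big|\,l\,dl\,d\eta,\qquad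 \Psi_2=\int_{\mathbb T}\int_0^{R(\varphi+\pi,\eta)}L_\varepsilon\Big(\tfrac{R(\varphi,\theta)e^{i\theta}+le^{i\eta}}{\sqrt{q(\varphi)}}\Big)l\,dl\,d\eta,$$ $$\Psi_{3+k}=-\int_{\mathbb T}\int_0^{R(\varphi+k\pi,\eta)}L_\varepsilon\Big(\tfrac{R(\varphi,\theta)e^{i(\theta+\Theta(\varphi))}+(-1)^{k+1}le^{-i(\eta+\Theta(\varphi))}}{\mathtt w_{3+k}(\varphi)}\Big)l\,dl\,d\eta.$$ **Norms.** With $h_{\ell,j}=\frac1{(2\pi)^2}\int_{[0,2\pi]^2}h\,e^{-i(\ell\varphi+j\theta)}\,d\varphi\,d\theta$, let $\|h\|_{H^s}^2=\sum_{(\ell,j)\in\mathbb Z^2}(1+\ell^2+j^2)^s|h_{\ell,j}|^2$ and, for $\lambda\in(0,1)$ and a family $h=(h(\xi_0,\cdot))_{\xi_0\in\mathcal O}$, $$\|h\|_s^{\mathrm{Lip}(\lambda)}=\sup_{\xi_0\in\mathcal O}\|h(\xi_0,\cdot)\|_{H^s}+\lambda\sup_{\xi_1\ne\xi_2\in\mathcal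 O}\frac{\|h(\xi_1,\cdot)-h(\xi_2,\cdot)\|_{H^{s-1}}}{|\xi_1-\xi_2|}.$$ **Statement.** There exist $\varepsilon_0>0$ and, for every $\varepsilon\in(0,\varepsilon_0)$, a family $r_\varepsilon=(r_\varepsilon(\xi_0,\cdot))_{\xi_0\in\mathcal O}$ of smooth functions $\mathbb T^2\to\mathbb R$ with $\int_{\mathbb T}r_\varepsilon(\xi_0,\varphi,\theta)\,d\theta=0$, such that $\|r_\varepsilon\|_s^{\mathrm{Lip}(\lambda)}<\infty$ for all $s\in\mathbb R$ and $\lambda\in(0,1)$, such that $1+2\varepsilon^2r_\varepsilon>0$ and the derivatives $\partial_\theta\Psi_n(\varepsilon,\varepsilon r_\varepsilon)$ in $G(\varepsilon r_\varepsilon)$ exist everywhere, and such that for every $s>0$ there is a constant $C>0$, independent of $\varepsilon$ and $\lambda$, with $$\|r_\varepsilon-\mathtt g\|_s^{\mathrm{Lip}(\lambda)}\le C\varepsilon\qquad\text{and}\qquad\|G(\varepsilon r_\varepsilon)\|_s^{\mathrm{Lip}(\lambda)}\le C\varepsilon^5\qquad\text{for all }\varepsilon\in(0,\varepsilon_0),\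 \lambda\in(0,1).$$ -/

import Mathlib

open scoped ENNReal ContDiff

noncomputable section

namespace Leapfrog

/-! ### The relative motion of the point vortices -/

/-- `(J, φ)` are polar coordinates `η + iξ = √J e^{iφ}` of the difference `z₁ - z₂ = η + iξ` of the
two upper vortices of a symmetric quartet with `Im (z₁ + z₂) = y₀`, started at `η = 0`, `ξ = ξ₀`.
The two inequalities say that no vortices collide (here `ξ = √J sin φ`). -/
structure IsOrbit (y₀ ξ₀ : ℝ) (J φ : ℝ → ℝ) : Prop where
  pos : ∀ t, 0 < J t
  below : ∀ t, J t * Real.sin (φ t) ^ 2 < y₀ ^ 2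
  hasDerivAt_J : ∀ t, HasDerivAt J
    (-((1 / (y₀ ^ 2 - J t * Real.sin (φ t) ^ 2) + 1 / (y₀ ^ 2 + J t * Real.cos (φ t) ^ 2))
      * Real.sin (2 * φ t) * J t)) t
  hasDerivAt_φ : ∀ t, HasDerivAt φ
    (1 / J t + Real.sin (φ t) ^ 2 / (y₀ ^ 2 - J t * Real.sin (φ t) ^ 2)
      - Real.cos (φ t) ^ 2 / (y₀ ^ 2 + J t * Real.cos (φ t) ^ 2)) t
  init_J : J 0 = ξ₀ ^ 2
  init_φ : φ 0 = Real.pi / 2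

/-- The solution of the initial value problem: for `0 < ξ₀ < y₀ / √2` there is exactly one. -/
def orbit (y₀ ξ₀ : ℝ) : (ℝ → ℝ) × (ℝ → ℝ) :=
  Classical.epsilon fun p => IsOrbit y₀ ξ₀ p.1 p.2

/-- The period `T(ξ₀)` of the relative motion: the time of one full turn. -/
def period (y₀ ξ₀ : ℝ) : ℝ :=
  sInf {T : ℝ | 0 < T ∧ ∀ t, (orbit y₀ ξ₀).1 (t + T) = (orbit y₀ ξ₀).1 t ∧
    (orbit y₀ ξ₀).2 (t + T) = (orbit y₀ ξ₀).2 t + 2 * Real.pi}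

/-- The frequency `ω₀ = 2π / T(ξ₀)`. -/
def freq (y₀ ξ₀ : ℝ) : ℝ := 2 * Real.pi / period y₀ ξ₀

/-- `q(ω₀ t) = J(t)`. -/
def q (y₀ ξ₀ φ : ℝ) : ℝ := (orbit y₀ ξ₀).1 (φ / freq y₀ ξ₀)

/-- `Θ(ω₀ t) = φ(t)`. -/
def Theta (y₀ ξ₀ φ : ℝ) : ℝ := (orbit y₀ ξ₀).2 (φ / freq y₀ ξ₀)

/-- `z₁ - conj z₁ = i √q sin Θ + i y₀`. -/
def w₃ (y₀ ξ₀ φ : ℝ) : ℂ :=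
  Complex.I * ((√(q y₀ ξ₀ φ) * Real.sin (Theta y₀ ξ₀ φ) : ℝ) : ℂ) + Complex.I * (y₀ : ℂ)

/-- `z₁ - conj z₂ = √q cos Θ + i y₀`. -/
def w₄ (y₀ ξ₀ φ : ℝ) : ℂ :=
  ((√(q y₀ ξ₀ φ) * Real.cos (Theta y₀ ξ₀ φ) : ℝ) : ℂ) + Complex.I * (y₀ : ℂ)

/-- `e^{ix}`. -/
def cis (x : ℝ) : ℂ := Complex.exp (Complex.I * (x : ℂ))

/-- `a₂ = 1/q - e^{2iΘ}/w₃² - e^{2iΘ}/w₄²`. -/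
def a₂ (y₀ ξ₀ φ : ℝ) : ℂ :=
  1 / (q y₀ ξ₀ φ : ℂ) - cis (2 * Theta y₀ ξ₀ φ) / w₃ y₀ ξ₀ φ ^ 2
    - cis (2 * Theta y₀ ξ₀ φ) / w₄ y₀ ξ₀ φ ^ 2

/-- `g(φ, θ) = Re (a₂(φ) e^{2iθ})`. -/
def g (y₀ ξ₀ φ θ : ℝ) : ℝ := (a₂ y₀ ξ₀ φ * cis (2 * θ)).re

/-! ### The contour dynamics functional

Functions on the torus `𝕋² = (ℝ/2πℤ)²` are functions `φ ↦ θ ↦ r φ θ` on `ℝ`. -/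

/-- The polar radius `R = √(1 + 2εr)` of the patch. -/
def radius (ε : ℝ) (r : ℝ → ℝ → ℝ) (φ θ : ℝ) : ℝ := √(1 + 2 * ε * r φ θ)

/-- The integral of `f(l e^{iη})` over the domain `{l < ρ(η)}` with respect to `l dl dη / (2π)`,
where `f` is written as a function of `l` and `η`. -/
def polarIntegral (ρ : ℝ → ℝ) (f : ℝ → ℝ → ℝ) : ℝ :=
  1 / (2 * Real.pi) * ∫ η in (0)..(2 * Real.pi), ∫ l in (0)..(ρ η), f l η * l

/-- The kernel `log |1 + ε z| - ε Re z`. -/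
def logKernel (ε : ℝ) (z : ℂ) : ℝ := Real.log ‖1 + (ε : ℂ) * z‖ - ε * z.re

/-- The stream function contribution of the patch itself, at its own boundary. -/
def Psi₁ (ε : ℝ) (r : ℝ → ℝ → ℝ) (φ θ : ℝ) : ℝ :=
  polarIntegral (radius ε r φ) fun l η =>
    Real.log ‖(radius ε r φ θ : ℂ) * cis θ - (l : ℂ) * cis η‖

/-- The contribution of the other patch in the upper half plane. -/
def Psi₂ (y₀ ξ₀ ε : ℝ) (r : ℝ → ℝ → ℝ) (φ θ : ℝ) : ℝ :=
  polarIntegral (radius ε r (φ + Real.pi)) fun l η =>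
    logKernel ε (((radius ε r φ θ : ℂ) * cis θ + (l : ℂ) * cis η) / (√(q y₀ ξ₀ φ) : ℂ))

/-- The contribution of the mirror image of the patch. -/
def Psi₃ (y₀ ξ₀ ε : ℝ) (r : ℝ → ℝ → ℝ) (φ θ : ℝ) : ℝ :=
  -polarIntegral (radius ε r φ) fun l η =>
    logKernel ε (((radius ε r φ θ : ℂ) * cis (θ + Theta y₀ ξ₀ φ)
      - (l : ℂ) * cis (-(η + Theta y₀ ξ₀ φ))) / w₃ y₀ ξ₀ φ)

/-- The contribution of the mirror image of the other patch. -/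
def Psi₄ (y₀ ξ₀ ε : ℝ) (r : ℝ → ℝ → ℝ) (φ θ : ℝ) : ℝ :=
  -polarIntegral (radius ε r (φ + Real.pi)) fun l η =>
    logKernel ε (((radius ε r φ θ : ℂ) * cis (θ + Theta y₀ ξ₀ φ)
      + (l : ℂ) * cis (-(η + Theta y₀ ξ₀ φ))) / w₄ y₀ ξ₀ φ)

/-- The functional `G(r) = ε³ω₀ ∂_φ r - ε³ω₀ Θ'(φ) ∂_θ r + ∑ₙ ∂_θ Ψₙ(ε, r)`. -/
def G (y₀ ξ₀ ε : ℝ) (r : ℝ → ℝ → ℝ) (φ θ : ℝ) : ℝ :=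
  ε ^ 3 * freq y₀ ξ₀ * deriv (fun x => r x θ) φ
    - ε ^ 3 * freq y₀ ξ₀ * deriv (Theta y₀ ξ₀) φ * deriv (r φ) θ
    + (deriv (Psi₁ ε r φ) θ + deriv (Psi₂ y₀ ξ₀ ε r φ) θ
      + deriv (Psi₃ y₀ ξ₀ ε r φ) θ + deriv (Psi₄ y₀ ξ₀ ε r φ) θ)

/-- `r` is admissible for `G`: the boundary curve is non-degenerate, and the four stream
functions have the `θ`-derivatives that occur in `G`. -/
structure Admissible (y₀ ξ₀ ε : ℝ) (r : ℝ → ℝ → ℝ) : Prop where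
  pos : ∀ φ θ, 0 < 1 + 2 * ε * r φ θ
  diff₁ : ∀ φ, Differentiable ℝ (Psi₁ ε r φ)
  diff₂ : ∀ φ, Differentiable ℝ (Psi₂ y₀ ξ₀ ε r φ)
  diff₃ : ∀ φ, Differentiable ℝ (Psi₃ y₀ ξ₀ ε r φ)
  diff₄ : ∀ φ, Differentiable ℝ (Psi₄ y₀ ξ₀ ε r φ)

/-! ### Function spaces -/

/-- Smooth functions on `𝕋²` with zero average in the space variable `θ`. -/
structure IsSmoothZeroMean (r : ℝ → ℝ → ℝ) : Prop where
  smooth : ContDiff ℝ ∞ (Function.uncurry r)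
  periodic_left : ∀ φ θ, r (φ + 2 * Real.pi) θ = r φ θ
  periodic_right : ∀ φ θ, r φ (θ + 2 * Real.pi) = r φ θ
  zeroMean : ∀ φ, ∫ θ in (0)..(2 * Real.pi), r φ θ = 0

/-- Fourier coefficients, with respect to the normalised measure of `𝕋²`. -/
def fourierCoeff (h : ℝ → ℝ → ℝ) (ℓ j : ℤ) : ℂ :=
  1 / (2 * (Real.pi : ℂ)) ^ 2 *
    ∫ φ in (0)..(2 * Real.pi), ∫ θ in (0)..(2 * Real.pi),
      (h φ θ : ℂ) * cis (-(ℓ * φ + j * θ))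

open Classical in
/-- The norm of `H^s(𝕋²)`, with value `∞` where it is not finite or `h` is not integrable. -/
def sobolevNorm (s : ℝ) (h : ℝ → ℝ → ℝ) : ℝ≥0∞ :=
  if MeasureTheory.IntegrableOn (Function.uncurry h)
      (Set.Ioc 0 (2 * Real.pi) ×ˢ Set.Ioc 0 (2 * Real.pi)) then
    (∑' k : ℤ × ℤ, ENNReal.ofReal
      ((1 + (k.1 : ℝ) ^ 2 + (k.2 : ℝ) ^ 2) ^ s * ‖fourierCoeff h k.1 k.2‖ ^ 2)) ^ (1 / 2 : ℝ)
  else ⊤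

/-- The weighted Lipschitz norm of a family `(h ξ₀)_{ξ₀ ∈ O}` of functions on `𝕋²`. -/
def lipNorm (O : Set ℝ) (lam s : ℝ) (h : ℝ → ℝ → ℝ → ℝ) : ℝ≥0∞ :=
  (⨆ ξ ∈ O, sobolevNorm s (h ξ)) +
    ENNReal.ofReal lam * ⨆ ξ₁ ∈ O, ⨆ ξ₂ ∈ O, ⨆ _ : ξ₁ ≠ ξ₂,
      sobolevNorm (s - 1) (h ξ₁ - h ξ₂) / ENNReal.ofReal |ξ₁ - ξ₂|

end Leapfrog

end

namespace Leapfrog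

open MeasureTheory Set Filter Topology

/-! ### Smooth dependence of integrals on parameters -/

/-! The profile is a sum of three harmonics, r = Re(a e^{2iθ} + b e^{3iθ} + c e^{4iθ}), whose
coefficients are chosen so that the functional cancels through order ε⁴. Since R² = 1 + 2ε²r, the
boundary is deformed at size ε², while ε is the ratio of the patch size to the mutual distances.

A patch acts on its own boundary linearly through the multiplier (1/2)(1 - 1/j) on the j-th
harmonic. The second order term is -(ε⁴/4) r², up to a function of φ (`exists_self_expansion`).
Another patch contributes Re(-(ε²/4)α²(1 + 2ε²r)e^{2iθ} + (ε³/6)α³e^{3iθ} - (ε⁴/8)α⁴e^{4iθ}), up to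
a function of φ and O(ε⁵), with a minus sign for the two mirror images. Here α is 1/√q, e^{iΘ}/w₃ or
e^{iΘ}/w₄ (`exists_interaction_expansion`). The deformation of the source does not enter, because
harmonics 2, 3, 4 change neither its area nor its centroid to this order.

Put A_n = α₂ⁿ - α₃ⁿ - α₄ⁿ, so that A_2 is the coefficient of g. Order ε² forces a = A_2 + O(ε).
Order ε³ forces b = -εA_3/2. At order ε⁴ the square of g creates a fourth harmonic, which c =
ε²(A_2² + A_4/3) removes together with the one from A_4. The transport term ω₀(∂_φ g - Θ'∂_θ g) is a
second harmonic and is removed by adding ε²c₂ to a, with c₂ = 2iω₀(A_2' - 2iΘ'A_2). What remains of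
G is O(ε⁵), and r - g is O(ε).

The delicate term is the self-interaction, whose kernel is singular on the boundary. Green's formula
(`integral_log_eq_boundary`) reduces it to a boundary integral, and |A - B e^{iu}|² = (2 - 2cos u)v
with v smooth and positive isolates the singularity. After one integration by parts, log(2 - 2cos u)
multiplies only B² = 1 + 2ε²r, where it acts by an explicit multiplier. The rest has a smooth
integrand and is Taylor expanded.

All expansions are exact identities: each remainder is a power of ε times a function that is smooth
in (ε, ξ₀, φ, θ) jointly. Compactness then gives all weighted Lipschitz bounds at once
(`exists_lipNorm_le`). This needs the orbit to depend smoothly on ξ₀. A conserved quantity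
determines the squared distance from the angle, the angle solves a scalar equation with positive
periodic speed, and quadrature together with the inverse function theorem gives the smoothness
(`exists_smooth_orbit`). Smooth cutoffs in ξ₀ and ε make all functions global. -/

theorem eventually_hasFDerivAt_intervalIntegral {E F : Type} [NormedAddCommGroup E]
    [NormedSpace ℝ E] [NormedAddCommGroup F] [NormedSpace ℝ F] {f : E → ℝ → F} {a b : ℝ} {p₀ : E}
    (h : ∀ t ∈ uIcc a b, ContDiffAt ℝ 1 (Function.uncurry f) (p₀, t)) :
    ∀ᶠ p in 𝓝 p₀, HasFDerivAt (fun p => ∫ t in a..b, f p t)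
      (∫ t in a..b, (fderiv ℝ (Function.uncurry f) (p, t)).comp (ContinuousLinearMap.inl ℝ E ℝ)) p := by
  set f' : E × ℝ → (E × ℝ →L[ℝ] F) := fderiv ℝ (Function.uncurry f) with hf'
  have hK : IsCompact (uIcc a b) := isCompact_uIcc
  -- Compactness of the interval turns a neighbourhood of (p₀, t) for each t into one neighbourhood
  -- of p₀ valid for all t. The same argument below gives a uniform bound of the derivative, which
  -- serves as the dominating constant.
  have h1 : ∀ᶠ p in 𝓝 p₀, ∀ t ∈ uIcc a b, ContDiffAt ℝ 1 (Function.uncurry f) (p, t) :=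
    hK.eventually_forall_of_forall_eventually fun t ht => (h t ht).eventually (by simp)
  have hc0 : ContinuousOn (fun t => f' (p₀, t)) (uIcc a b) := fun t ht =>
    (ContinuousAt.comp (f := fun t => (p₀, t)) (g := f')
      ((h t ht).fderiv_right (m := 0) (by simp)).continuousAt
      (by fun_prop)).continuousWithinAt
  obtain ⟨M, hM⟩ := hK.exists_bound_of_continuousOn hc0
  have h2 : ∀ᶠ p in 𝓝 p₀, ∀ t ∈ uIcc a b, ‖f' (p, t)‖ ≤ M + 1 := by
    refine hK.eventually_forall_of_forall_eventually (P := fun p t => ‖f' (p, t)‖ ≤ M + 1)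
      fun t ht => ?_
    have hc : ContinuousAt (fun z => ‖f' z‖) (p₀, t) :=
      ((h t ht).fderiv_right (m := 0) (by simp)).continuousAt.norm
    have : ‖f' (p₀, t)‖ < M + 1 := lt_of_le_of_lt (hM t ht) (by linarith)
    exact (hc.eventually (gt_mem_nhds this)).mono fun z hz => le_of_lt hz
  have h12 := (h1.and h2).eventually_nhds
  filter_upwards [h12] with p hp
  have hcont : ∀ x, (∀ t ∈ uIcc a b, ContDiffAt ℝ 1 (Function.uncurry f) (x, t)) →
      ContinuousOn (f x) (uIcc a b) := fun x hx t ht =>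
    (ContinuousAt.comp (f := fun t => (x, t)) (g := Function.uncurry f)
      (hx t ht).continuousAt (by fun_prop)).continuousWithinAt
  have hp0 := hp.self_of_nhds
  have hsub : ∀ t ∈ uIoc a b, t ∈ uIcc a b := fun t ht => uIoc_subset_uIcc ht
  refine intervalIntegral.hasFDerivAt_integral_of_dominated_of_fderiv_le
    (F' := fun p t => (f' (p, t)).comp (ContinuousLinearMap.inl ℝ E ℝ))
    (bound := fun _ => (M + 1) * ‖ContinuousLinearMap.inl ℝ E ℝ‖) hp ?_ ?_ ?_ ?_ ?_ ?_
  · filter_upwards [hp] with x hx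
    exact ((hcont x hx.1).mono uIoc_subset_uIcc).aestronglyMeasurable measurableSet_uIoc
  · exact (hcont p hp0.1).intervalIntegrable
  · refine ContinuousOn.aestronglyMeasurable (fun t ht => ?_) measurableSet_uIoc
    have := (ContinuousAt.comp (f := fun t => (p, t)) (g := f')
      ((hp0.1 t (hsub t ht)).fderiv_right (m := 0) (by simp)).continuousAt (by fun_prop))
    exact (this.clm_comp continuousAt_const).continuousWithinAt
  · refine Eventually.of_forall fun t ht x hx => ?_
    exact (ContinuousLinearMap.opNorm_comp_le _ _).trans
      (mul_le_mul_of_nonneg_right (hx.2 t (hsub t ht)) (norm_nonneg _))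
  · exact intervalIntegrable_const
  · refine Eventually.of_forall fun t ht x hx => ?_
    have h3 := ((hx.1 t (hsub t ht)).differentiableAt (by simp)).hasFDerivAt
    exact HasFDerivAt.comp (g := Function.uncurry f) (f := fun x => (x, t)) x h3
      (hasFDerivAt_prodMk_left x t)

/-- Induction on n by differentiating under the integral. The partial derivative takes values in
another space, so the target is quantified inside the induction. One order of smoothness is spent on
the domination, which is harmless for smooth integrands. -/
theorem contDiffAt_intervalIntegral_nat {E : Type} [NormedAddCommGroup E] [NormedSpace ℝ E]
    (n : ℕ) : ∀ {F : Type} [NormedAddCommGroup F] [NormedSpace ℝ F] {f : E → ℝ → F} {a b : ℝ}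
    {p₀ : E}, (∀ t ∈ uIcc a b, ContDiffAt ℝ (n + 1 : ℕ) (Function.uncurry f) (p₀, t)) →
    ContDiffAt ℝ n (fun p => ∫ t in a..b, f p t) p₀ := by
  induction n with
  | zero =>
    intro F _ _ f a b p₀ h
    have := eventually_hasFDerivAt_intervalIntegral (f := f) (a := a) (b := b) (p₀ := p₀)
      (by simpa using h)
    refine contDiffAt_zero.2 ⟨_, this, fun x hx => ?_⟩
    exact (HasFDerivAt.continuousAt hx).continuousWithinAt
  | succ n ih =>
    intro F _ _ f a b p₀ h
    have h1 := eventually_hasFDerivAt_intervalIntegral (f := f) (a := a) (b := b) (p₀ := p₀)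
      (fun t ht => (h t ht).of_le (by norm_cast; omega))
    refine contDiffAt_succ_iff_hasFDerivAt.2 ⟨_, ⟨_, h1, fun x hx => hx⟩, ?_⟩
    refine ih fun t ht => ?_
    have h2 : ContDiffAt ℝ (n + 1 : ℕ) (fderiv ℝ (Function.uncurry f)) (p₀, t) :=
      (h t ht).fderiv_right (by norm_cast)
    exact h2.clm_comp contDiffAt_const

/-- If `f` is smooth at all points `(p₀, t)` with `t ∈ [a, b]`, then `p ↦ ∫ t in a..b, f p t` is
smooth at `p₀`. -/
theorem contDiffAt_intervalIntegral {E F : Type} [NormedAddCommGroup E] [NormedSpace ℝ E]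
    [NormedAddCommGroup F] [NormedSpace ℝ F] {f : E → ℝ → F} {a b : ℝ} {p₀ : E}
    (h : ∀ t ∈ uIcc a b, ContDiffAt ℝ ∞ (Function.uncurry f) (p₀, t)) :
    ContDiffAt ℝ ∞ (fun p => ∫ t in a..b, f p t) p₀ :=
  contDiffAt_infty.2 fun n => contDiffAt_intervalIntegral_nat n fun t ht =>
    contDiffAt_infty.1 (h t ht) _

theorem contDiff_intervalIntegral {E F : Type} [NormedAddCommGroup E] [NormedSpace ℝ E]
    [NormedAddCommGroup F] [NormedSpace ℝ F] {f : E → ℝ → F} {a b : ℝ}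
    (h : ContDiff ℝ ∞ (Function.uncurry f)) :
    ContDiff ℝ ∞ (fun p => ∫ t in a..b, f p t) :=
  contDiff_iff_contDiffAt.2 fun _ => contDiffAt_intervalIntegral fun _ _ => h.contDiffAt

/-! ### Sobolev norms of smooth families -/

theorem continuous_cis : Continuous cis := by unfold cis; fun_prop

theorem norm_cis (x : ℝ) : ‖cis x‖ = 1 := by
  rw [cis, mul_comm]; exact Complex.norm_exp_ofReal_mul_I x

theorem cis_eq (x : ℝ) : cis x = (Real.cos x : ℂ) + (Real.sin x : ℂ) * Complex.I := by
  rw [cis, mul_comm, Complex.exp_mul_I]; simp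

theorem cis_add (x y : ℝ) : cis (x + y) = cis x * cis y := by
  simp only [cis]; rw [← Complex.exp_add]; push_cast; ring_nf

theorem cis_int_mul_two_pi (n : ℤ) : cis (n * (2 * Real.pi)) = 1 := by
  rw [cis, ← Complex.exp_int_mul_two_pi_mul_I n]; push_cast; ring_nf

theorem hasDerivAt_cis_comp {f : ℝ → ℝ} {f' x : ℝ} (hf : HasDerivAt f f' x) :
    HasDerivAt (fun x => cis (f x)) (Complex.I * f' * cis (f x)) x := by
  have h := ((hf.ofReal_comp).const_mul Complex.I).cexp
  refine h.congr_deriv ?_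
  simp only [cis]; ring

theorem continuous_uncurry_kernel {f : ℝ → ℝ → ℝ} (hf : Continuous (Function.uncurry f)) (ℓ j : ℤ) :
    Continuous (fun p : ℝ × ℝ => (f p.1 p.2 : ℂ) * cis (-(ℓ * p.1 + j * p.2))) := by
  have h1 : Continuous fun p : ℝ × ℝ => f p.1 p.2 := hf
  have := continuous_cis
  fun_prop

theorem fourierCoeff_swap {f : ℝ → ℝ → ℝ} (hf : Continuous (Function.uncurry f)) (ℓ j : ℤ) :
    fourierCoeff (fun x y => f y x) j ℓ = fourierCoeff f ℓ j := by
  unfold fourierCoeff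
  congr 1
  have hc := continuous_uncurry_kernel hf ℓ j
  have hInt : IntegrableOn (fun p : ℝ × ℝ => (f p.1 p.2 : ℂ) * cis (-(ℓ * p.1 + j * p.2)))
      (uIoc 0 (2 * Real.pi) ×ˢ uIoc 0 (2 * Real.pi)) :=
    (hc.continuousOn.integrableOn_compact (isCompact_uIcc.prod isCompact_uIcc)).mono_set
      (prod_mono uIoc_subset_uIcc uIoc_subset_uIcc)
  have := intervalIntegral_intervalIntegral_swap
    (F := fun φ θ => (f φ θ : ℂ) * cis (-(ℓ * φ + j * θ))) hInt
  rw [this]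
  simp only [add_comm]

theorem fourierCoeff_deriv_right {f f' : ℝ → ℝ → ℝ}
    (hf' : ∀ φ, Continuous (f' φ)) (hd : ∀ φ θ, HasDerivAt (f φ) (f' φ θ) θ)
    (hper : ∀ φ θ, f φ (θ + 2 * Real.pi) = f φ θ) (ℓ j : ℤ) :
    fourierCoeff f' ℓ j = (Complex.I * j) * fourierCoeff f ℓ j := by
  unfold fourierCoeff
  have key : ∀ φ, (∫ θ in (0)..(2 * Real.pi), (f' φ θ : ℂ) * cis (-(ℓ * φ + j * θ)))
      = (Complex.I * j) * ∫ θ in (0)..(2 * Real.pi), (f φ θ : ℂ) * cis (-(ℓ * φ + j * θ)) := by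
    intro φ
    have hcf : Continuous (f φ) := continuous_iff_continuousAt.2 fun θ => (hd φ θ).continuousAt
    have hc1 : Continuous fun θ => (f' φ θ : ℂ) * cis (-(ℓ * φ + j * θ)) := by
      have := continuous_cis; have := hf' φ; fun_prop
    have hc2 : Continuous fun θ => (f φ θ : ℂ) * cis (-(ℓ * φ + j * θ)) := by
      have := continuous_cis; fun_prop
    have hder : ∀ θ ∈ uIcc 0 (2 * Real.pi), HasDerivAt
        (fun θ => (f φ θ : ℂ) * cis (-(ℓ * φ + j * θ)))
        ((f' φ θ : ℂ) * cis (-(ℓ * φ + j * θ))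
          - (Complex.I * j) * ((f φ θ : ℂ) * cis (-(ℓ * φ + j * θ)))) θ := by
      intro θ _
      have h1 : HasDerivAt (fun θ : ℝ => -((ℓ : ℝ) * φ + j * θ)) (-(j : ℝ)) θ := by
        exact ((((hasDerivAt_id' θ).const_mul (j : ℝ)).const_add ((ℓ : ℝ) * φ)).fun_neg).congr_deriv
          (by simp)
      refine ((hd φ θ).ofReal_comp.mul (hasDerivAt_cis_comp h1)).congr_deriv ?_
      push_cast; ring
    have := intervalIntegral.integral_eq_sub_of_hasDerivAt hder
      ((hc1.intervalIntegrable _ _).sub ((hc2.intervalIntegrable _ _).const_mul _))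
    rw [intervalIntegral.integral_sub (hc1.intervalIntegrable _ _)
      ((hc2.intervalIntegrable _ _).const_mul _),
      intervalIntegral.integral_const_mul] at this
    have hz : (f φ (2 * Real.pi) : ℂ) * cis (-(ℓ * φ + j * (2 * Real.pi)))
        - (f φ 0 : ℂ) * cis (-(ℓ * φ + j * 0)) = 0 := by
      have h1 : f φ (2 * Real.pi) = f φ 0 := by simpa using hper φ 0
      have h2 : cis (-(ℓ * φ + j * (2 * Real.pi))) = cis (-(ℓ * φ + j * 0)) := by
        have : -(ℓ * φ + j * (2 * Real.pi)) = -(ℓ * φ + j * 0) + ((-j : ℤ) : ℝ) * (2 * Real.pi) := by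
          push_cast; ring
        rw [this, cis_add, cis_int_mul_two_pi, mul_one]
      rw [h1, h2, sub_self]
    rw [hz] at this
    exact sub_eq_zero.1 this
  simp_rw [key, intervalIntegral.integral_const_mul]
  ring

/-- Fubini exchanges the two variables and reduces this to the integration by parts in θ. -/
theorem fourierCoeff_deriv_left {f f' : ℝ → ℝ → ℝ} (hf : Continuous (Function.uncurry f))
    (hf' : Continuous (Function.uncurry f')) (hd : ∀ φ θ, HasDerivAt (fun x => f x θ) (f' φ θ) φ)
    (hper : ∀ φ θ, f (φ + 2 * Real.pi) θ = f φ θ) (ℓ j : ℤ) :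
    fourierCoeff f' ℓ j = (Complex.I * ℓ) * fourierCoeff f ℓ j := by
  rw [← fourierCoeff_swap hf, ← fourierCoeff_swap hf']
  exact fourierCoeff_deriv_right (fun φ => by
    have : Continuous fun p : ℝ × ℝ => f' p.1 p.2 := hf'
    fun_prop) (fun φ θ => hd θ φ) (fun φ θ => hper θ φ) j ℓ

theorem fourierCoeff_lin {f g : ℝ → ℝ → ℝ} (hf : Continuous (Function.uncurry f))
    (hg : Continuous (Function.uncurry g)) (a b : ℝ) (ℓ j : ℤ) :
    fourierCoeff (fun x y => a * f x y + b * g x y) ℓ j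
      = a * fourierCoeff f ℓ j + b * fourierCoeff g ℓ j := by
  unfold fourierCoeff
  have hcf := continuous_uncurry_kernel hf ℓ j
  have hcg := continuous_uncurry_kernel hg ℓ j
  have hpf : ∀ φ, Continuous fun θ => (f φ θ : ℂ) * cis (-(ℓ * φ + j * θ)) := fun φ =>
    hcf.comp (f := fun θ => (φ, θ)) (by fun_prop)
  have hpg : ∀ φ, Continuous fun θ => (g φ θ : ℂ) * cis (-(ℓ * φ + j * θ)) := fun φ =>
    hcg.comp (f := fun θ => (φ, θ)) (by fun_prop)
  have hif := intervalIntegral.continuous_parametric_intervalIntegral_of_continuous'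
    (μ := volume) (f := fun φ θ => (f φ θ : ℂ) * cis (-(ℓ * φ + j * θ))) hcf 0 (2 * Real.pi)
  have hig := intervalIntegral.continuous_parametric_intervalIntegral_of_continuous'
    (μ := volume) (f := fun φ θ => (g φ θ : ℂ) * cis (-(ℓ * φ + j * θ))) hcg 0 (2 * Real.pi)
  have : ∀ φ, (∫ θ in (0)..(2 * Real.pi), ((a * f φ θ + b * g φ θ : ℝ) : ℂ) * cis (-(ℓ * φ + j * θ)))
      = a * (∫ θ in (0)..(2 * Real.pi), (f φ θ : ℂ) * cis (-(ℓ * φ + j * θ)))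
      + b * (∫ θ in (0)..(2 * Real.pi), (g φ θ : ℂ) * cis (-(ℓ * φ + j * θ))) := by
    intro φ
    rw [← intervalIntegral.integral_const_mul, ← intervalIntegral.integral_const_mul,
      ← intervalIntegral.integral_add (((hpf φ).intervalIntegrable _ _).const_mul _)
        (((hpg φ).intervalIntegrable _ _).const_mul _)]
    congr 1; ext θ; push_cast; ring
  simp_rw [this]
  rw [intervalIntegral.integral_add ((hif.intervalIntegrable _ _).const_mul _)
        ((hig.intervalIntegrable _ _).const_mul _),
    intervalIntegral.integral_const_mul, intervalIntegral.integral_const_mul]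
  ring

theorem norm_fourierCoeff_le {f : ℝ → ℝ → ℝ} {M : ℝ}
    (hM : ∀ φ ∈ Icc 0 (2 * Real.pi), ∀ θ ∈ Icc 0 (2 * Real.pi), |f φ θ| ≤ M) (ℓ j : ℤ) :
    ‖fourierCoeff f ℓ j‖ ≤ M := by
  have hpi := Real.pi_pos
  have h2 : (0 : ℝ) ≤ 2 * Real.pi := by positivity
  have hsub : ∀ x ∈ uIoc 0 (2 * Real.pi), x ∈ Icc 0 (2 * Real.pi) := by
    intro x hx; rw [uIoc_of_le h2] at hx; exact ⟨hx.1.le, hx.2⟩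
  have h1 : ‖∫ φ in (0)..(2 * Real.pi), ∫ θ in (0)..(2 * Real.pi),
      (f φ θ : ℂ) * cis (-(ℓ * φ + j * θ))‖ ≤ (M * |2 * Real.pi - 0|) * |2 * Real.pi - 0| := by
    refine intervalIntegral.norm_integral_le_of_norm_le_const fun φ hφ => ?_
    refine intervalIntegral.norm_integral_le_of_norm_le_const fun θ hθ => ?_
    rw [norm_mul, norm_cis, mul_one, Complex.norm_real]
    exact hM φ (hsub φ hφ) θ (hsub θ hθ)
  unfold fourierCoeff
  rw [norm_mul]
  have h3 : ‖(1 / (2 * (Real.pi : ℂ)) ^ 2)‖ = 1 / (2 * Real.pi) ^ 2 := by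
    simp [abs_of_pos hpi]
  rw [h3]
  rw [sub_zero, abs_of_nonneg h2] at h1
  calc _ ≤ 1 / (2 * Real.pi) ^ 2 * (M * (2 * Real.pi) * (2 * Real.pi)) := by gcongr
    _ = M := by field_simp

theorem summable_int_one_div_one_add_sq : Summable fun n : ℤ => 1 / (1 + (n : ℝ) ^ 2) := by
  have h1 : Summable fun n : ℤ => 1 / (n : ℝ) ^ 2 := Real.summable_one_div_int_pow.2 (by norm_num)
  -- The comparison fails only at n = 0, where 1 / n² has the value 0.
  refine Summable.of_norm_bounded_eventually h1 ?_
  rw [Filter.eventually_cofinite]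
  refine (Set.finite_singleton (0 : ℤ)).subset fun n hn => ?_
  by_contra h0
  apply hn
  have : (n : ℝ) ≠ 0 := by exact_mod_cast h0
  rw [Real.norm_of_nonneg (by positivity)]
  gcongr; linarith

/-- The weight dominates a product: (1 + m² + n²)² ≥ (1 + m²)(1 + n²). -/
theorem summable_weight :
    Summable fun k : ℤ × ℤ => 1 / (1 + (k.1 : ℝ) ^ 2 + (k.2 : ℝ) ^ 2) ^ 2 := by
  have h := summable_int_one_div_one_add_sq.mul_of_nonneg summable_int_one_div_one_add_sq
    (fun n => by positivity) (fun n => by positivity)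
  refine Summable.of_nonneg_of_le (fun k => by positivity) (fun k => ?_) h
  rw [div_mul_div_comm, one_mul]
  have h1 := sq_nonneg (k.1 : ℝ)
  have h2 := sq_nonneg (k.2 : ℝ)
  gcongr
  nlinarith

/-- A bound on the Sobolev norm from the decay of the Fourier coefficients. -/
theorem exists_sobolevNorm_le : ∃ K : ℝ, 0 < K ∧ ∀ (s : ℝ) (N : ℕ) (f : ℝ → ℝ → ℝ) (M : ℝ),
    s + 2 ≤ 2 * N → Continuous (Function.uncurry f) → 0 ≤ M →
    (∀ ℓ j : ℤ, (1 + (ℓ : ℝ) ^ 2 + (j : ℝ) ^ 2) ^ N * ‖fourierCoeff f ℓ j‖ ≤ M) →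
    sobolevNorm s f ≤ ENNReal.ofReal (K * M) := by
  set W := ∑' k : ℤ × ℤ, 1 / (1 + (k.1 : ℝ) ^ 2 + (k.2 : ℝ) ^ 2) ^ 2 with hW
  have hW0 : 0 ≤ W := tsum_nonneg fun k => by positivity
  refine ⟨√W + 1, by positivity, fun s N f M hs hf hM hb => ?_⟩
  have hInt : IntegrableOn (Function.uncurry f)
      (Ioc 0 (2 * Real.pi) ×ˢ Ioc 0 (2 * Real.pi)) :=
    (hf.continuousOn.integrableOn_compact
      (isCompact_Icc.prod isCompact_Icc)).mono_set (prod_mono Ioc_subset_Icc_self Ioc_subset_Icc_self)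
  rw [sobolevNorm, if_pos hInt]
  have hterm : ∀ k : ℤ × ℤ, (1 + (k.1 : ℝ) ^ 2 + (k.2 : ℝ) ^ 2) ^ s * ‖fourierCoeff f k.1 k.2‖ ^ 2
      ≤ M ^ 2 * (1 / (1 + (k.1 : ℝ) ^ 2 + (k.2 : ℝ) ^ 2) ^ 2) := by
    intro k
    set x := 1 + (k.1 : ℝ) ^ 2 + (k.2 : ℝ) ^ 2 with hx
    have hx1 : 1 ≤ x := by rw [hx]; nlinarith [sq_nonneg (k.1 : ℝ), sq_nonneg (k.2 : ℝ)]
    have hx0 : 0 < x := by linarith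
    -- The two spare powers in s + 2 ≤ 2N leave the factor x⁻², which is summable over ℤ².
    have h1 : x ^ s * x ^ 2 ≤ x ^ (2 * N) := by
      rw [← Real.rpow_natCast x 2, ← Real.rpow_natCast x (2 * N), ← Real.rpow_add hx0]
      exact Real.rpow_le_rpow_of_exponent_le hx1 (by push_cast; linarith)
    have h2 : (x ^ N * ‖fourierCoeff f k.1 k.2‖) ^ 2 ≤ M ^ 2 :=
      pow_le_pow_left₀ (by positivity) (hb k.1 k.2) 2
    rw [mul_one_div, le_div_iff₀ (by positivity)]
    calc x ^ s * ‖fourierCoeff f k.1 k.2‖ ^ 2 * x ^ 2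
        = (x ^ s * x ^ 2) * ‖fourierCoeff f k.1 k.2‖ ^ 2 := by ring
      _ ≤ x ^ (2 * N) * ‖fourierCoeff f k.1 k.2‖ ^ 2 := by gcongr
      _ = (x ^ N * ‖fourierCoeff f k.1 k.2‖) ^ 2 := by ring
      _ ≤ M ^ 2 := h2
  have hsum : (∑' k : ℤ × ℤ, ENNReal.ofReal
      ((1 + (k.1 : ℝ) ^ 2 + (k.2 : ℝ) ^ 2) ^ s * ‖fourierCoeff f k.1 k.2‖ ^ 2))
      ≤ ENNReal.ofReal (M ^ 2 * W) := by
    rw [hW, ← tsum_mul_left, ENNReal.ofReal_tsum_of_nonneg (fun k => by positivity)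
      (summable_weight.mul_left _)]
    exact ENNReal.tsum_le_tsum fun k => ENNReal.ofReal_le_ofReal (hterm k)
  calc _ ≤ (ENNReal.ofReal (M ^ 2 * W)) ^ (1 / 2 : ℝ) := ENNReal.rpow_le_rpow hsum (by norm_num)
    _ = ENNReal.ofReal ((M ^ 2 * W) ^ (1 / 2 : ℝ)) :=
        ENNReal.ofReal_rpow_of_nonneg (by positivity) (by norm_num)
    _ ≤ _ := by
        apply ENNReal.ofReal_le_ofReal
        rw [← Real.sqrt_eq_rpow, Real.sqrt_mul (by positivity), Real.sqrt_sq hM]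
        nlinarith

/-! ### Derivatives of smooth families and the powers of 1 - Δ. -/

/-- The derivative of `h` in the direction `v`. -/
noncomputable def dirDeriv {E : Type} [NormedAddCommGroup E] [NormedSpace ℝ E] (v : E) (h : E → ℝ)
    (p : E) : ℝ :=
  fderiv ℝ h p v

theorem contDiff_dirDeriv {E : Type} [NormedAddCommGroup E] [NormedSpace ℝ E] {h : E → ℝ}
    (hh : ContDiff ℝ ∞ h) (v : E) : ContDiff ℝ ∞ (dirDeriv v h) :=
  (hh.fderiv_right (m := ∞) (by simp)).clm_apply contDiff_const

theorem hasDerivAt_comp_dirDeriv {E : Type} [NormedAddCommGroup E] [NormedSpace ℝ E] {h : E → ℝ}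
    (hh : ContDiff ℝ ∞ h) {γ : ℝ → E} {v : E} {t : ℝ} (hγ : HasDerivAt γ v t) :
    HasDerivAt (fun t => h (γ t)) (dirDeriv v h (γ t)) t :=
  ((hh.differentiable (by simp)) (γ t)).hasFDerivAt.comp_hasDerivAt t hγ

theorem hasDerivAt_family_θ {h : (ℝ × ℝ × ℝ) × ℝ → ℝ} (hh : ContDiff ℝ ∞ h) (ε ξ φ θ : ℝ) :
    HasDerivAt (fun θ => h ((ε, ξ, φ), θ)) (dirDeriv ((0, 0, 0), 1) h ((ε, ξ, φ), θ)) θ :=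
  hasDerivAt_comp_dirDeriv (γ := fun θ => ((ε, ξ, φ), θ)) hh
    ((hasDerivAt_const _ _).prodMk (hasDerivAt_id' θ))

theorem hasDerivAt_family_φ {h : (ℝ × ℝ × ℝ) × ℝ → ℝ} (hh : ContDiff ℝ ∞ h) (ε ξ φ θ : ℝ) :
    HasDerivAt (fun φ => h ((ε, ξ, φ), θ)) (dirDeriv ((0, 0, 1), 0) h ((ε, ξ, φ), θ)) φ :=
  hasDerivAt_comp_dirDeriv (γ := fun φ => ((ε, ξ, φ), θ)) hh
    (((hasDerivAt_const _ _).prodMk ((hasDerivAt_const _ _).prodMk (hasDerivAt_id' φ))).prodMk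
      (hasDerivAt_const _ _))

theorem hasDerivAt_family_ξ {h : (ℝ × ℝ × ℝ) × ℝ → ℝ} (hh : ContDiff ℝ ∞ h) (ε ξ φ θ : ℝ) :
    HasDerivAt (fun ξ => h ((ε, ξ, φ), θ)) (dirDeriv ((0, 1, 0), 0) h ((ε, ξ, φ), θ)) ξ :=
  hasDerivAt_comp_dirDeriv (γ := fun ξ => ((ε, ξ, φ), θ)) hh
    (((hasDerivAt_const _ _).prodMk ((hasDerivAt_id' ξ).prodMk (hasDerivAt_const _ _))).prodMk
      (hasDerivAt_const _ _))

/-- `(ε, ξ)`-slice of a family. -/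
def slice (h : (ℝ × ℝ × ℝ) × ℝ → ℝ) (ε ξ φ θ : ℝ) : ℝ := h ((ε, ξ, φ), θ)

/-- `2π`-periodicity in both variables. -/
def IsPeriodic (f : ℝ → ℝ → ℝ) : Prop :=
  (∀ φ θ, f (φ + 2 * Real.pi) θ = f φ θ) ∧ ∀ φ θ, f φ (θ + 2 * Real.pi) = f φ θ

theorem continuous_slice {h : (ℝ × ℝ × ℝ) × ℝ → ℝ} (hh : ContDiff ℝ ∞ h) (ε ξ : ℝ) :
    Continuous (Function.uncurry (slice h ε ξ)) := by
  have := hh.continuous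
  change Continuous fun p : ℝ × ℝ => h ((ε, ξ, p.1), p.2)
  fun_prop

theorem isPeriodic_slice_dirDeriv_θ {h : (ℝ × ℝ × ℝ) × ℝ → ℝ} (hh : ContDiff ℝ ∞ h) {ε ξ : ℝ}
    (hp : IsPeriodic (slice h ε ξ)) :
    IsPeriodic (slice (dirDeriv ((0, 0, 0), 1) h) ε ξ) := by
  refine ⟨fun φ θ => ?_, fun φ θ => ?_⟩
  · have h1 := hasDerivAt_family_θ hh ε ξ (φ + 2 * Real.pi) θ
    have h2 := hasDerivAt_family_θ hh ε ξ φ θ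
    have h3 : (fun θ => h ((ε, ξ, φ + 2 * Real.pi), θ)) = fun θ => h ((ε, ξ, φ), θ) :=
      funext fun θ => hp.1 φ θ
    rw [h3] at h1
    exact h1.unique h2
  · have h1 := (hasDerivAt_family_θ hh ε ξ φ (θ + 2 * Real.pi)).comp_add_const θ (2 * Real.pi)
    have h2 := hasDerivAt_family_θ hh ε ξ φ θ
    have h3 : (fun θ => h ((ε, ξ, φ), θ + 2 * Real.pi)) = fun θ => h ((ε, ξ, φ), θ) :=
      funext fun θ => hp.2 φ θ
    rw [h3] at h1
    exact h1.unique h2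

theorem isPeriodic_slice_dirDeriv_φ {h : (ℝ × ℝ × ℝ) × ℝ → ℝ} (hh : ContDiff ℝ ∞ h) {ε ξ : ℝ}
    (hp : IsPeriodic (slice h ε ξ)) :
    IsPeriodic (slice (dirDeriv ((0, 0, 1), 0) h) ε ξ) := by
  refine ⟨fun φ θ => ?_, fun φ θ => ?_⟩
  · have h1 := (hasDerivAt_family_φ hh ε ξ (φ + 2 * Real.pi) θ).comp_add_const φ (2 * Real.pi)
    have h2 := hasDerivAt_family_φ hh ε ξ φ θ
    have h3 : (fun φ => h ((ε, ξ, φ + 2 * Real.pi), θ)) = fun φ => h ((ε, ξ, φ), θ) :=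
      funext fun φ => hp.1 φ θ
    rw [h3] at h1
    exact h1.unique h2
  · have h1 := hasDerivAt_family_φ hh ε ξ φ (θ + 2 * Real.pi)
    have h2 := hasDerivAt_family_φ hh ε ξ φ θ
    have h3 : (fun φ => h ((ε, ξ, φ), θ + 2 * Real.pi)) = fun φ => h ((ε, ξ, φ), θ) :=
      funext fun φ => hp.2 φ θ
    rw [h3] at h1
    exact h1.unique h2

/-- The operator `1 - Δ` on the torus. -/
noncomputable def bessel (h : (ℝ × ℝ × ℝ) × ℝ → ℝ) : (ℝ × ℝ × ℝ) × ℝ → ℝ := fun p =>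
  h p - (dirDeriv ((0, 0, 1), 0) (dirDeriv ((0, 0, 1), 0) h) p
    + dirDeriv ((0, 0, 0), 1) (dirDeriv ((0, 0, 0), 1) h) p)

theorem contDiff_bessel {h : (ℝ × ℝ × ℝ) × ℝ → ℝ} (hh : ContDiff ℝ ∞ h) : ContDiff ℝ ∞ (bessel h) :=
  hh.sub ((contDiff_dirDeriv (contDiff_dirDeriv hh _) _).add
    (contDiff_dirDeriv (contDiff_dirDeriv hh _) _))

theorem isPeriodic_slice_bessel {h : (ℝ × ℝ × ℝ) × ℝ → ℝ} (hh : ContDiff ℝ ∞ h) {ε ξ : ℝ}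
    (hp : IsPeriodic (slice h ε ξ)) : IsPeriodic (slice (bessel h) ε ξ) := by
  have h1 := isPeriodic_slice_dirDeriv_φ (contDiff_dirDeriv hh _) (isPeriodic_slice_dirDeriv_φ hh hp)
  have h2 := isPeriodic_slice_dirDeriv_θ (contDiff_dirDeriv hh _) (isPeriodic_slice_dirDeriv_θ hh hp)
  refine ⟨fun φ θ => ?_, fun φ θ => ?_⟩
  · exact congrArg₂ (· - ·) (hp.1 φ θ) (congrArg₂ (· + ·) (h1.1 φ θ) (h2.1 φ θ))
  · exact congrArg₂ (· - ·) (hp.2 φ θ) (congrArg₂ (· + ·) (h1.2 φ θ) (h2.2 φ θ))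

/-- Two integrations by parts in each variable: 1 - (iℓ)² - (ij)² = 1 + ℓ² + j². Sup bounds on
powers of 1 - Δ thereby become decay of the Fourier coefficients. -/
theorem fourierCoeff_bessel {h : (ℝ × ℝ × ℝ) × ℝ → ℝ} (hh : ContDiff ℝ ∞ h) {ε ξ : ℝ}
    (hp : IsPeriodic (slice h ε ξ)) (ℓ j : ℤ) :
    fourierCoeff (slice (bessel h) ε ξ) ℓ j
      = ((1 + (ℓ : ℝ) ^ 2 + (j : ℝ) ^ 2 : ℝ) : ℂ) * fourierCoeff (slice h ε ξ) ℓ j := by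
  set hφ := dirDeriv ((0, 0, 1), 0) h with hφ_def
  set hφφ := dirDeriv ((0, 0, 1), 0) hφ with hφφ_def
  set hθ := dirDeriv ((0, 0, 0), 1) h with hθ_def
  set hθθ := dirDeriv ((0, 0, 0), 1) hθ with hθθ_def
  have sφ : ContDiff ℝ ∞ hφ := contDiff_dirDeriv hh _
  have sφφ : ContDiff ℝ ∞ hφφ := contDiff_dirDeriv sφ _
  have sθ : ContDiff ℝ ∞ hθ := contDiff_dirDeriv hh _
  have sθθ : ContDiff ℝ ∞ hθθ := contDiff_dirDeriv sθ _
  have pφ : IsPeriodic (slice hφ ε ξ) := isPeriodic_slice_dirDeriv_φ hh hp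
  have pθ : IsPeriodic (slice hθ ε ξ) := isPeriodic_slice_dirDeriv_θ hh hp
  have cs : ∀ {k : (ℝ × ℝ × ℝ) × ℝ → ℝ}, ContDiff ℝ ∞ k → ∀ φ, Continuous (slice k ε ξ φ) := by
    intro k hk φ
    exact (continuous_slice hk ε ξ).comp (f := fun θ => (φ, θ)) (by fun_prop)
  have e1 := fourierCoeff_deriv_left (continuous_slice hh ε ξ) (continuous_slice sφ ε ξ)
    (fun φ θ => hasDerivAt_family_φ hh ε ξ φ θ) hp.1 ℓ j
  have e2 := fourierCoeff_deriv_left (continuous_slice sφ ε ξ) (continuous_slice sφφ ε ξ)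
    (fun φ θ => hasDerivAt_family_φ sφ ε ξ φ θ) pφ.1 ℓ j
  have e3 := fourierCoeff_deriv_right (f := slice h ε ξ) (cs sθ)
    (fun φ θ => hasDerivAt_family_θ hh ε ξ φ θ) hp.2 ℓ j
  have e4 := fourierCoeff_deriv_right (f := slice hθ ε ξ) (cs sθθ)
    (fun φ θ => hasDerivAt_family_θ sθ ε ξ φ θ) pθ.2 ℓ j
  have l1 := fourierCoeff_lin (continuous_slice sφφ ε ξ) (continuous_slice sθθ ε ξ) 1 1 ℓ j
  have hc : Continuous (Function.uncurry
      fun x y => 1 * slice hφφ ε ξ x y + 1 * slice hθθ ε ξ x y) :=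
    (continuous_const.mul (continuous_slice sφφ ε ξ)).add
      (continuous_const.mul (continuous_slice sθθ ε ξ))
  have l2 := fourierCoeff_lin (continuous_slice hh ε ξ)
    (g := fun x y => 1 * slice hφφ ε ξ x y + 1 * slice hθθ ε ξ x y)
    hc 1 (-1) ℓ j
  have hb : slice (bessel h) ε ξ = fun x y => 1 * slice h ε ξ x y
      + -1 * (1 * slice hφφ ε ξ x y + 1 * slice hθθ ε ξ x y) := by
    ext x y; simp only [slice, bessel]; ring
  rw [hb, l2, l1, e2, e1, e4, e3]
  push_cast
  linear_combination (-(ℓ : ℂ) ^ 2 * fourierCoeff (slice h ε ξ) ℓ j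
    - (j : ℂ) ^ 2 * fourierCoeff (slice h ε ξ) ℓ j) * Complex.I_sq

theorem contDiff_bessel_iterate {h : (ℝ × ℝ × ℝ) × ℝ → ℝ} (hh : ContDiff ℝ ∞ h) (N : ℕ) :
    ContDiff ℝ ∞ (bessel^[N] h) := by
  induction N with
  | zero => simpa using hh
  | succ N ih => rw [Function.iterate_succ_apply']; exact contDiff_bessel ih

theorem fourierCoeff_bessel_iterate {h : (ℝ × ℝ × ℝ) × ℝ → ℝ} (hh : ContDiff ℝ ∞ h) {ε ξ : ℝ}
    (hp : IsPeriodic (slice h ε ξ)) (N : ℕ) :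
    IsPeriodic (slice (bessel^[N] h) ε ξ) ∧ ∀ ℓ j : ℤ,
    fourierCoeff (slice (bessel^[N] h) ε ξ) ℓ j
      = ((1 + (ℓ : ℝ) ^ 2 + (j : ℝ) ^ 2 : ℝ) : ℂ) ^ N * fourierCoeff (slice h ε ξ) ℓ j := by
  induction N with
  | zero => simpa using hp
  | succ N ih =>
    have hN := contDiff_bessel_iterate hh N
    rw [Function.iterate_succ_apply']
    refine ⟨isPeriodic_slice_bessel hN ih.1, fun ℓ j => ?_⟩
    rw [fourierCoeff_bessel hN ih.1, ih.2]
    ring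

/-- Smooth families of functions on the torus are bounded in all weighted Lipschitz norms. -/
theorem exists_lipNorm_le {h : (ℝ × ℝ × ℝ) × ℝ → ℝ} (hh : ContDiff ℝ ∞ h) {ε₀ lo hi : ℝ}
    (hp : ∀ ε ∈ Ioo 0 ε₀, ∀ ξ ∈ Icc lo hi, IsPeriodic (slice h ε ξ)) (s : ℝ) :
    ∃ C : ℝ, 0 < C ∧ ∀ ε ∈ Ioo 0 ε₀, ∀ lam ∈ Ioo (0 : ℝ) 1, ∀ (c : ℝ) (F : ℝ → ℝ → ℝ → ℝ), 0 ≤ c →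
      (∀ ξ ∈ Icc lo hi, ∀ φ θ, F ξ φ θ = c * h ((ε, ξ, φ), θ)) →
      lipNorm (Icc lo hi) lam s F ≤ ENNReal.ofReal (C * c) := by
  obtain ⟨K, hK, hsob⟩ := exists_sobolevNorm_le
  -- This gives s + 2 ≤ 2N. The same N serves for the exponent s - 1 in the Lipschitz part.
  obtain ⟨N, hN⟩ := exists_nat_ge (|s| / 2 + 1)
  have hN1 : s + 2 ≤ 2 * N := by linarith [le_abs_self s]
  set g := bessel^[N] h with hg
  have sg : ContDiff ℝ ∞ g := contDiff_bessel_iterate hh N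
  -- The closed range of ε includes 0, where the family is still smooth. The bounds on this box are
  -- therefore uniform as ε tends to 0.
  have hcomp : IsCompact ((Icc 0 ε₀ ×ˢ Icc lo hi ×ˢ Icc 0 (2 * Real.pi)) ×ˢ Icc 0 (2 * Real.pi)) :=
    (isCompact_Icc.prod (isCompact_Icc.prod isCompact_Icc)).prod isCompact_Icc
  obtain ⟨M₁, hM₁⟩ := hcomp.exists_bound_of_continuousOn sg.continuous.continuousOn
  -- A bound for the ξ-derivative of (1 - Δ)^N h gives, by the mean value inequality, the Lipschitz
  -- bound in ξ.
  obtain ⟨M₂, hM₂⟩ := hcomp.exists_bound_of_continuousOn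
    (contDiff_dirDeriv sg ((0, 1, 0), 0)).continuous.continuousOn
  refine ⟨K * |M₁| + K * |M₂| + 1, by positivity, fun ε hε lam hlam c F hc hF => ?_⟩
  have hεI : ε ∈ Icc 0 ε₀ := Ioo_subset_Icc_self hε
  have hw : ∀ ℓ j : ℤ, (0 : ℝ) ≤ 1 + (ℓ : ℝ) ^ 2 + (j : ℝ) ^ 2 := fun ℓ j => by positivity
  -- The zero multiple gives the scaling the form required by `fourierCoeff_lin`.
  have hFs : ∀ ξ ∈ Icc lo hi, F ξ = fun φ θ => c * slice h ε ξ φ θ + 0 * slice h ε ξ φ θ := by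
    intro ξ hξ; ext φ θ; rw [hF ξ hξ]; simp [slice]
  have hA : ∀ ξ ∈ Icc lo hi, sobolevNorm s (F ξ) ≤ ENNReal.ofReal (K * (c * |M₁|)) := by
    intro ξ hξ
    have hcs := continuous_slice hh ε ξ
    refine hsob s N _ _ hN1 ?_ (by positivity) fun ℓ j => ?_
    · rw [hFs ξ hξ]
      exact (continuous_const.mul hcs).add (continuous_const.mul hcs)
    · rw [hFs ξ hξ, fourierCoeff_lin hcs hcs]
      have h1 := (fourierCoeff_bessel_iterate hh (hp ε hε ξ hξ) N).2 ℓ j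
      have h2 : ‖fourierCoeff (slice g ε ξ) ℓ j‖ ≤ |M₁| :=
        norm_fourierCoeff_le (fun φ hφ θ hθ =>
          (hM₁ ((ε, ξ, φ), θ) ⟨⟨hεI, hξ, hφ⟩, hθ⟩).trans (le_abs_self _)) ℓ j
      rw [h1, norm_mul, norm_pow, Complex.norm_real, Real.norm_of_nonneg (hw ℓ j)] at h2
      have : ‖(c : ℂ) * fourierCoeff (slice h ε ξ) ℓ j + ((0 : ℝ) : ℂ) * fourierCoeff (slice h ε ξ) ℓ j‖
          = c * ‖fourierCoeff (slice h ε ξ) ℓ j‖ := by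
        simp [abs_of_nonneg hc]
      rw [this]
      nlinarith
  have hB : ∀ ξ₁ ∈ Icc lo hi, ∀ ξ₂ ∈ Icc lo hi, ξ₁ ≠ ξ₂ →
      sobolevNorm (s - 1) (F ξ₁ - F ξ₂) / ENNReal.ofReal |ξ₁ - ξ₂|
        ≤ ENNReal.ofReal (K * (c * |M₂|)) := by
    intro ξ₁ h₁ ξ₂ h₂ hne
    have hpos : 0 < |ξ₁ - ξ₂| := abs_pos.2 (sub_ne_zero.2 hne)
    have hcs₁ := continuous_slice hh ε ξ₁
    have hcs₂ := continuous_slice hh ε ξ₂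
    have hd : F ξ₁ - F ξ₂ = fun φ θ => c * slice h ε ξ₁ φ θ + (-c) * slice h ε ξ₂ φ θ := by
      ext φ θ
      simp only [Pi.sub_apply, hF ξ₁ h₁, hF ξ₂ h₂, slice]; ring
    refine ENNReal.div_le_of_le_mul ?_
    rw [← ENNReal.ofReal_mul (by positivity), mul_assoc K]
    refine hsob (s - 1) N _ _ (by linarith) ?_ (by positivity) fun ℓ j => ?_
    · rw [hd]
      exact (continuous_const.mul hcs₁).add (continuous_const.mul hcs₂)
    · rw [hd, fourierCoeff_lin hcs₁ hcs₂]
      have e1 := (fourierCoeff_bessel_iterate hh (hp ε hε ξ₁ h₁) N).2 ℓ j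
      have e2 := (fourierCoeff_bessel_iterate hh (hp ε hε ξ₂ h₂) N).2 ℓ j
      have e3 := fourierCoeff_lin (continuous_slice sg ε ξ₁) (continuous_slice sg ε ξ₂) 1 (-1) ℓ j
      have h2 : ‖fourierCoeff (fun x y => 1 * slice g ε ξ₁ x y + -1 * slice g ε ξ₂ x y) ℓ j‖
          ≤ |M₂| * |ξ₁ - ξ₂| := by
        refine norm_fourierCoeff_le (fun φ hφ θ hθ => ?_) ℓ j
        have := (convex_Icc lo hi).norm_image_sub_le_of_norm_hasDerivWithin_le (C := |M₂|)
          (f := fun ξ => g ((ε, ξ, φ), θ)) (fun ξ _ => (hasDerivAt_family_ξ sg ε ξ φ θ).hasDerivWithinAt)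
          (fun ξ hξ => (hM₂ ((ε, ξ, φ), θ) ⟨⟨hεI, hξ, hφ⟩, hθ⟩).trans (le_abs_self _)) h₂ h₁
        simpa [slice, sub_eq_add_neg] using this
      rw [e3, e1, e2] at h2
      have e4 : ((1 : ℝ) : ℂ) * (((1 + (ℓ : ℝ) ^ 2 + (j : ℝ) ^ 2 : ℝ) : ℂ) ^ N
          * fourierCoeff (slice h ε ξ₁) ℓ j) + ((-1 : ℝ) : ℂ) *
            (((1 + (ℓ : ℝ) ^ 2 + (j : ℝ) ^ 2 : ℝ) : ℂ) ^ N * fourierCoeff (slice h ε ξ₂) ℓ j)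
          = ((1 + (ℓ : ℝ) ^ 2 + (j : ℝ) ^ 2 : ℝ) : ℂ) ^ N *
            (fourierCoeff (slice h ε ξ₁) ℓ j - fourierCoeff (slice h ε ξ₂) ℓ j) := by
        push_cast; ring
      rw [e4, norm_mul, norm_pow, Complex.norm_real, Real.norm_of_nonneg (hw ℓ j)] at h2
      have e5 : (c : ℂ) * fourierCoeff (slice h ε ξ₁) ℓ j + ((-c : ℝ) : ℂ) * fourierCoeff (slice h ε ξ₂) ℓ j
          = c * (fourierCoeff (slice h ε ξ₁) ℓ j - fourierCoeff (slice h ε ξ₂) ℓ j) := by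
        push_cast; ring
      rw [e5, norm_mul, Complex.norm_real, Real.norm_of_nonneg hc]
      nlinarith
  calc lipNorm (Icc lo hi) lam s F
      ≤ ENNReal.ofReal (K * (c * |M₁|)) + 1 * ENNReal.ofReal (K * (c * |M₂|)) := by
        refine add_le_add (iSup₂_le hA) (mul_le_mul' ?_ ?_)
        · rw [← ENNReal.ofReal_one]; exact ENNReal.ofReal_le_ofReal hlam.2.le
        · exact iSup₂_le fun ξ₁ h₁ => iSup₂_le fun ξ₂ h₂ => iSup_le fun hne => hB ξ₁ h₁ ξ₂ h₂ hne
    _ ≤ _ := by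
        rw [one_mul, ← ENNReal.ofReal_add (by positivity) (by positivity)]
        apply ENNReal.ofReal_le_ofReal
        nlinarith

/-! ### Scalar autonomous equations with periodic positive speed -/

/-- The inverse function theorem for (x, y) ↦ (x, f(x, y)) gives smooth local inverses. Injectivity
in y forces the second component of a local inverse to agree with the given global right inverse g.
-/
theorem contDiff_inverse_snd {f : ℝ × ℝ → ℝ} {g : ℝ × ℝ → ℝ} (hf : ContDiff ℝ ∞ f)
    (hd : ∀ p, fderiv ℝ f p (0, 1) ≠ 0) (hinj : ∀ x, Function.Injective fun y => f (x, y))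
    (hfg : ∀ x y, f (x, g (x, y)) = y) : ContDiff ℝ ∞ g := by
  set Φ : ℝ × ℝ → ℝ × ℝ := fun p => (p.1, f p) with hΦ
  have sΦ : ContDiff ℝ ∞ Φ := contDiff_fst.prodMk hf
  have hΦinj : Function.Injective Φ := by
    rintro ⟨x, y⟩ ⟨x', y'⟩ h
    obtain ⟨h1, h2⟩ := Prod.mk.inj h
    simp only at h1
    subst h1
    rw [hinj x h2]
  refine contDiff_iff_contDiffAt.2 fun z => ?_
  set a : ℝ × ℝ := (z.1, g z) with ha
  have hΦa : Φ a = z := by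
    simp only [hΦ, ha]; rw [show f (z.1, g z) = z.2 from hfg z.1 z.2]
  set L : ℝ × ℝ →L[ℝ] ℝ × ℝ := (ContinuousLinearMap.fst ℝ ℝ ℝ).prod (fderiv ℝ f a) with hL
  have hLinj : Function.Injective (L : ℝ × ℝ →ₗ[ℝ] ℝ × ℝ) := by
    rw [← LinearMap.ker_eq_bot, LinearMap.ker_eq_bot']
    rintro ⟨u, v⟩ huv
    obtain ⟨h1, h2⟩ := Prod.mk.inj (show (u, fderiv ℝ f a (u, v)) = (0, 0) from huv)
    subst h1
    have : ((0 : ℝ), v) = v • ((0 : ℝ), (1 : ℝ)) := by simp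
    rw [this, map_smul, smul_eq_mul] at h2
    rw [(mul_eq_zero.1 h2).resolve_right (hd a)]; rfl
  set e : (ℝ × ℝ) ≃L[ℝ] ℝ × ℝ := (LinearEquiv.ofInjectiveEndo _ hLinj).toContinuousLinearEquiv
  have he : (e : ℝ × ℝ →L[ℝ] ℝ × ℝ) = L := by
    ext <;> rfl
  have hder : HasFDerivAt Φ (e : ℝ × ℝ →L[ℝ] ℝ × ℝ) a := by
    rw [he]
    exact hasFDerivAt_fst.prodMk (hf.differentiable (by simp) a).hasFDerivAt
  have h1 := sΦ.contDiffAt.to_localInverse hder (n := ∞) (by simp)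
  have h2 : ∀ᶠ y in 𝓝 (Φ a), Φ (sΦ.contDiffAt.localInverse hder (n := ∞) (by simp) y) = y :=
    HasStrictFDerivAt.eventually_right_inverse _
  rw [hΦa] at h1 h2
  have h3 : g =ᶠ[𝓝 z] fun y => (sΦ.contDiffAt.localInverse hder (n := ∞) (by simp) y).2 := by
    filter_upwards [h2] with y hy
    have : Φ (y.1, g y) = y := by
      simp only [hΦ]; rw [show f (y.1, g y) = y.2 from hfg y.1 y.2]
    rw [← hΦinj (this.trans hy.symm)]
  exact (contDiffAt_snd.comp z h1).congr_of_eventuallyEq h3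

/-- The time needed to turn from the angle `π / 2` to the angle `ψ` with speed `F`. -/
noncomputable def travelTime (F : ℝ → ℝ) (ψ : ℝ) : ℝ := ∫ x in (Real.pi / 2)..ψ, 1 / F x

/-- The time of one full turn with speed `F`. -/
noncomputable def turnTime (F : ℝ → ℝ) : ℝ := travelTime F (Real.pi / 2 + 2 * Real.pi)

/-- The angle at the phase `φ` of the motion with speed `F`. -/
noncomputable def angleAt (F : ℝ → ℝ) (φ : ℝ) : ℝ :=
  Function.invFun (fun ψ => 2 * Real.pi / turnTime F * travelTime F ψ) φ

section

variable {F : ℝ → ℝ}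

theorem hasDerivAt_travelTime (hF : Continuous F) (hpos : ∀ x, 0 < F x) (ψ : ℝ) :
    HasDerivAt (travelTime F) (1 / F ψ) ψ := by
  have hc : Continuous fun x => 1 / F x := continuous_const.div hF fun x => (hpos x).ne'
  exact intervalIntegral.integral_hasDerivAt_right (hc.intervalIntegrable _ _)
    hc.aestronglyMeasurable.stronglyMeasurableAtFilter hc.continuousAt

theorem strictMono_travelTime (hF : Continuous F) (hpos : ∀ x, 0 < F x) :
    StrictMono (travelTime F) :=
  strictMono_of_hasDerivAt_pos (hasDerivAt_travelTime hF hpos) fun x => by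
    have := hpos x; positivity

theorem travelTime_pi_div_two : travelTime F (Real.pi / 2) = 0 := by simp [travelTime]

theorem turnTime_pos (hF : Continuous F) (hpos : ∀ x, 0 < F x) : 0 < turnTime F := by
  rw [← travelTime_pi_div_two (F := F)]
  exact strictMono_travelTime hF hpos (by linarith [Real.pi_pos])

theorem travelTime_add_two_pi (hF : Continuous F) (hpos : ∀ x, 0 < F x)
    (hper : Function.Periodic F (2 * Real.pi)) (ψ : ℝ) :
    travelTime F (ψ + 2 * Real.pi) = travelTime F ψ + turnTime F := by
  have hc : Continuous fun x => 1 / F x := continuous_const.div hF fun x => (hpos x).ne'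
  have hp : Function.Periodic (fun x => 1 / F x) (2 * Real.pi) := fun x => by simp [hper x]
  exact hp.intervalIntegral_add_eq_add _ _ fun _ _ => hc.intervalIntegrable _ _

/-- The integral of a positive periodic function diverges at both ends, so the continuous travel
time takes every real value. -/
theorem surjective_travelTime (hF : Continuous F) (hpos : ∀ x, 0 < F x)
    (hper : Function.Periodic F (2 * Real.pi)) : Function.Surjective (travelTime F) := by
  have hc : Continuous fun x => 1 / F x := continuous_const.div hF fun x => (hpos x).ne'
  have hp : Function.Periodic (fun x => 1 / F x) (2 * Real.pi) := fun x => by simp [hper x]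
  have h2 : 0 < 2 * Real.pi := by positivity
  have hp1 : ∀ x, 0 < 1 / F x := fun x => by have := hpos x; positivity
  have heq : travelTime F = fun ψ => (∫ x in (Real.pi / 2)..0, 1 / F x) + ∫ x in (0)..ψ, 1 / F x := by
    ext ψ
    exact (intervalIntegral.integral_add_adjacent_intervals (hc.intervalIntegrable _ _)
      (hc.intervalIntegrable _ _)).symm
  have hcont : Continuous (travelTime F) :=
    continuous_iff_continuousAt.2 fun x => (hasDerivAt_travelTime hF hpos x).continuousAt
  refine hcont.surjective ?_ ?_
  · rw [heq]
    exact tendsto_atTop_add_const_left _ _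
      (hp.tendsto_atTop_intervalIntegral_of_pos' (hc.intervalIntegrable _ _) hp1 h2)
  · rw [heq]
    exact tendsto_atBot_add_const_left _ _
      (hp.tendsto_atBot_intervalIntegral_of_pos' (hc.intervalIntegrable _ _) hp1 h2)

theorem travelTime_angleAt (hF : Continuous F) (hpos : ∀ x, 0 < F x)
    (hper : Function.Periodic F (2 * Real.pi)) (φ : ℝ) :
    travelTime F (angleAt F φ) = φ / (2 * Real.pi / turnTime F) := by
  have hT := turnTime_pos hF hpos
  have hpi := Real.pi_pos
  have hω : 2 * Real.pi / turnTime F ≠ 0 := by positivity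
  have : ∃ ψ, 2 * Real.pi / turnTime F * travelTime F ψ = φ := by
    obtain ⟨ψ, hψ⟩ := surjective_travelTime hF hpos hper (φ / (2 * Real.pi / turnTime F))
    exact ⟨ψ, by rw [hψ]; field_simp⟩
  have h := Function.invFun_eq this
  rw [eq_div_iff hω, mul_comm]
  exact h

theorem angleAt_eq_of_travelTime (hF : Continuous F) (hpos : ∀ x, 0 < F x)
    (hper : Function.Periodic F (2 * Real.pi)) {φ ψ : ℝ}
    (h : travelTime F ψ = φ / (2 * Real.pi / turnTime F)) : angleAt F φ = ψ :=
  (strictMono_travelTime hF hpos).injective ((travelTime_angleAt hF hpos hper φ).trans h.symm)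

theorem angleAt_add_two_pi (hF : Continuous F) (hpos : ∀ x, 0 < F x)
    (hper : Function.Periodic F (2 * Real.pi)) (φ : ℝ) :
    angleAt F (φ + 2 * Real.pi) = angleAt F φ + 2 * Real.pi := by
  refine angleAt_eq_of_travelTime hF hpos hper ?_
  have hT := turnTime_pos hF hpos
  have hpi := Real.pi_pos
  rw [travelTime_add_two_pi hF hpos hper, travelTime_angleAt hF hpos hper]
  field_simp

end

section

variable {F : ℝ × ℝ → ℝ}

/-- An affine substitution moves the variable endpoint into the integrand. The integral then has
fixed limits and depends smoothly on its parameters. -/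
theorem contDiff_travelTime (hF : ContDiff ℝ ∞ F) (hpos : ∀ p, 0 < F p) :
    ContDiff ℝ ∞ fun p : ℝ × ℝ => travelTime (fun x => F (p.1, x)) p.2 := by
  have heq : (fun p : ℝ × ℝ => travelTime (fun x => F (p.1, x)) p.2) = fun p =>
      (p.2 - Real.pi / 2) * ∫ t in (0 : ℝ)..1,
        1 / F (p.1, Real.pi / 2 + (p.2 - Real.pi / 2) * t) := by
    ext p
    have := intervalIntegral.smul_integral_comp_add_mul (a := 0) (b := 1)
      (fun x => 1 / F (p.1, x)) (p.2 - Real.pi / 2) (Real.pi / 2)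
    rw [smul_eq_mul] at this
    rw [this, travelTime]
    congr 1 <;> ring
  rw [heq]
  refine (contDiff_snd.sub contDiff_const).mul (contDiff_intervalIntegral ?_)
  exact contDiff_const.div (hF.comp (g := F)
    (f := fun q : (ℝ × ℝ) × ℝ => (q.1.1, Real.pi / 2 + (q.1.2 - Real.pi / 2) * q.2)) (by fun_prop))
    fun q => (hpos _).ne'

theorem contDiff_turnTime (hF : ContDiff ℝ ∞ F) (hpos : ∀ p, 0 < F p) :
    ContDiff ℝ ∞ fun ξ : ℝ => turnTime (fun x => F (ξ, x)) :=
  (contDiff_travelTime hF hpos).comp (f := fun ξ : ℝ => (ξ, Real.pi / 2 + 2 * Real.pi))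
    (by fun_prop)

/-- The angle inverts the normalised travel time, whose derivative 2π / (turn time · speed) never
vanishes, so `contDiff_inverse_snd` applies with ξ as parameter. -/
theorem contDiff_angleAt (hF : ContDiff ℝ ∞ F) (hpos : ∀ p, 0 < F p)
    (hper : ∀ ξ, Function.Periodic (fun x => F (ξ, x)) (2 * Real.pi)) :
    ContDiff ℝ ∞ fun p : ℝ × ℝ => angleAt (fun x => F (p.1, x)) p.2 := by
  have hc : ∀ ξ, Continuous fun x => F (ξ, x) := fun ξ =>
    hF.continuous.comp (by fun_prop)
  have hTpos : ∀ ξ, 0 < turnTime fun x => F (ξ, x) := fun ξ => turnTime_pos (hc ξ) fun x => hpos _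
  have hpi := Real.pi_pos
  have sf : ContDiff ℝ ∞ fun p : ℝ × ℝ => 2 * Real.pi / turnTime (fun x => F (p.1, x))
      * travelTime (fun x => F (p.1, x)) p.2 :=
    (contDiff_const.div ((contDiff_turnTime hF hpos).comp contDiff_fst) fun p => (hTpos p.1).ne').mul
      (contDiff_travelTime hF hpos)
  refine contDiff_inverse_snd sf (fun p => ?_) (fun ξ => ?_) fun ξ φ => ?_
  · have h1 : HasDerivAt (fun y : ℝ => (p.1, y)) ((0 : ℝ), (1 : ℝ)) p.2 :=
      (hasDerivAt_const _ _).prodMk (hasDerivAt_id' _)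
    have h2 := ((sf.differentiable (by simp)) p).hasFDerivAt.comp_hasDerivAt p.2 h1
    have h3 := (hasDerivAt_travelTime (hc p.1) (fun x => hpos _) p.2).const_mul
      (2 * Real.pi / turnTime fun x => F (p.1, x))
    rw [h2.unique h3]
    have := hTpos p.1
    have := hpos (p.1, p.2)
    positivity
  · refine fun x y h => (strictMono_travelTime (hc ξ) fun x => hpos _).injective ?_
    have h2 : 2 * Real.pi / turnTime (fun x => F (ξ, x)) ≠ 0 := by
      have := hTpos ξ; positivity
    exact mul_left_cancel₀ h2 h
  · have := hTpos ξ
    simp only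
    rw [travelTime_angleAt (hc ξ) (fun x => hpos _) (hper ξ)]
    field_simp

end

/-! ### The relative motion of the point vortices -/

/-- The value `k = x² / (y² - x²)` of the conserved quantity on the orbit through `ξ = x`. -/
noncomputable def energy (y x : ℝ) : ℝ := x ^ 2 / (y ^ 2 - x ^ 2)

/-- The squared distance on the level `k` in the direction `ψ`. -/
noncomputable def sqDist (y k ψ : ℝ) : ℝ :=
  2 * k * y ^ 2 / (1 - k * Real.cos (2 * ψ) + √(1 - 2 * k * Real.cos (2 * ψ) + k ^ 2))

/-- The angular speed at squared distance `J` in the direction `ψ`. -/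
noncomputable def angSpeed (y J ψ : ℝ) : ℝ :=
  1 / J + Real.sin ψ ^ 2 / (y ^ 2 - J * Real.sin ψ ^ 2)
    - Real.cos ψ ^ 2 / (y ^ 2 + J * Real.cos ψ ^ 2)

/-- The condition x < y/√2 amounts to k < 1. It keeps the discriminant 1 - 2k cos 2ψ + k² ≥ (1 - k)²
away from 0, so every direction is reached smoothly on the level. -/
theorem energy_mem {y x : ℝ} (hx : 0 < x) (hxy : x < y / √2) :
    0 < energy y x ∧ energy y x < 1 ∧ 0 < y ^ 2 - x ^ 2 := by
  have h2 : (0 : ℝ) < √2 := by positivity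
  have h1 : x * √2 < y := (lt_div_iff₀ h2).1 hxy
  have h3 : (x * √2) ^ 2 < y ^ 2 := by
    have : 0 < x * √2 := by positivity
    nlinarith
  rw [mul_pow, Real.sq_sqrt (by norm_num)] at h3
  have h4 : 0 < y ^ 2 - x ^ 2 := by nlinarith
  refine ⟨by unfold energy; positivity, ?_, h4⟩
  rw [energy, div_lt_one h4]; linarith

section

variable {y k : ℝ}

theorem disc_pos (hk : 0 < k) (hk1 : k < 1) (ψ : ℝ) :
    0 < 1 - 2 * k * Real.cos (2 * ψ) + k ^ 2 := by
  nlinarith [Real.cos_le_one (2 * ψ), Real.neg_one_le_cos (2 * ψ)]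

theorem sqDist_denom_pos (hk : 0 < k) (hk1 : k < 1) (ψ : ℝ) :
    0 < 1 - k * Real.cos (2 * ψ) + √(1 - 2 * k * Real.cos (2 * ψ) + k ^ 2) := by
  have := Real.sqrt_nonneg (1 - 2 * k * Real.cos (2 * ψ) + k ^ 2)
  nlinarith [Real.cos_le_one (2 * ψ), Real.neg_one_le_cos (2 * ψ)]

theorem sqDist_pos (hy : 0 < y) (hk : 0 < k) (hk1 : k < 1) (ψ : ℝ) : 0 < sqDist y k ψ := by
  have := sqDist_denom_pos hk hk1 ψ
  unfold sqDist; positivity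

/-- The level equation is quadratic in J, namely k sin²ψ cos²ψ J² + y²(1 - k cos 2ψ)J = k y⁴. The
formula is its positive root in rationalised form, which stays valid where sin ψ cos ψ = 0. -/
theorem sqDist_equation (hk : 0 < k) (hk1 : k < 1) (ψ : ℝ) :
    k * (y ^ 2 - sqDist y k ψ * Real.sin ψ ^ 2) * (y ^ 2 + sqDist y k ψ * Real.cos ψ ^ 2)
      = sqDist y k ψ * y ^ 2 := by
  have hw := (sqDist_denom_pos hk hk1 ψ).ne'
  have hD := Real.sq_sqrt (disc_pos hk hk1 ψ).le
  unfold sqDist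
  rw [Real.sin_sq_eq_half_sub, Real.cos_sq]
  set C := Real.cos (2 * ψ)
  set D := √(1 - 2 * k * C + k ^ 2)
  field_simp
  linear_combination y ^ 4 * hD

/-- Subtracting the equations of two positive solutions J and L leaves J - L times a factor that is
positive because k < 1. -/
theorem eq_sqDist (hy : 0 < y) (hk : 0 < k) (hk1 : k < 1) {J ψ : ℝ} (hJ : 0 < J)
    (h : k * (y ^ 2 - J * Real.sin ψ ^ 2) * (y ^ 2 + J * Real.cos ψ ^ 2) = J * y ^ 2) :
    J = sqDist y k ψ := by
  have h0 := sqDist_equation (y := y) hk hk1 ψ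
  have h1 := sqDist_pos hy hk hk1 ψ
  set L := sqDist y k ψ
  have hc : Real.cos ψ ^ 2 ≤ 1 := Real.cos_sq_le_one ψ
  have hs : 0 ≤ Real.sin ψ ^ 2 := sq_nonneg _
  have hc0 : 0 ≤ Real.cos ψ ^ 2 := sq_nonneg _
  have hβ : 0 < y ^ 2 * (1 - k * Real.cos ψ ^ 2 + k * Real.sin ψ ^ 2) := by
    have : 0 < 1 - k * Real.cos ψ ^ 2 + k * Real.sin ψ ^ 2 := by nlinarith
    positivity
  have hα : 0 ≤ k * Real.sin ψ ^ 2 * Real.cos ψ ^ 2 * (J + L) := by positivity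
  have hprod : (J - L) * (k * Real.sin ψ ^ 2 * Real.cos ψ ^ 2 * (J + L)
      + y ^ 2 * (1 - k * Real.cos ψ ^ 2 + k * Real.sin ψ ^ 2)) = 0 := by
    linear_combination h0 - h
  rcases mul_eq_zero.1 hprod with h2 | h2
  · linarith
  · linarith

theorem sqDist_below (hy : 0 < y) (hk : 0 < k) (hk1 : k < 1) (ψ : ℝ) :
    sqDist y k ψ * Real.sin ψ ^ 2 < y ^ 2 := by
  have h0 := sqDist_equation (y := y) hk hk1 ψ
  have h1 := sqDist_pos hy hk hk1 ψ
  have h2 : 0 < y ^ 2 + sqDist y k ψ * Real.cos ψ ^ 2 := by positivity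
  have h3 : 0 < k * (y ^ 2 - sqDist y k ψ * Real.sin ψ ^ 2)
      * (y ^ 2 + sqDist y k ψ * Real.cos ψ ^ 2) := by rw [h0]; positivity
  have h4 := (pos_iff_pos_of_mul_pos h3).2 h2
  have := (pos_iff_pos_of_mul_pos h4).1 hk
  linarith

theorem angSpeed_pos {J ψ : ℝ} (hy : 0 < y) (hJ : 0 < J) (hb : J * Real.sin ψ ^ 2 < y ^ 2) :
    0 < angSpeed y J ψ := by
  have h1 : Real.cos ψ ^ 2 / (y ^ 2 + J * Real.cos ψ ^ 2) < 1 / J := by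
    rw [div_lt_div_iff₀ (by positivity) hJ]
    have : 0 < y ^ 2 := by positivity
    nlinarith
  have h2 : 0 ≤ Real.sin ψ ^ 2 / (y ^ 2 - J * Real.sin ψ ^ 2) :=
    div_nonneg (sq_nonneg _) (by linarith)
  unfold angSpeed; linarith

theorem sqDist_pi_div_two {x : ℝ} (hx : 0 < x) (hxy : x < y / √2) (hy : 0 < y) :
    sqDist y (energy y x) (Real.pi / 2) = x ^ 2 := by
  obtain ⟨h1, h2, h3⟩ := energy_mem hx hxy
  refine (eq_sqDist hy h1 h2 (by positivity) ?_).symm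
  rw [Real.sin_pi_div_two, Real.cos_pi_div_two, energy]
  have : y ^ 2 - x ^ 2 ≠ 0 := h3.ne'
  field_simp
  ring

/-- Implicit differentiation of the level equation gives dJ/dψ as the quotient of the two right-hand
sides of the point vortex system. The equation for J then follows from the one for the angle by the
chain rule. -/
theorem hasDerivAt_sqDist (hy : 0 < y) (hk : 0 < k) (hk1 : k < 1) (ψ : ℝ) :
    HasDerivAt (sqDist y k)
      (-((1 / (y ^ 2 - sqDist y k ψ * Real.sin ψ ^ 2) + 1 / (y ^ 2 + sqDist y k ψ * Real.cos ψ ^ 2))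
        * Real.sin (2 * ψ) * sqDist y k ψ) / angSpeed y (sqDist y k ψ) ψ) ψ := by
  have hd : DifferentiableAt ℝ (sqDist y k) ψ := by
    have h1 := (disc_pos hk hk1 ψ).ne'
    have h2 := (sqDist_denom_pos hk hk1 ψ).ne'
    unfold sqDist
    fun_prop (disch := assumption)
  refine hd.hasDerivAt.congr_deriv ?_
  set J' := deriv (sqDist y k) ψ
  have e0 : HasDerivAt (fun ψ => k * (y ^ 2 - sqDist y k ψ * Real.sin ψ ^ 2)
      * (y ^ 2 + sqDist y k ψ * Real.cos ψ ^ 2) - sqDist y k ψ * y ^ 2) 0 ψ := by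
    refine (hasDerivAt_const ψ (0 : ℝ)).congr_of_eventuallyEq (Eventually.of_forall fun ψ => ?_)
    simp only
    rw [sqDist_equation hk hk1 ψ, sub_self]
  have hs2 := (Real.hasDerivAt_sin ψ).fun_pow 2
  have hc2 := (Real.hasDerivAt_cos ψ).fun_pow 2
  have hJ := hd.hasDerivAt
  have e1 := ((((hJ.fun_mul hs2).const_sub (y ^ 2)).const_mul k).fun_mul
    ((hJ.fun_mul hc2).const_add (y ^ 2))).fun_sub (hJ.mul_const (y ^ 2))
  have e2 := e0.unique e1
  have hpos := sqDist_pos hy hk hk1 ψ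
  have hb := sqDist_below hy hk hk1 ψ
  have hsp := angSpeed_pos hy hpos hb
  have heq := sqDist_equation (y := y) hk hk1 ψ
  rw [Real.sin_two_mul, eq_div_iff hsp.ne']
  set J := sqDist y k ψ
  set s := Real.sin ψ
  set c := Real.cos ψ
  have hA : y ^ 2 - J * s ^ 2 ≠ 0 := by linarith
  have hB : y ^ 2 + J * c ^ 2 ≠ 0 := by positivity
  have hy2 : y ≠ 0 := hy.ne'
  unfold angSpeed
  change J' * (1 / J + s ^ 2 / (y ^ 2 - J * s ^ 2) - c ^ 2 / (y ^ 2 + J * c ^ 2)) = _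
  have hJ0 := hpos.ne'
  have e3 : 0 = k * -(J' * s ^ 2 + J * (2 * s * c)) * (y ^ 2 + J * c ^ 2)
      + k * (y ^ 2 - J * s ^ 2) * (J' * c ^ 2 + J * (2 * c * -s)) - J' * y ^ 2 := by
    simpa using e2
  field_simp
  -- The differentiated equation is multiplied by the two denominators. The level equation then
  -- eliminates k in favour of J y², which produces the common factor y².
  refine mul_left_cancel₀ (pow_ne_zero 2 hy2) ?_
  linear_combination (y ^ 2 - J * s ^ 2) * (y ^ 2 + J * c ^ 2) * e3
    + (-(J' * s ^ 2 + J * (2 * s * c)) * (y ^ 2 + J * c ^ 2)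
      + (y ^ 2 - J * s ^ 2) * (J' * c ^ 2 + J * (2 * c * -s))) * heq

theorem sqDist_add_two_pi (ψ : ℝ) : sqDist y k (ψ + 2 * Real.pi) = sqDist y k ψ := by
  have : Real.cos (2 * (ψ + 2 * Real.pi)) = Real.cos (2 * ψ) := by
    rw [show 2 * (ψ + 2 * Real.pi) = 2 * ψ + (2 : ℕ) * (2 * Real.pi) by push_cast; ring]
    exact Real.cos_add_nat_mul_two_pi _ _
  simp only [sqDist, this]

/-- The angular speed on the level `k`. -/
noncomputable def levelSpeed (y k ψ : ℝ) : ℝ := angSpeed y (sqDist y k ψ) ψ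

theorem levelSpeed_pos (hy : 0 < y) (hk : 0 < k) (hk1 : k < 1) (ψ : ℝ) : 0 < levelSpeed y k ψ :=
  angSpeed_pos hy (sqDist_pos hy hk hk1 ψ) (sqDist_below hy hk hk1 ψ)

theorem periodic_levelSpeed : Function.Periodic (levelSpeed y k) (2 * Real.pi) := fun ψ => by
  simp only [levelSpeed, angSpeed, sqDist_add_two_pi, Real.sin_add_two_pi, Real.cos_add_two_pi]

end

theorem contDiff_sqDist {E : Type} [NormedAddCommGroup E] [NormedSpace ℝ E] {y : ℝ} {k ψ : E → ℝ}
    (hk : ∀ p, 0 < k p) (hk1 : ∀ p, k p < 1) (sk : ContDiff ℝ ∞ k) (sψ : ContDiff ℝ ∞ ψ) :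
    ContDiff ℝ ∞ fun p => sqDist y (k p) (ψ p) := by
  have h1 : ∀ p, 1 - 2 * k p * Real.cos (2 * ψ p) + k p ^ 2 ≠ 0 := fun p =>
    (disc_pos (hk p) (hk1 p) (ψ p)).ne'
  have h2 : ∀ p, 1 - k p * Real.cos (2 * ψ p) + √(1 - 2 * k p * Real.cos (2 * ψ p) + k p ^ 2) ≠ 0 :=
    fun p => (sqDist_denom_pos (hk p) (hk1 p) (ψ p)).ne'
  unfold sqDist
  refine ContDiff.div (by fun_prop) (ContDiff.add (by fun_prop) (ContDiff.sqrt (by fun_prop) h1)) h2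

theorem contDiff_levelSpeed {E : Type} [NormedAddCommGroup E] [NormedSpace ℝ E] {y : ℝ}
    {k ψ : E → ℝ} (hy : 0 < y) (hk : ∀ p, 0 < k p) (hk1 : ∀ p, k p < 1) (sk : ContDiff ℝ ∞ k)
    (sψ : ContDiff ℝ ∞ ψ) : ContDiff ℝ ∞ fun p => levelSpeed y (k p) (ψ p) := by
  have hJ := contDiff_sqDist (y := y) hk hk1 sk sψ
  have h1 := fun p => (sqDist_pos hy (hk p) (hk1 p) (ψ p)).ne'
  have h2 : ∀ p, y ^ 2 - sqDist y (k p) (ψ p) * Real.sin (ψ p) ^ 2 ≠ 0 := fun p => by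
    have := sqDist_below hy (hk p) (hk1 p) (ψ p)
    linarith
  have h3 : ∀ p, y ^ 2 + sqDist y (k p) (ψ p) * Real.cos (ψ p) ^ 2 ≠ 0 := fun p => by
    have := sqDist_pos hy (hk p) (hk1 p) (ψ p)
    positivity
  unfold levelSpeed angSpeed
  exact ((contDiff_const.div hJ h1).add (ContDiff.div (by fun_prop) (by fun_prop) h2)).sub
    (ContDiff.div (by fun_prop) (by fun_prop) h3)

section

variable {y x : ℝ}

/-- Existence by quadrature: the angle inverts the travel time, so its derivative is the level
speed, and the squared distance follows the level. -/
theorem isOrbit_angleAt (hy : 0 < y) (hx : 0 < x) (hxy : x < y / √2) :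
    IsOrbit y x
      (fun t => sqDist y (energy y x) (angleAt (levelSpeed y (energy y x))
        (2 * Real.pi / turnTime (levelSpeed y (energy y x)) * t)))
      (fun t => angleAt (levelSpeed y (energy y x))
        (2 * Real.pi / turnTime (levelSpeed y (energy y x)) * t)) := by
  obtain ⟨hk, hk1, -⟩ := energy_mem hx hxy
  set k := energy y x with hk_def
  set F := levelSpeed y k with hF_def
  have sF : ContDiff ℝ ∞ fun p : ℝ × ℝ => F p.2 :=
    contDiff_levelSpeed hy (fun _ => hk) (fun _ => hk1) contDiff_const contDiff_snd
  have hF : Continuous F := sF.continuous.comp (f := fun x : ℝ => ((0 : ℝ), x)) (by fun_prop)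
  have hpos : ∀ ψ, 0 < F ψ := levelSpeed_pos hy hk hk1
  have hper : Function.Periodic F (2 * Real.pi) := periodic_levelSpeed
  have hT := turnTime_pos hF hpos
  have hpi := Real.pi_pos
  set Ω := 2 * Real.pi / turnTime F with hΩ
  have hΩ0 : 0 < Ω := by positivity
  set α : ℝ → ℝ := fun t => angleAt F (Ω * t) with hα
  have hαt : ∀ t, travelTime F (α t) = t := fun t => by
    rw [hα, travelTime_angleAt hF hpos hper, ← hΩ]; field_simp
  have sα : ContDiff ℝ ∞ α :=
    (contDiff_angleAt (F := fun p : ℝ × ℝ => F p.2) sF (fun p => hpos _) (fun _ => hper)).comp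
      (f := fun t : ℝ => ((0 : ℝ), Ω * t)) (by fun_prop)
  have dα : ∀ t, HasDerivAt α (F (α t)) t := fun t => by
    have h1 := (sα.differentiable (by simp) t).hasDerivAt
    have h2 := (hasDerivAt_travelTime hF hpos (α t)).comp t h1
    have h3 : travelTime F ∘ α = fun t => t := funext hαt
    rw [h3] at h2
    have h4 := h2.unique (hasDerivAt_id' t)
    have := (hpos (α t)).ne'
    refine h1.congr_deriv ?_
    field_simp at h4
    exact h4
  refine ⟨fun t => sqDist_pos hy hk hk1 _, fun t => sqDist_below hy hk hk1 _, fun t => ?_,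
    fun t => dα t, ?_, ?_⟩
  · have h1 := (hasDerivAt_sqDist hy hk hk1 (α t)).comp t (dα t)
    exact h1.congr_deriv (div_mul_cancel₀ _ (hpos (α t)).ne')
  · have : α 0 = Real.pi / 2 := by
      refine (strictMono_travelTime hF hpos).injective ?_
      rw [hαt, travelTime_pi_div_two]
    change sqDist y k (α 0) = x ^ 2
    rw [this, sqDist_pi_div_two hx hxy hy]
  · refine (strictMono_travelTime hF hpos).injective ?_
    rw [travelTime_pi_div_two]
    exact hαt 0

/-- The quotient J / ((y² - J sin²φ)(y² + J cos²φ)) is constant along every orbit. Its initial value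
fixes the level, which determines J from the angle. -/
theorem IsOrbit.eq_sqDist {J φ : ℝ → ℝ} (hy : 0 < y) (hx : 0 < x) (hxy : x < y / √2)
    (h : IsOrbit y x J φ) (t : ℝ) : J t = sqDist y (energy y x) (φ t) := by
  obtain ⟨hk, hk1, hyx⟩ := energy_mem hx hxy
  refine Leapfrog.eq_sqDist hy hk hk1 (h.pos t) ?_
  have hA : ∀ t, y ^ 2 - J t * Real.sin (φ t) ^ 2 ≠ 0 := fun t => by linarith [h.below t]
  have hB : ∀ t, y ^ 2 + J t * Real.cos (φ t) ^ 2 ≠ 0 := fun t => by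
    have := h.pos t; positivity
  have hy2 : y ≠ 0 := hy.ne'
  have hder : ∀ t, HasDerivAt (fun t => J t /
      ((y ^ 2 - J t * Real.sin (φ t) ^ 2) * (y ^ 2 + J t * Real.cos (φ t) ^ 2))) 0 t := by
    intro t
    have dJ := h.hasDerivAt_J t
    have ds := ((Real.hasDerivAt_sin (φ t)).comp t (h.hasDerivAt_φ t)).fun_pow 2
    have dc := ((Real.hasDerivAt_cos (φ t)).comp t (h.hasDerivAt_φ t)).fun_pow 2
    have h1 := dJ.fun_div (((dJ.fun_mul ds).const_sub (y ^ 2)).fun_mul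
      ((dJ.fun_mul dc).const_add (y ^ 2))) (mul_ne_zero (hA t) (hB t))
    refine h1.congr_deriv ?_
    have hJ := (h.pos t).ne'
    have hAt := hA t
    have hBt := hB t
    rw [Real.sin_two_mul]
    simp only [Function.comp_apply, Nat.cast_ofNat, Nat.add_one_sub_one, pow_one]
    set S := Real.sin (φ t)
    set C := Real.cos (φ t)
    field_simp
    ring
  have hconst := is_const_of_deriv_eq_zero (fun t => (hder t).differentiableAt)
    (fun t => (hder t).deriv) t 0
  simp only [h.init_J, h.init_φ, Real.sin_pi_div_two, Real.cos_pi_div_two] at hconst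
  have hAt := hA t
  have hBt := hB t
  have h0 := hyx.ne'
  rw [energy, mul_assoc]
  rw [div_eq_iff (mul_ne_zero hAt hBt)] at hconst
  generalize (y ^ 2 - J t * Real.sin (φ t) ^ 2) * (y ^ 2 + J t * Real.cos (φ t) ^ 2) = P
    at hconst ⊢
  rw [hconst]
  field_simp
  ring

/-- The travel time of the angle has derivative 1 in t and vanishes at t = 0. As travel time is
injective, this determines the angle and gives uniqueness of the orbit. -/
theorem IsOrbit.travelTime_eq {J φ : ℝ → ℝ} (hy : 0 < y) (hx : 0 < x) (hxy : x < y / √2)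
    (h : IsOrbit y x J φ) (t : ℝ) : travelTime (levelSpeed y (energy y x)) (φ t) = t := by
  obtain ⟨hk, hk1, -⟩ := energy_mem hx hxy
  have sF : ContDiff ℝ ∞ (levelSpeed y (energy y x)) :=
    contDiff_levelSpeed hy (fun _ => hk) (fun _ => hk1) contDiff_const contDiff_id
  have hpos := levelSpeed_pos hy hk hk1
  have hder : ∀ t, HasDerivAt (fun t => travelTime (levelSpeed y (energy y x)) (φ t) - t) 0 t := by
    intro t
    have dφ : HasDerivAt φ (levelSpeed y (energy y x) (φ t)) t := by
      have := h.hasDerivAt_φ t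
      rw [h.eq_sqDist hy hx hxy t] at this
      exact this
    refine (((hasDerivAt_travelTime sF.continuous hpos (φ t)).comp t dφ).sub
      (hasDerivAt_id' t)).congr_deriv ?_
    have := (hpos (φ t)).ne'
    field_simp
    simp
  have hconst := is_const_of_deriv_eq_zero (fun t => (hder t).differentiableAt)
    (fun t => (hder t).deriv) t 0
  simp only [h.init_φ, travelTime_pi_div_two] at hconst
  linarith

/-- Existence of one solution makes the choice `orbit` a solution. The two preceding lemmas then
identify it. -/
theorem isOrbit_orbit (hy : 0 < y) (hx : 0 < x) (hxy : x < y / √2) :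
    IsOrbit y x (orbit y x).1 (orbit y x).2 :=
  Classical.epsilon_spec (p := fun p : (ℝ → ℝ) × (ℝ → ℝ) => IsOrbit y x p.1 p.2)
    ⟨(_, _), isOrbit_angleAt hy hx hxy⟩

/-- The full-turn condition at t = 0 alone already forces the period to be the turn time, so the set
under the infimum is a singleton. -/
theorem period_eq (hy : 0 < y) (hx : 0 < x) (hxy : x < y / √2) :
    period y x = turnTime (levelSpeed y (energy y x)) := by
  obtain ⟨hk, hk1, -⟩ := energy_mem hx hxy
  have h := isOrbit_orbit hy hx hxy
  have sF : ContDiff ℝ ∞ (levelSpeed y (energy y x)) :=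
    contDiff_levelSpeed hy (fun _ => hk) (fun _ => hk1) contDiff_const contDiff_id
  have hpos := levelSpeed_pos hy hk hk1
  have hT := turnTime_pos sF.continuous hpos
  have htt := h.travelTime_eq hy hx hxy
  have hset : {T : ℝ | 0 < T ∧ ∀ t, (orbit y x).1 (t + T) = (orbit y x).1 t ∧
      (orbit y x).2 (t + T) = (orbit y x).2 t + 2 * Real.pi}
      = {turnTime (levelSpeed y (energy y x))} := by
    ext T
    simp only [mem_ofPred_eq, mem_singleton_iff]
    constructor
    · rintro ⟨-, hT⟩
      have h1 := (hT 0).2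
      rw [h.init_φ, zero_add] at h1
      rw [turnTime, ← h1, htt]
    · rintro rfl
      refine ⟨hT, fun t => ?_⟩
      have h2 : (orbit y x).2 (t + turnTime (levelSpeed y (energy y x)))
          = (orbit y x).2 t + 2 * Real.pi := by
        refine (strictMono_travelTime sF.continuous hpos).injective ?_
        rw [htt, travelTime_add_two_pi sF.continuous hpos periodic_levelSpeed, htt]
      refine ⟨?_, h2⟩
      rw [h.eq_sqDist hy hx hxy, h.eq_sqDist hy hx hxy, h2, sqDist_add_two_pi]
  rw [period, hset, csInf_singleton]

theorem freq_eq (hy : 0 < y) (hx : 0 < x) (hxy : x < y / √2) :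
    freq y x = 2 * Real.pi / turnTime (levelSpeed y (energy y x)) := by
  rw [freq, period_eq hy hx hxy]

theorem Theta_eq (hy : 0 < y) (hx : 0 < x) (hxy : x < y / √2) (φ : ℝ) :
    Theta y x φ = angleAt (levelSpeed y (energy y x)) φ := by
  obtain ⟨hk, hk1, -⟩ := energy_mem hx hxy
  have sF : ContDiff ℝ ∞ (levelSpeed y (energy y x)) :=
    contDiff_levelSpeed hy (fun _ => hk) (fun _ => hk1) contDiff_const contDiff_id
  refine (angleAt_eq_of_travelTime sF.continuous (levelSpeed_pos hy hk hk1) periodic_levelSpeed ?_).symm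
  rw [Theta, (isOrbit_orbit hy hx hxy).travelTime_eq hy hx hxy, freq_eq hy hx hxy]

theorem q_eq (hy : 0 < y) (hx : 0 < x) (hxy : x < y / √2) (φ : ℝ) :
    q y x φ = sqDist y (energy y x) (angleAt (levelSpeed y (energy y x)) φ) := by
  rw [← Theta_eq hy hx hxy, q, (isOrbit_orbit hy hx hxy).eq_sqDist hy hx hxy, Theta]

end

/-! ### Extension of the orbit to all parameters. -/

/-- A smooth retraction of the line into an interval, equal to the identity on `[lo, hi]`. -/
theorem exists_smooth_cutoff {a lo hi b : ℝ} (h1 : a < lo) (h2 : lo < hi) (h3 : hi < b) :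
    ∃ χ : ℝ → ℝ, ContDiff ℝ ∞ χ ∧ (∀ x ∈ Icc lo hi, χ x = x) ∧ ∀ x, χ x ∈ Ioo a b := by
  set m := (lo + hi) / 2 with hm
  set ρ := min (lo - a) (b - hi) with hρ
  have hρ0 : 0 < ρ := lt_min (by linarith) (by linarith)
  have hρ1 : ρ ≤ lo - a := min_le_left _ _
  have hρ2 : ρ ≤ b - hi := min_le_right _ _
  let f : ContDiffBump m := ⟨(hi - lo) / 2, (hi - lo) / 2 + ρ, by linarith, by linarith⟩
  refine ⟨fun x => m + f x * (x - m), ?_, fun x hx => ?_, fun x => ?_⟩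
  · have hf : ContDiff ℝ ∞ (f : ℝ → ℝ) := f.contDiff
    exact contDiff_const.add (hf.mul (contDiff_id.sub contDiff_const))
  · have : f x = 1 := f.one_of_mem_closedBall (by
      rw [Metric.mem_closedBall, Real.dist_eq, abs_le]
      exact ⟨by change -((hi - lo) / 2) ≤ _; linarith [hx.1],
        by change _ ≤ (hi - lo) / 2; linarith [hx.2]⟩)
    simp [this]
  · have hlt : |f x * (x - m)| < (hi - lo) / 2 + ρ := by
      by_cases hx : |x - m| < (hi - lo) / 2 + ρ
      · rw [abs_mul, abs_of_nonneg f.nonneg]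
        exact lt_of_le_of_lt (mul_le_of_le_one_left (abs_nonneg _) f.le_one) hx
      · have : f x = 0 := f.zero_of_le_dist (by rw [Real.dist_eq]; exact not_lt.1 hx)
        rw [this, zero_mul, abs_zero]; linarith
    rw [abs_lt] at hlt
    exact ⟨by linarith [hlt.1], by linarith [hlt.2]⟩

/-- The point vortex motion, extended smoothly to all parameters `ξ`. -/
theorem exists_smooth_orbit {y lo hi : ℝ} (hy : 0 < y) (hlo : 0 < lo) (hlt : lo < hi)
    (hhi : hi < y / √2) :
    ∃ (Q Th : ℝ × ℝ → ℝ) (Om : ℝ → ℝ), ContDiff ℝ ∞ Q ∧ ContDiff ℝ ∞ Th ∧ ContDiff ℝ ∞ Om ∧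
      (∀ p, 0 < Q p) ∧ (∀ p, Q p * Real.sin (Th p) ^ 2 < y ^ 2) ∧
      (∀ ξ φ, Q (ξ, φ + 2 * Real.pi) = Q (ξ, φ)) ∧
      (∀ ξ φ, Th (ξ, φ + 2 * Real.pi) = Th (ξ, φ) + 2 * Real.pi) ∧
      ∀ ξ ∈ Icc lo hi, freq y ξ = Om ξ ∧ ∀ φ, q y ξ φ = Q (ξ, φ) ∧ Theta y ξ φ = Th (ξ, φ) := by
  -- The cutoff takes values in (0, y/√2), where the level lies in (0, 1). Every real ξ thus has a
  -- genuine orbit, and nothing changes on [lo, hi].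
  obtain ⟨χ, sχ, hχ, hχ'⟩ := exists_smooth_cutoff hlo hlt hhi
  set k : ℝ → ℝ := fun ξ => energy y (χ ξ) with hk_def
  have hmem := fun ξ => energy_mem (hχ' ξ).1 (hχ' ξ).2
  have hk : ∀ ξ, 0 < k ξ := fun ξ => (hmem ξ).1
  have hk1 : ∀ ξ, k ξ < 1 := fun ξ => (hmem ξ).2.1
  have sk : ContDiff ℝ ∞ k :=
    (sχ.pow 2).div (contDiff_const.sub (sχ.pow 2)) fun ξ => (hmem ξ).2.2.ne'
  set F : ℝ × ℝ → ℝ := fun p => levelSpeed y (k p.1) p.2 with hF_def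
  have sF : ContDiff ℝ ∞ F := contDiff_levelSpeed hy (fun p => hk p.1) (fun p => hk1 p.1)
    (sk.comp contDiff_fst) contDiff_snd
  have hpos : ∀ p, 0 < F p := fun p => levelSpeed_pos hy (hk p.1) (hk1 p.1) _
  have hper : ∀ ξ, Function.Periodic (fun x => F (ξ, x)) (2 * Real.pi) := fun ξ x =>
    periodic_levelSpeed (y := y) (k := k ξ) x
  have hc : ∀ ξ, Continuous fun x => F (ξ, x) := fun ξ => sF.continuous.comp (by fun_prop)
  have sTh := contDiff_angleAt sF hpos hper
  have hThper : ∀ ξ φ, angleAt (fun x => F (ξ, x)) (φ + 2 * Real.pi)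
      = angleAt (fun x => F (ξ, x)) φ + 2 * Real.pi := fun ξ φ =>
    angleAt_add_two_pi (hc ξ) (fun x => hpos _) (hper ξ) φ
  refine ⟨fun p => sqDist y (k p.1) (angleAt (fun x => F (p.1, x)) p.2),
    fun p => angleAt (fun x => F (p.1, x)) p.2, fun ξ => 2 * Real.pi / turnTime fun x => F (ξ, x),
    contDiff_sqDist (fun p => hk p.1) (fun p => hk1 p.1) (sk.comp contDiff_fst) sTh, sTh,
    contDiff_const.div (contDiff_turnTime sF hpos) fun ξ =>
      (turnTime_pos (hc ξ) fun x => hpos _).ne',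
    fun p => sqDist_pos hy (hk _) (hk1 _) _, fun p => sqDist_below hy (hk _) (hk1 _) _,
    fun ξ φ => ?_, hThper, fun ξ hξ => ?_⟩
  · simp only [hThper, sqDist_add_two_pi]
  · have h1 : 0 < ξ := by rw [← hχ ξ hξ]; exact (hχ' ξ).1
    have h2 : ξ < y / √2 := by rw [← hχ ξ hξ]; exact (hχ' ξ).2
    have h3 : (fun x => F (ξ, x)) = levelSpeed y (energy y ξ) := by
      ext x; simp only [hF_def, hk_def, hχ ξ hξ]
    have h4 : k ξ = energy y ξ := by simp only [hk_def, hχ ξ hξ]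
    refine ⟨?_, fun φ => ⟨?_, ?_⟩⟩
    · rw [freq_eq hy h1 h2]; simp only [h3]
    · rw [q_eq hy h1 h2]; simp only [h3, h4]
    · rw [Theta_eq hy h1 h2]; simp only [h3]

/-! ### The logarithmic potential of a star-shaped patch as a boundary integral -/

/-- `|A - t b e^{iu}|²`. -/
noncomputable def sqGap (A b t u : ℝ) : ℝ := A ^ 2 + t ^ 2 * b ^ 2 - 2 * t * A * b * Real.cos u

theorem sqGap_eq (A b t u : ℝ) :
    sqGap A b t u = (t * b - A * Real.cos u) ^ 2 + (A * Real.sin u) ^ 2 := by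
  have := Real.sin_sq_add_cos_sq u
  unfold sqGap
  linear_combination -A ^ 2 * this

theorem norm_sub_mul_cis_sq (A l u : ℝ) :
    ‖(A : ℂ) - (l : ℂ) * cis u‖ ^ 2 = A ^ 2 + l ^ 2 - 2 * A * l * Real.cos u := by
  rw [← Complex.normSq_eq_norm_sq, cis_eq, Complex.normSq_apply]
  simp only [Complex.sub_re, Complex.sub_im, Complex.mul_re, Complex.mul_im, Complex.add_re,
    Complex.add_im, Complex.ofReal_re, Complex.ofReal_im, Complex.I_re, Complex.I_im]
  have := Real.sin_sq_add_cos_sq u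
  linear_combination l ^ 2 * this

theorem integral_log_norm_radial (A b u : ℝ) :
    ∫ l in (0)..b, Real.log ‖(A : ℂ) - (l : ℂ) * cis u‖ * l
      = ∫ t in (0 : ℝ)..1, 1 / 2 * t * b ^ 2 * Real.log (sqGap A b t u) := by
  have h := intervalIntegral.mul_integral_comp_mul_right (a := 0) (b := 1)
    (f := fun l : ℝ => Real.log ‖(A : ℂ) - (l : ℂ) * cis u‖ * l) (c := b)
  rw [zero_mul, one_mul] at h
  rw [← h, ← intervalIntegral.integral_const_mul]
  congr 1
  ext t
  have h1 : Real.log ‖(A : ℂ) - ((t * b : ℝ) : ℂ) * cis u‖ = 1 / 2 * Real.log (sqGap A b t u) := by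
    have h2 : sqGap A b t u = ‖(A : ℂ) - ((t * b : ℝ) : ℂ) * cis u‖ ^ 2 := by
      rw [norm_sub_mul_cis_sq, sqGap]; ring
    rw [h2, Real.log_pow]; push_cast; ring
  rw [h1]; ring

/-- The `u`-derivative of `-A b sin u (log |A - t b e^{iu}|² - 1) / 4`. -/
noncomputable def tangentialTerm (A b b' t u : ℝ) : ℝ :=
  -(1 / 4) * A * (b' * Real.sin u + b * Real.cos u) * (Real.log (sqGap A b t u) - 1)
    - 1 / 4 * (A * b * Real.sin u) *
      (2 * t * (b' * (t * b - A * Real.cos u) + A * b * Real.sin u)) / sqGap A b t u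

/-- In the plane, log|x - A| is one quarter of the divergence of (x - A)(log|x - A|² - 1). In the
coordinates x = t B(u) e^{iu} this reads: weighted logarithm = ∂_t of the radial flux - ∂_u of the
tangential flux. `hasDerivAt_tangential` supplies the second half. -/
theorem hasDerivAt_radial {A b b' t u : ℝ} (hN : sqGap A b t u ≠ 0) :
    HasDerivAt (fun t => 1 / 4 * t * (t * b ^ 2 - A * (b' * Real.sin u + b * Real.cos u))
      * (Real.log (sqGap A b t u) - 1))
      (1 / 2 * t * b ^ 2 * Real.log (sqGap A b t u) + tangentialTerm A b b' t u) t := by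
  have h1 : HasDerivAt (fun t => sqGap A b t u) (2 * t * b ^ 2 - 2 * A * b * Real.cos u) t := by
    have ht := hasDerivAt_id' t
    refine ((((ht.fun_pow 2).mul_const (b ^ 2)).const_add (A ^ 2)).fun_sub
      (((((ht.const_mul 2).mul_const A).mul_const b)).mul_const (Real.cos u))).congr_deriv ?_
    simp
  have h2 := (((hasDerivAt_id' t).const_mul (1 / 4)).fun_mul
    (((hasDerivAt_id' t).mul_const (b ^ 2)).sub_const (A * (b' * Real.sin u + b * Real.cos u)))).fun_mul
      ((h1.log hN).sub_const 1)
  refine h2.congr_deriv ?_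
  unfold tangentialTerm
  have hN' : sqGap A b t u = A ^ 2 + t ^ 2 * b ^ 2 - 2 * t * A * b * Real.cos u := rfl
  have hsc := Real.sin_sq_add_cos_sq u
  field_simp
  rw [hN']
  generalize Real.log (A ^ 2 + t ^ 2 * b ^ 2 - 2 * t * A * b * Real.cos u) = L
  generalize Real.sin u = S at *
  generalize Real.cos u = C at *
  linear_combination 4 * t * b ^ 2 * A ^ 2 * hsc

theorem hasDerivAt_tangential {A t u : ℝ} {B : ℝ → ℝ} {b' : ℝ} (hB : HasDerivAt B b' u)
    (hN : sqGap A (B u) t u ≠ 0) :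
    HasDerivAt (fun u => -(1 / 4) * A * (B u * Real.sin u) * (Real.log (sqGap A (B u) t u) - 1))
      (tangentialTerm A (B u) b' t u) u := by
  have h1 : HasDerivAt (fun u => sqGap A (B u) t u)
      (2 * t * (b' * (t * B u - A * Real.cos u) + A * B u * Real.sin u)) u := by
    refine ((((hB.fun_pow 2).const_mul (t ^ 2)).const_add (A ^ 2)).fun_sub
      ((hB.const_mul (2 * t * A)).fun_mul (Real.hasDerivAt_cos u))).congr_deriv ?_
    simp; ring
  refine ((((hB.fun_mul (Real.hasDerivAt_sin u)).const_mul (-(1 / 4) * A))).fun_mul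
    ((h1.log hN).sub_const 1)).congr_deriv ?_
  unfold tangentialTerm
  ring

/-- The squared distance lies between (A sin u)² and (A + b)². Its logarithm is thus dominated,
uniformly in t, by the integrable function |log(sin u)| plus constants. -/
theorem abs_log_sqGap_le {A b t u : ℝ} (hA : 0 < A) (hb : 0 ≤ b) (ht : t ∈ Icc (0 : ℝ) 1)
    (hu : Real.sin u ≠ 0) :
    0 < sqGap A b t u ∧
      |Real.log (sqGap A b t u)| ≤ (A + b) ^ 2 + 2 * |Real.log A| + 2 * |Real.log (Real.sin u)| := by
  have hs : 0 < (A * Real.sin u) ^ 2 := by positivity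
  have h1 : (A * Real.sin u) ^ 2 ≤ sqGap A b t u := by
    rw [sqGap_eq]; nlinarith [sq_nonneg (t * b - A * Real.cos u)]
  have h0 : 0 < sqGap A b t u := lt_of_lt_of_le hs h1
  have h2 : sqGap A b t u ≤ (A + b) ^ 2 := by
    unfold sqGap
    have h3 : t * b ≤ b := by nlinarith [ht.1, ht.2]
    have h4 : 0 ≤ t * b := mul_nonneg ht.1 hb
    have h5 : -(t * b * A) ≤ t * b * A * Real.cos u := by
      nlinarith [Real.neg_one_le_cos u, mul_nonneg h4 hA.le]
    nlinarith
  refine ⟨h0, abs_le.2 ⟨?_, ?_⟩⟩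
  · have h3 := Real.log_le_log hs h1
    rw [Real.log_pow, Real.log_mul hA.ne' hu] at h3
    push_cast at h3
    nlinarith [neg_abs_le (Real.log A), neg_abs_le (Real.log (Real.sin u)), sq_nonneg (A + b)]
  · have h3 := Real.log_le_self h0.le
    nlinarith [abs_nonneg (Real.log A), abs_nonneg (Real.log (Real.sin u))]

/-- With p = tb - A cos u and s = A sin u, the quotient term is a quadratic form in (p, s) over p² +
s², hence bounded. Only the logarithm is singular. -/
theorem abs_tangentialTerm_le {A b b' t u M : ℝ} (hA : 0 < A) (hb : 0 ≤ b)
    (ht : t ∈ Icc (0 : ℝ) 1) (hu : Real.sin u ≠ 0) (hAM : A ≤ M) (hbM : b ≤ M) (hbM' : |b'| ≤ M)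
    (hlog : |Real.log A| ≤ M) :
    |tangentialTerm A b b' t u|
      ≤ (M ^ 2 * (4 * M ^ 2 + 2 * M + 3) + M ^ 2) * (1 + |Real.log (Real.sin u)|) := by
  obtain ⟨h0, hL⟩ := abs_log_sqGap_le hA hb ht hu
  have hM : 0 < M := lt_of_lt_of_le hA hAM
  set L := Real.log (sqGap A b t u)
  set l := |Real.log (Real.sin u)|
  have hl : 0 ≤ l := abs_nonneg _
  have hsin := Real.abs_sin_le_one u
  have hcos := Real.abs_cos_le_one u
  have hL' : |L - 1| ≤ 4 * M ^ 2 + 2 * M + 2 * l + 1 := by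
    have h1 : (A + b) ^ 2 ≤ 4 * M ^ 2 := by nlinarith
    have h2 := abs_sub L 1
    rw [abs_one] at h2
    linarith
  have e1 : |-(1 / 4) * A * (b' * Real.sin u + b * Real.cos u) * (L - 1)|
      ≤ 1 / 2 * M ^ 2 * (4 * M ^ 2 + 2 * M + 2 * l + 1) := by
    have h1 : |b' * Real.sin u + b * Real.cos u| ≤ 2 * M := by
      refine (abs_add_le _ _).trans ?_
      rw [abs_mul, abs_mul, abs_of_nonneg hb]
      have := mul_le_mul hbM' hsin (abs_nonneg _) hM.le
      have := mul_le_mul hbM hcos (abs_nonneg _) hM.le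
      linarith
    rw [abs_mul, abs_mul, abs_mul, abs_neg, abs_of_pos hA, abs_of_pos (by norm_num : (0:ℝ) < 1 / 4)]
    calc 1 / 4 * A * |b' * Real.sin u + b * Real.cos u| * |L - 1|
        ≤ 1 / 4 * M * (2 * M) * (4 * M ^ 2 + 2 * M + 2 * l + 1) := by gcongr
      _ = _ := by ring
  have e2 : |1 / 4 * (A * b * Real.sin u) *
      (2 * t * (b' * (t * b - A * Real.cos u) + A * b * Real.sin u)) / sqGap A b t u| ≤ M ^ 2 := by
    rw [abs_div, abs_of_pos h0, div_le_iff₀ h0, sqGap_eq]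
    set p := t * b - A * Real.cos u
    set s := A * Real.sin u with hs
    have h3 : 1 / 4 * (A * b * Real.sin u) * (2 * t * (b' * p + A * b * Real.sin u))
        = 1 / 2 * t * b * (b' * (s * p) + b * s ^ 2) := by rw [hs]; ring
    have h4 : |b' * (s * p) + b * s ^ 2| ≤ M * (2 * (p ^ 2 + s ^ 2)) := by
      refine (abs_add_le _ _).trans ?_
      rw [abs_mul, abs_mul b, abs_of_nonneg hb, abs_of_nonneg (sq_nonneg s)]
      have h5 : |s * p| ≤ p ^ 2 + s ^ 2 := by
        rw [abs_le]; constructor <;> nlinarith [sq_nonneg (s + p), sq_nonneg (s - p)]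
      have := mul_le_mul hbM' h5 (abs_nonneg _) hM.le
      have := mul_le_mul_of_nonneg_right hbM (sq_nonneg s)
      nlinarith [sq_nonneg p]
    rw [h3, abs_mul, abs_mul, abs_mul, abs_of_nonneg ht.1, abs_of_nonneg hb,
      abs_of_pos (by norm_num : (0:ℝ) < 1 / 2)]
    calc 1 / 2 * t * b * |b' * (s * p) + b * s ^ 2|
        ≤ 1 / 2 * 1 * M * (M * (2 * (p ^ 2 + s ^ 2))) := by
          gcongr
          exact ht.2
      _ = _ := by ring
  unfold tangentialTerm
  refine (abs_sub _ _).trans ?_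
  have h6 : 0 ≤ M ^ 2 * l := by positivity
  have h7 : 0 ≤ M ^ 3 * l := by positivity
  have h8 : 0 ≤ M ^ 4 * l := by positivity
  have h9 : 0 ≤ M ^ 2 := by positivity
  have h10 : 0 ≤ M ^ 3 := by positivity
  have h11 : 0 ≤ M ^ 4 := by positivity
  nlinarith [e1, e2]

theorem ae_sin_ne_zero : ∀ᵐ u : ℝ, Real.sin u ≠ 0 := by
  have hcount : {u : ℝ | Real.sin u = 0}.Countable := by
    have : {u : ℝ | Real.sin u = 0} = Set.range fun n : ℤ => (n : ℝ) * Real.pi := by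
      ext u; exact Real.sin_eq_zero_iff
    rw [this]; exact Set.countable_range _
  have h0 := hcount.measure_zero volume
  rw [ae_iff]
  simpa using h0

/-- For t < 1 the scaled curve could meet A only on the real axis. There it passes through tA ≠ A at
both ends of the interval and through a negative number at u = π. -/
theorem sqGap_pos_of_lt {A t u : ℝ} {B : ℝ → ℝ} (hA : 0 < A) (hB : ∀ u, 0 < B u)
    (h0 : B 0 = A) (h1 : B (2 * Real.pi) = A) (ht : t ∈ Ioo (0 : ℝ) 1)
    (hu : u ∈ Icc 0 (2 * Real.pi)) : 0 < sqGap A (B u) t u := by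
  by_cases hs : Real.sin u = 0
  · rw [sqGap_eq, hs]
    have hne : t * B u - A * Real.cos u ≠ 0 := by
      rcases Real.sin_eq_zero_iff_cos_eq.1 hs with hc | hc
      · obtain ⟨n, hn⟩ := (Real.cos_eq_one_iff u).1 hc
        have hpi := Real.pi_pos
        have hBu : B u = A := by
          have hn0 : (0 : ℝ) ≤ n := by
            by_contra h
            have := hu.1
            nlinarith
          have hn1 : (n : ℝ) ≤ 1 := by
            by_contra h
            have := hu.2
            nlinarith
          have hn0' : 0 ≤ n := by exact_mod_cast hn0
          have hn1' : n ≤ 1 := by exact_mod_cast hn1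
          obtain rfl | rfl : n = 0 ∨ n = 1 := by omega
          · rw [← hn]; simpa using h0
          · rw [← hn]; simpa using h1
        rw [hBu, hc]
        have := ht.2
        nlinarith
      · rw [hc]
        have := hB u
        have := ht.1
        have : 0 < t * B u := by positivity
        linarith
    positivity
  · exact (abs_log_sqGap_le hA (hB u).le (Ioo_subset_Icc_self ht) hs).1

/-- Green's formula for the logarithmic potential of `{l < B(u)}` at the boundary point `A = B(0)`. -/
theorem integral_log_eq_boundary {A : ℝ} {B B' : ℝ → ℝ} (hA : 0 < A) (hB : ∀ u, 0 < B u)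
    (h0 : B 0 = A) (h1 : B (2 * Real.pi) = A) (hd : ∀ u, HasDerivAt B (B' u) u)
    (hc' : Continuous B') :
    IntervalIntegrable (fun u => (B u ^ 2 - A * (B' u * Real.sin u + B u * Real.cos u))
        * (Real.log (sqGap A (B u) 1 u) - 1)) volume 0 (2 * Real.pi) ∧
    ∫ u in (0)..(2 * Real.pi), ∫ l in (0)..(B u), Real.log ‖(A : ℂ) - (l : ℂ) * cis u‖ * l
      = 1 / 4 * ∫ u in (0)..(2 * Real.pi),
        (B u ^ 2 - A * (B' u * Real.sin u + B u * Real.cos u))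
          * (Real.log (sqGap A (B u) 1 u) - 1) := by
  have hpi := Real.pi_pos
  have h2pi : (0 : ℝ) ≤ 2 * Real.pi := by positivity
  have hc : Continuous B := continuous_iff_continuousAt.2 fun u => (hd u).continuousAt
  obtain ⟨M₁, hM₁⟩ := isCompact_Icc.exists_bound_of_continuousOn
    (s := Icc 0 (2 * Real.pi)) hc.continuousOn
  obtain ⟨M₂, hM₂⟩ := isCompact_Icc.exists_bound_of_continuousOn
    (s := Icc 0 (2 * Real.pi)) hc'.continuousOn
  obtain ⟨M, hMA, hM1, hM2, hMl⟩ : ∃ M, A ≤ M ∧ M₁ ≤ M ∧ M₂ ≤ M ∧ |Real.log A| ≤ M :=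
    ⟨max (max A M₁) (max M₂ |Real.log A|), by simp, by simp, by simp, by simp⟩
  have hM0 : 0 < M := lt_of_lt_of_le hA hMA
  have hBM : ∀ u ∈ Icc 0 (2 * Real.pi), B u ≤ M := fun u hu =>
    ((le_abs_self _).trans (hM₁ u hu)).trans hM1
  have hBM' : ∀ u ∈ Icc 0 (2 * Real.pi), |B' u| ≤ M := fun u hu => (hM₂ u hu).trans hM2
  have hlogint : IntervalIntegrable (fun u => 1 + |Real.log (Real.sin u)|) volume 0 (2 * Real.pi) :=
    intervalIntegrable_const.add (intervalIntegrable_log_sin (a := 0) (b := 2 * Real.pi)).abs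
  set K := M ^ 2 * (4 * M ^ 2 + 2 * M + 3) + M ^ 2 with hK
  -- integrability of the tangential term on the product
  have hIoc : ∀ u ∈ Ioc 0 (2 * Real.pi), u ∈ Icc 0 (2 * Real.pi) := fun u hu => ⟨hu.1.le, hu.2⟩
  have hmeasT : Measurable fun p : ℝ × ℝ => tangentialTerm A (B p.1) (B' p.1) p.2 p.1 := by
    unfold tangentialTerm sqGap
    have := hc.measurable
    have := hc'.measurable
    have hl := Real.measurable_log
    fun_prop
  have hae : ∀ᵐ u ∂(volume.restrict (Ioc 0 (2 * Real.pi))),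
      Real.sin u ≠ 0 ∧ u ∈ Icc 0 (2 * Real.pi) := by
    filter_upwards [ae_restrict_of_ae ae_sin_ne_zero, ae_restrict_mem measurableSet_Ioc] with u h3 h4
    exact ⟨h3, hIoc u h4⟩
  have hT : Integrable (fun p : ℝ × ℝ => tangentialTerm A (B p.1) (B' p.1) p.2 p.1)
      ((volume.restrict (Ioc 0 (2 * Real.pi))).prod (volume.restrict (Ioc (0 : ℝ) 1))) := by
    have hdom : Integrable (fun p : ℝ × ℝ => (K * (1 + |Real.log (Real.sin p.1)|)) * (1 : ℝ))
        ((volume.restrict (Ioc 0 (2 * Real.pi))).prod (volume.restrict (Ioc (0 : ℝ) 1))) := by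
      refine Integrable.mul_prod (f := fun u => K * (1 + |Real.log (Real.sin u)|))
        (g := fun _ => (1 : ℝ)) ?_ (integrable_const _)
      exact ((intervalIntegrable_iff_integrableOn_Ioc_of_le h2pi).1 hlogint).const_mul K
    refine hdom.mono' hmeasT.aestronglyMeasurable ?_
    have e1 : ∀ᵐ p ∂((volume.restrict (Ioc 0 (2 * Real.pi))).prod (volume.restrict (Ioc (0 : ℝ) 1))),
        Real.sin p.1 ≠ 0 ∧ p.1 ∈ Icc 0 (2 * Real.pi) := Measure.quasiMeasurePreserving_fst.ae hae
    have e2 : ∀ᵐ p ∂((volume.restrict (Ioc 0 (2 * Real.pi))).prod (volume.restrict (Ioc (0 : ℝ) 1))),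
        p.2 ∈ Ioc (0 : ℝ) 1 :=
      Measure.quasiMeasurePreserving_snd.ae (ae_restrict_mem measurableSet_Ioc)
    filter_upwards [e1, e2] with p hp1 hp2
    rw [mul_one]
    exact abs_tangentialTerm_le hA (hB _).le ⟨hp2.1.le, hp2.2⟩ hp1.1 hMA (hBM _ hp1.2) (hBM' _ hp1.2) hMl
  -- its integral vanishes
  have hTzero : ∫ u in (0)..(2 * Real.pi), ∫ t in (0 : ℝ)..1, tangentialTerm A (B u) (B' u) t u = 0 := by
    rw [intervalIntegral_intervalIntegral_swap
      (F := fun u t => tangentialTerm A (B u) (B' u) t u)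
      (by rw [uIoc_of_le h2pi, uIoc_of_le zero_le_one, IntegrableOn, Measure.volume_eq_prod,
            ← Measure.prod_restrict]; exact hT)]
    -- The value t = 1, where the curve reaches the singularity, is discarded. For each other t the
    -- integrand is the u-derivative of a smooth function that vanishes with sin u at both ends.
    rw [intervalIntegral.integral_of_le zero_le_one, integral_Ioc_eq_integral_Ioo]
    refine setIntegral_eq_zero_of_forall_eq_zero fun t ht => ?_
    have hpos : ∀ u ∈ uIcc 0 (2 * Real.pi), sqGap A (B u) t u ≠ 0 := fun u hu =>
      (sqGap_pos_of_lt hA hB h0 h1 ht (by rwa [uIcc_of_le h2pi] at hu)).ne'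
    have hcont : ContinuousOn (fun u => tangentialTerm A (B u) (B' u) t u) (uIcc 0 (2 * Real.pi)) := by
      have hcg : Continuous fun u => sqGap A (B u) t u := by unfold sqGap; fun_prop
      unfold tangentialTerm
      refine ContinuousOn.sub ?_ ?_
      · exact (Continuous.continuousOn (by fun_prop)).mul
          ((hcg.continuousOn.log hpos).sub continuousOn_const)
      · exact (Continuous.continuousOn (by fun_prop)).div hcg.continuousOn hpos
    rw [intervalIntegral.integral_eq_sub_of_hasDerivAt
      (fun u hu => hasDerivAt_tangential (hd u) (hpos u hu)) hcont.intervalIntegrable]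
    simp
  have hTint : IntervalIntegrable (fun u => ∫ t in (0 : ℝ)..1, tangentialTerm A (B u) (B' u) t u)
      volume 0 (2 * Real.pi) := by
    rw [intervalIntegrable_iff_integrableOn_Ioc_of_le h2pi]
    simp_rw [intervalIntegral.integral_of_le zero_le_one]
    exact hT.integral_prod_left
  -- the boundary term
  have hEint : IntervalIntegrable (fun u =>
      (B u ^ 2 - A * (B' u * Real.sin u + B u * Real.cos u))
        * (Real.log (sqGap A (B u) 1 u) - 1)) volume 0 (2 * Real.pi) := by
    have hlg : IntervalIntegrable (fun u => Real.log (sqGap A (B u) 1 u) - 1) volume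
        0 (2 * Real.pi) := by
      rw [intervalIntegrable_iff_integrableOn_Ioc_of_le h2pi]
      have hdom : IntegrableOn (fun u => (4 * M ^ 2 + 2 * M + 3) * (1 + |Real.log (Real.sin u)|))
          (Ioc 0 (2 * Real.pi)) :=
        ((intervalIntegrable_iff_integrableOn_Ioc_of_le h2pi).1 hlogint).const_mul _
      refine hdom.mono' ?_ ?_
      · refine Measurable.aestronglyMeasurable ?_
        unfold sqGap
        have := hc.measurable
        have hl := Real.measurable_log
        fun_prop
      · filter_upwards [hae] with u hu
        have h3 := (abs_log_sqGap_le (t := 1) hA (hB u).le ⟨zero_le_one, le_rfl⟩ hu.1).2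
        have h4 := hBM u hu.2
        have h5 := hB u
        have h6 : (A + B u) ^ 2 ≤ 4 * M ^ 2 := by nlinarith
        have h7 := abs_sub (Real.log (sqGap A (B u) 1 u)) 1
        rw [abs_one] at h7
        rw [Real.norm_eq_abs]
        have h8 := abs_nonneg (Real.log (Real.sin u))
        nlinarith [mul_nonneg (by positivity : 0 ≤ 4 * M ^ 2 + 2 * M) h8]
    exact hlg.continuousOn_mul (Continuous.continuousOn (by fun_prop))
  refine ⟨hEint, ?_⟩
  have key : ∀ᵐ u, u ∈ uIoc 0 (2 * Real.pi) →
      ∫ l in (0)..(B u), Real.log ‖(A : ℂ) - (l : ℂ) * cis u‖ * l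
      = 1 / 4 * ((B u ^ 2 - A * (B' u * Real.sin u + B u * Real.cos u))
          * (Real.log (sqGap A (B u) 1 u) - 1))
        - ∫ t in (0 : ℝ)..1, tangentialTerm A (B u) (B' u) t u := by
    filter_upwards [ae_sin_ne_zero] with u hu _
    rw [integral_log_norm_radial]
    have hpos : ∀ t ∈ uIcc (0 : ℝ) 1, sqGap A (B u) t u ≠ 0 := fun t ht =>
      (abs_log_sqGap_le hA (hB u).le (by rwa [uIcc_of_le zero_le_one] at ht) hu).1.ne'
    have hcg : Continuous fun t => sqGap A (B u) t u := by unfold sqGap; fun_prop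
    have c1 : ContinuousOn (fun t => 1 / 2 * t * B u ^ 2 * Real.log (sqGap A (B u) t u))
        (uIcc (0 : ℝ) 1) :=
      (Continuous.continuousOn (by fun_prop)).mul (hcg.continuousOn.log hpos)
    have c2 : ContinuousOn (fun t => tangentialTerm A (B u) (B' u) t u) (uIcc (0 : ℝ) 1) := by
      unfold tangentialTerm
      refine ContinuousOn.sub ?_ ?_
      · exact (Continuous.continuousOn (by fun_prop)).mul
          ((hcg.continuousOn.log hpos).sub continuousOn_const)
      · exact (Continuous.continuousOn (by fun_prop)).div hcg.continuousOn hpos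
    -- The radial flux vanishes at t = 0, and at t = 1 it is the boundary integrand.
    have h3 := intervalIntegral.integral_eq_sub_of_hasDerivAt
      (fun t ht => hasDerivAt_radial (b' := B' u) (hpos t ht))
      (c1.intervalIntegrable.add c2.intervalIntegrable)
    rw [intervalIntegral.integral_add c1.intervalIntegrable c2.intervalIntegrable] at h3
    rw [eq_sub_iff_add_eq, h3]
    ring
  rw [intervalIntegral.integral_congr_ae key,
    intervalIntegral.integral_sub (hEint.const_mul _) hTint, hTzero, sub_zero,
    intervalIntegral.integral_const_mul]

/-! ### Integration against `log (2 - 2 cos u)` -/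

theorem intervalIntegrable_log_chord (a b : ℝ) :
    IntervalIntegrable (fun u => Real.log (2 - 2 * Real.cos u)) volume a b := by
  have h : AnalyticOnNhd ℝ (fun u : ℝ => 2 - 2 * Real.cos u) (uIcc a b) := fun u _ =>
    analyticAt_const.sub (analyticAt_const.mul Real.analyticAt_cos)
  exact h.meromorphicOn.intervalIntegrable_log

/-- Half-angle formulas turn the product into 2 cos(u/2) · x log x with x = 2 sin(u/2). -/
theorem continuous_sin_mul_log_chord :
    Continuous fun u => Real.sin u * Real.log (2 - 2 * Real.cos u) := by
  have h : (fun u => Real.sin u * Real.log (2 - 2 * Real.cos u)) = fun u =>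
      2 * Real.cos (u / 2) * ((2 * Real.sin (u / 2)) * Real.log (2 * Real.sin (u / 2))) := by
    ext u
    have h1 : 2 - 2 * Real.cos u = (2 * Real.sin (u / 2)) ^ 2 := by
      rw [mul_pow, Real.sin_sq_eq_half_sub]; ring_nf
    have h2 : Real.sin u = 2 * Real.sin (u / 2) * Real.cos (u / 2) := by
      rw [← Real.sin_two_mul]; ring_nf
    rw [h1, Real.log_pow, h2]; push_cast; ring
  rw [h]
  have := Real.continuous_mul_log.comp (f := fun u : ℝ => 2 * Real.sin (u / 2)) (by fun_prop)
  exact Continuous.mul (by fun_prop) this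

theorem cos_lt_one_of_mem_Ioo {u : ℝ} (hu : u ∈ Ioo 0 (2 * Real.pi)) : Real.cos u < 1 := by
  refine lt_of_le_of_ne (Real.cos_le_one u) fun h => ?_
  have h1 : Real.sin (u / 2) = 0 := by
    have := Real.sin_sq_eq_half_sub (u / 2)
    rw [show 2 * (u / 2) = u by ring, h] at this
    simpa using this
  have h2 : 0 < Real.sin (u / 2) :=
    Real.sin_pos_of_pos_of_lt_pi (by linarith [hu.1]) (by linarith [hu.2])
  exact h2.ne' h1

/-- Integration by parts. The factor sin u makes the primitive continuous and zero at the ends, and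
sin u times the derivative of the logarithm is 1 + cos u. This yields the Fourier coefficients of
log(2 - 2cos u), and it also removes the logarithm from the B' term of the boundary integral. -/
theorem integral_deriv_sin_mul_mul_log_chord {p p' : ℝ → ℝ} (hp : ∀ u, HasDerivAt p (p' u) u)
    (hc' : Continuous p') :
    ∫ u in (0)..(2 * Real.pi),
        (p' u * Real.sin u + p u * Real.cos u) * Real.log (2 - 2 * Real.cos u)
      = -∫ u in (0)..(2 * Real.pi), p u * (1 + Real.cos u) := by
  have h2pi : (0 : ℝ) ≤ 2 * Real.pi := by positivity
  have hc : Continuous p := continuous_iff_continuousAt.2 fun u => (hp u).continuousAt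
  have i1 : IntervalIntegrable (fun u => (p' u * Real.sin u + p u * Real.cos u)
      * Real.log (2 - 2 * Real.cos u)) volume 0 (2 * Real.pi) :=
    (intervalIntegrable_log_chord _ _).continuousOn_mul (Continuous.continuousOn (by fun_prop))
  have i2 : IntervalIntegrable (fun u => p u * (1 + Real.cos u)) volume 0 (2 * Real.pi) :=
    Continuous.intervalIntegrable (by fun_prop) _ _
  have h := intervalIntegral.integral_eq_sub_of_hasDerivAt_of_le h2pi
    (f := fun u => p u * (Real.sin u * Real.log (2 - 2 * Real.cos u)))
    (f' := fun u => (p' u * Real.sin u + p u * Real.cos u) * Real.log (2 - 2 * Real.cos u)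
      + p u * (1 + Real.cos u))
    (hc.mul continuous_sin_mul_log_chord).continuousOn (fun u hu => ?_) (i1.add i2)
  · rw [intervalIntegral.integral_add i1 i2] at h
    simp only [Real.sin_two_pi, Real.sin_zero, zero_mul, mul_zero, sub_zero] at h
    linarith
  · have hlt := cos_lt_one_of_mem_Ioo hu
    have hs : 2 - 2 * Real.cos u ≠ 0 := by linarith
    have h1 : HasDerivAt (fun u => 2 - 2 * Real.cos u) (2 * Real.sin u) u := by
      simpa using ((Real.hasDerivAt_cos u).const_mul 2).const_sub 2
    refine ((hp u).fun_mul ((Real.hasDerivAt_sin u).fun_mul (h1.log hs))).congr_deriv ?_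
    have := Real.sin_sq_add_cos_sq u
    have hs' : 1 - Real.cos u ≠ 0 := by linarith
    rw [show 2 - 2 * Real.cos u = 2 * (1 - Real.cos u) by ring]
    field_simp
    linear_combination p u * this

theorem integral_cos_nat_mul {n : ℕ} (hn : n ≠ 0) :
    ∫ u in (0)..(2 * Real.pi), Real.cos (n * u) = 0 := by
  have hn' : (n : ℝ) ≠ 0 := by exact_mod_cast hn
  rw [intervalIntegral.integral_comp_mul_left (fun x => Real.cos x) hn', integral_cos]
  have : Real.sin (n * (2 * Real.pi)) = 0 := by
    have := Real.sin_nat_mul_pi (2 * n)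
    push_cast at this
    rw [← this]; ring_nf
  simp [this]

theorem integral_sin_nat_mul (n : ℕ) :
    ∫ u in (0)..(2 * Real.pi), Real.sin (n * u) = 0 := by
  by_cases hn : n = 0
  · simp [hn]
  have hn' : (n : ℝ) ≠ 0 := by exact_mod_cast hn
  rw [intervalIntegral.integral_comp_mul_left (fun x => Real.sin x) hn', integral_sin]
  have := Real.cos_nat_mul_two_pi n
  simp [this]

theorem integral_sin_nat_mul_mul_log_chord (n : ℕ) :
    ∫ u in (0)..(2 * Real.pi), Real.sin (n * u) * Real.log (2 - 2 * Real.cos u) = 0 := by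
  have h := intervalIntegral.integral_comp_sub_left (a := 0) (b := 2 * Real.pi)
    (fun u => Real.sin (n * u) * Real.log (2 - 2 * Real.cos u)) (2 * Real.pi)
  have h1 : ∀ u, Real.sin (n * (2 * Real.pi - u)) * Real.log (2 - 2 * Real.cos (2 * Real.pi - u))
      = -(Real.sin (n * u) * Real.log (2 - 2 * Real.cos u)) := by
    intro u
    rw [Real.cos_two_pi_sub, mul_sub, Real.sin_nat_mul_two_pi_sub]; ring
  simp only [h1, sub_self, sub_zero, intervalIntegral.integral_neg] at h
  linarith

/-- The instance p sin u = (sin 2u)/2. This and the next two lemmas give the values -2π/j for j = 2,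
3, 4. -/
theorem integral_cos_two_mul_log_chord :
    ∫ u in (0)..(2 * Real.pi), Real.cos (2 * u) * Real.log (2 - 2 * Real.cos u) = -Real.pi := by
  have h := integral_deriv_sin_mul_mul_log_chord (p := fun u => Real.cos u)
    (p' := fun u => -Real.sin u) Real.hasDerivAt_cos (by fun_prop)
  have e1 : ∀ u, -Real.sin u * Real.sin u + Real.cos u * Real.cos u = Real.cos (2 * u) := fun u => by
    rw [Real.cos_two_mul]; linear_combination -Real.sin_sq_add_cos_sq u
  have e2 : ∀ u, Real.cos u * (1 + Real.cos u)
      = 1 / 2 + (Real.cos ((1 : ℕ) * u) + 1 / 2 * Real.cos ((2 : ℕ) * u)) := fun u => by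
    push_cast; rw [one_mul, Real.cos_two_mul]; ring
  simp only [e1, e2] at h
  rw [h, intervalIntegral.integral_add (by simp) (Continuous.intervalIntegrable (by fun_prop) _ _),
    intervalIntegral.integral_add (Continuous.intervalIntegrable (by fun_prop) _ _)
      (Continuous.intervalIntegrable (by fun_prop) _ _), intervalIntegral.integral_const_mul,
    integral_cos_nat_mul one_ne_zero, integral_cos_nat_mul two_ne_zero]
  simp; ring

theorem integral_cos_three_mul_log_chord :
    ∫ u in (0)..(2 * Real.pi), Real.cos (3 * u) * Real.log (2 - 2 * Real.cos u)
      = -(2 / 3 * Real.pi) := by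
  -- Chosen so that p sin u = (sin 3u)/3.
  have hp : ∀ u, HasDerivAt (fun u => (4 * Real.cos u ^ 2 - 1) / 3)
      (-(8 / 3) * Real.cos u * Real.sin u) u := fun u => by
    refine (((((Real.hasDerivAt_cos u).fun_pow 2).const_mul 4).sub_const 1).div_const 3).congr_deriv ?_
    simp; ring
  have h := integral_deriv_sin_mul_mul_log_chord hp (by fun_prop)
  have e1 : ∀ u, -(8 / 3) * Real.cos u * Real.sin u * Real.sin u
      + (4 * Real.cos u ^ 2 - 1) / 3 * Real.cos u = Real.cos (3 * u) := fun u => by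
    rw [Real.cos_three_mul]; linear_combination -(8 / 3) * Real.cos u * Real.sin_sq_add_cos_sq u
  have e2 : ∀ u, (4 * Real.cos u ^ 2 - 1) / 3 * (1 + Real.cos u)
      = 1 / 3 + (2 / 3 * Real.cos ((1 : ℕ) * u) + (2 / 3 * Real.cos ((2 : ℕ) * u)
        + 1 / 3 * Real.cos ((3 : ℕ) * u))) := fun u => by
    push_cast; rw [one_mul, Real.cos_two_mul, Real.cos_three_mul]; ring
  simp only [e1, e2] at h
  rw [h, intervalIntegral.integral_add (by simp) (Continuous.intervalIntegrable (by fun_prop) _ _),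
    intervalIntegral.integral_add (Continuous.intervalIntegrable (by fun_prop) _ _)
      (Continuous.intervalIntegrable (by fun_prop) _ _),
    intervalIntegral.integral_add (Continuous.intervalIntegrable (by fun_prop) _ _)
      (Continuous.intervalIntegrable (by fun_prop) _ _),
    intervalIntegral.integral_const_mul, intervalIntegral.integral_const_mul,
    intervalIntegral.integral_const_mul,
    integral_cos_nat_mul one_ne_zero, integral_cos_nat_mul two_ne_zero,
    integral_cos_nat_mul three_ne_zero]
  simp; ring

theorem integral_cos_four_mul_log_chord :
    ∫ u in (0)..(2 * Real.pi), Real.cos (4 * u) * Real.log (2 - 2 * Real.cos u)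
      = -(1 / 2 * Real.pi) := by
  -- Chosen so that p sin u = (sin 4u)/4.
  have hp : ∀ u, HasDerivAt (fun u => 2 * Real.cos u ^ 3 - Real.cos u)
      (-(6 * Real.cos u ^ 2 * Real.sin u) + Real.sin u) u := fun u => by
    refine ((((Real.hasDerivAt_cos u).fun_pow 3).const_mul 2).fun_sub
      (Real.hasDerivAt_cos u)).congr_deriv ?_
    simp; ring
  have h4 : ∀ u, Real.cos (4 * u) = 8 * Real.cos u ^ 4 - 8 * Real.cos u ^ 2 + 1 := fun u => by
    rw [show 4 * u = 2 * (2 * u) by ring, Real.cos_two_mul, Real.cos_two_mul]; ring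
  have h := integral_deriv_sin_mul_mul_log_chord hp (by fun_prop)
  have e1 : ∀ u, (-(6 * Real.cos u ^ 2 * Real.sin u) + Real.sin u) * Real.sin u
      + (2 * Real.cos u ^ 3 - Real.cos u) * Real.cos u = Real.cos (4 * u) := fun u => by
    rw [h4]; linear_combination (1 - 6 * Real.cos u ^ 2) * Real.sin_sq_add_cos_sq u
  have e2 : ∀ u, (2 * Real.cos u ^ 3 - Real.cos u) * (1 + Real.cos u)
      = 1 / 4 + (1 / 2 * Real.cos ((1 : ℕ) * u) + (1 / 2 * Real.cos ((2 : ℕ) * u)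
        + (1 / 2 * Real.cos ((3 : ℕ) * u) + 1 / 4 * Real.cos ((4 : ℕ) * u)))) := fun u => by
    push_cast; rw [one_mul, Real.cos_two_mul, Real.cos_three_mul, h4]; ring
  simp only [e1, e2] at h
  rw [h, intervalIntegral.integral_add (by simp) (Continuous.intervalIntegrable (by fun_prop) _ _),
    intervalIntegral.integral_add (Continuous.intervalIntegrable (by fun_prop) _ _)
      (Continuous.intervalIntegrable (by fun_prop) _ _),
    intervalIntegral.integral_add (Continuous.intervalIntegrable (by fun_prop) _ _)
      (Continuous.intervalIntegrable (by fun_prop) _ _),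
    intervalIntegral.integral_add (Continuous.intervalIntegrable (by fun_prop) _ _)
      (Continuous.intervalIntegrable (by fun_prop) _ _),
    intervalIntegral.integral_const_mul, intervalIntegral.integral_const_mul,
    intervalIntegral.integral_const_mul, intervalIntegral.integral_const_mul,
    integral_cos_nat_mul one_ne_zero, integral_cos_nat_mul two_ne_zero,
    integral_cos_nat_mul three_ne_zero, integral_cos_nat_mul four_ne_zero]
  simp; ring

/-- The boundary integral with the singularity split off: `v` is the quotient of `|A - B e^{iu}|²`
by `|1 - e^{iu}|²`. -/
theorem boundary_integral_eq {A : ℝ} {B B' v : ℝ → ℝ} (hd : ∀ u, HasDerivAt B (B' u) u)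
    (hc' : Continuous B') (hv : Continuous v) (hv0 : ∀ u, 0 < v u)
    (hN : ∀ u, sqGap A (B u) 1 u = (2 - 2 * Real.cos u) * v u) :
    ∫ u in (0)..(2 * Real.pi), (B u ^ 2 - A * (B' u * Real.sin u + B u * Real.cos u))
          * (Real.log (sqGap A (B u) 1 u) - 1)
      = (∫ u in (0)..(2 * Real.pi), B u ^ 2 * Real.log (2 - 2 * Real.cos u))
        + (∫ u in (0)..(2 * Real.pi), (A * B u * (1 + Real.cos u)
          + (B u ^ 2 - A * (B' u * Real.sin u + B u * Real.cos u)) * Real.log (v u)))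
        - ∫ u in (0)..(2 * Real.pi), B u ^ 2 := by
  have h2pi : (0 : ℝ) ≤ 2 * Real.pi := by positivity
  have hc : Continuous B := continuous_iff_continuousAt.2 fun u => (hd u).continuousAt
  have hlv : Continuous fun u => Real.log (v u) := hv.log fun u => (hv0 u).ne'
  have hI := integral_deriv_sin_mul_mul_log_chord hd hc'
  have hlog := intervalIntegrable_log_chord 0 (2 * Real.pi)
  -- Splitting the logarithm of the product requires 2 - 2cos u ≠ 0, hence only almost every u.
  have hae : ∀ᵐ u, u ∈ uIoc 0 (2 * Real.pi) →
      (B u ^ 2 - A * (B' u * Real.sin u + B u * Real.cos u)) * (Real.log (sqGap A (B u) 1 u) - 1)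
      = B u ^ 2 * Real.log (2 - 2 * Real.cos u)
        + (-A * ((B' u * Real.sin u + B u * Real.cos u) * Real.log (2 - 2 * Real.cos u))
        + ((B u ^ 2 - A * (B' u * Real.sin u + B u * Real.cos u)) * Real.log (v u)
        + (A * (B' u * Real.sin u + B u * Real.cos u) - B u ^ 2))) := by
    filter_upwards [ae_sin_ne_zero] with u hu _
    have h1 : 2 - 2 * Real.cos u ≠ 0 := fun h => hu (by
      have h2 : Real.cos u = 1 := by linarith
      exact Real.sin_eq_zero_iff_cos_eq.2 (Or.inl h2))
    rw [hN, Real.log_mul h1 (hv0 u).ne']; ring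
  have i1 : IntervalIntegrable (fun u => B u ^ 2 * Real.log (2 - 2 * Real.cos u)) volume
      0 (2 * Real.pi) := hlog.continuousOn_mul (Continuous.continuousOn (by fun_prop))
  have i2 : IntervalIntegrable (fun u => -A * ((B' u * Real.sin u + B u * Real.cos u)
      * Real.log (2 - 2 * Real.cos u))) volume 0 (2 * Real.pi) :=
    (hlog.continuousOn_mul (Continuous.continuousOn (by fun_prop))).const_mul _
  have i3 : IntervalIntegrable (fun u => (B u ^ 2 - A * (B' u * Real.sin u + B u * Real.cos u))
      * Real.log (v u)) volume 0 (2 * Real.pi) := Continuous.intervalIntegrable (by fun_prop) _ _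
  have i4 : IntervalIntegrable (fun u => A * (B' u * Real.sin u + B u * Real.cos u)) volume
      0 (2 * Real.pi) := Continuous.intervalIntegrable (by fun_prop) _ _
  have i5 : IntervalIntegrable (fun u => B u ^ 2) volume 0 (2 * Real.pi) :=
    Continuous.intervalIntegrable (by fun_prop) _ _
  have i6 : IntervalIntegrable (fun u => A * B u * (1 + Real.cos u)) volume 0 (2 * Real.pi) :=
    Continuous.intervalIntegrable (by fun_prop) _ _
  have hm : ∫ u in (0)..(2 * Real.pi), (B' u * Real.sin u + B u * Real.cos u) = 0 := by
    rw [intervalIntegral.integral_eq_sub_of_hasDerivAt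
      (f := fun u => B u * Real.sin u) (fun u _ => (hd u).fun_mul (Real.hasDerivAt_sin u))
      (Continuous.intervalIntegrable (by fun_prop) _ _)]
    simp
  rw [intervalIntegral.integral_congr_ae hae,
    intervalIntegral.integral_add i1 (i2.add (i3.add (i4.sub i5))),
    intervalIntegral.integral_add i2 (i3.add (i4.sub i5)),
    intervalIntegral.integral_add i3 (i4.sub i5), intervalIntegral.integral_sub i4 i5,
    intervalIntegral.integral_add i6 i3, intervalIntegral.integral_const_mul, hI,
    intervalIntegral.integral_const_mul A, hm]
  have : ∫ u in (0)..(2 * Real.pi), A * B u * (1 + Real.cos u)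
      = A * ∫ u in (0)..(2 * Real.pi), B u * (1 + Real.cos u) := by
    rw [← intervalIntegral.integral_const_mul]; simp only [mul_assoc]
  rw [this]; ring

/-! ### Taylor remainders of the logarithm -/

/-- The remainder in `log (1 + x) = x - x² / 2 + x³ logRem x`. -/
noncomputable def logRem (x : ℝ) : ℝ := ∫ t in (0 : ℝ)..1, t ^ 2 / (1 + t * x)

theorem one_add_mul_pos {t x : ℝ} (ht : t ∈ Icc (0 : ℝ) 1) (hx : -1 < x) : 0 < 1 + t * x := by
  rcases ht.1.eq_or_lt with h | h
  · rw [← h]; norm_num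
  · nlinarith [ht.2]

/-- The remainder comes from integrating along t ↦ log(1 + tx). As a parameter integral it is smooth
for all x > -1, including x = 0, where a quotient definition would need care. -/
theorem log_one_add_eq {x : ℝ} (hx : -1 < x) :
    Real.log (1 + x) = x - x ^ 2 / 2 + x ^ 3 * logRem x := by
  have hpos : ∀ t ∈ uIcc (0 : ℝ) 1, 1 + t * x ≠ 0 := fun t ht =>
    (one_add_mul_pos (by rwa [uIcc_of_le zero_le_one] at ht) hx).ne'
  have hc : ContinuousOn (fun t : ℝ => x ^ 3 * (t ^ 2 / (1 + t * x))) (uIcc (0 : ℝ) 1) :=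
    continuousOn_const.mul (ContinuousOn.div (by fun_prop) (by fun_prop) hpos)
  have h := intervalIntegral.integral_eq_sub_of_hasDerivAt
    (f := fun t : ℝ => Real.log (1 + t * x) - t * x + (t * x) ^ 2 / 2) (fun t ht => ?_)
    hc.intervalIntegrable
  · rw [intervalIntegral.integral_const_mul] at h
    rw [logRem, h]; simp
  · have h1 : HasDerivAt (fun t : ℝ => t * x) x t := by simpa using (hasDerivAt_id' t).mul_const x
    refine ((((h1.const_add 1).log (hpos t ht)).fun_sub h1).fun_add
      ((h1.fun_pow 2).div_const 2)).congr_deriv ?_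
    have := hpos t ht
    have e : x / (1 + t * x) = x - t * x ^ 2 + x ^ 3 * (t ^ 2 / (1 + t * x)) := by
      rw [div_eq_iff this, add_mul, mul_assoc (x ^ 3), div_mul_cancel₀ _ this]; ring
    rw [e]; push_cast; ring

theorem contDiffAt_logRem {x : ℝ} (hx : -1 < x) : ContDiffAt ℝ ∞ logRem x := by
  refine contDiffAt_intervalIntegral (f := fun x t : ℝ => t ^ 2 / (1 + t * x)) fun t ht => ?_
  have h := (one_add_mul_pos (by rwa [uIcc_of_le zero_le_one] at ht) hx).ne'
  exact ContDiffAt.div (f := fun p : ℝ × ℝ => p.2 ^ 2) (g := fun p : ℝ × ℝ => 1 + p.2 * p.1)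
    (by fun_prop) (by fun_prop) h

theorem contDiff_logRem_comp {X : Type} [NormedAddCommGroup X] [NormedSpace ℝ X] {f : X → ℝ}
    (hf : ContDiff ℝ ∞ f) (h : ∀ x, -1 < f x) : ContDiff ℝ ∞ fun x => logRem (f x) :=
  contDiff_iff_contDiffAt.2 fun x => (contDiffAt_logRem (h x)).comp x hf.contDiffAt

/-- The second order expansion of the integrand of the logarithmic potential of a nearly circular
patch. -/
theorem exists_chord_expansion {X : Type} [NormedAddCommGroup X] [NormedSpace ℝ X]
    {d a b b' κ C S : X → ℝ} (sd : ContDiff ℝ ∞ d) (sa : ContDiff ℝ ∞ a) (sb : ContDiff ℝ ∞ b)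
    (sb' : ContDiff ℝ ∞ b') (sκ : ContDiff ℝ ∞ κ) (sC : ContDiff ℝ ∞ C) (sS : ContDiff ℝ ∞ S)
    (ha : ∀ x, |d x * a x| ≤ 1 / 16) (hb : ∀ x, |d x * b x| ≤ 1 / 16) (hκ : ∀ x, 0 ≤ κ x)
    (hκC : ∀ x, (2 - 2 * C x) * κ x = (a x - b x) ^ 2) :
    ∃ h : X → ℝ, ContDiff ℝ ∞ h ∧ ∀ x,
      √(1 + 2 * d x * a x) * √(1 + 2 * d x * b x) * (1 + C x)
        + (√(1 + 2 * d x * b x) ^ 2 - √(1 + 2 * d x * a x) *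
            (d x * b' x / √(1 + 2 * d x * b x) * S x + √(1 + 2 * d x * b x) * C x))
          * Real.log (√(1 + 2 * d x * a x) * √(1 + 2 * d x * b x)
            + 4 * d x ^ 2 * κ x / (√(1 + 2 * d x * a x) + √(1 + 2 * d x * b x)) ^ 2)
      = (1 + C x) + 2 * d x * (a x + b x)
        + d x ^ 2 * ((2 * a x * b x + b x ^ 2 - a x ^ 2)
          - ((a x + b x) * b' x * S x + 1 / 2 * (a x + b x) ^ 2 * C x)) + d x ^ 3 * h x := by
  have pa : ∀ x, 0 < 1 + 2 * d x * a x := fun x => by linarith [(abs_le.1 (ha x)).1]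
  have pb : ∀ x, 0 < 1 + 2 * d x * b x := fun x => by linarith [(abs_le.1 (hb x)).1]
  obtain ⟨A, hA⟩ : ∃ f : X → ℝ, ∀ x, f x = √(1 + 2 * d x * a x) := ⟨_, fun _ => rfl⟩
  obtain ⟨B, hB⟩ : ∃ f : X → ℝ, ∀ x, f x = √(1 + 2 * d x * b x) := ⟨_, fun _ => rfl⟩
  have sA : ContDiff ℝ ∞ A := by
    rw [funext hA]; exact ContDiff.sqrt (by fun_prop) fun x => (pa x).ne'
  have sB : ContDiff ℝ ∞ B := by
    rw [funext hB]; exact ContDiff.sqrt (by fun_prop) fun x => (pb x).ne'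
  have A0 : ∀ x, 0 < A x := fun x => by rw [hA]; exact Real.sqrt_pos.2 (pa x)
  have B0 : ∀ x, 0 < B x := fun x => by rw [hB]; exact Real.sqrt_pos.2 (pb x)
  have A2 : ∀ x, A x ^ 2 = 1 + 2 * d x * a x := fun x => by rw [hA]; exact Real.sq_sqrt (pa x).le
  have B2 : ∀ x, B x ^ 2 = 1 + 2 * d x * b x := fun x => by rw [hB]; exact Real.sq_sqrt (pb x).le
  -- T is the second order Taylor polynomial of AB in d. The bounds 1/16 keep it positive, so that
  -- AB + T may be a denominator.
  obtain ⟨T, hT⟩ : ∃ f : X → ℝ, ∀ x, f x = 1 + d x * (a x + b x) - 1 / 2 * d x ^ 2 * (a x - b x) ^ 2 := ⟨_, fun _ => rfl⟩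
  have ST0 : ∀ x, A x * B x + T x ≠ 0 := fun x => by
    have h1 := mul_pos (A0 x) (B0 x)
    have h2 := abs_le.1 (ha x)
    have h3 := abs_le.1 (hb x)
    have : 0 < T x := by
      simp only [hT]
      nlinarith [sq_nonneg (d x * a x), sq_nonneg (d x * b x)]
    positivity
  have AB0 : ∀ x, A x + B x ≠ 0 := fun x => by have := A0 x; have := B0 x; positivity
  have AB0' : ∀ x, (A x + B x) ^ 2 ≠ 0 := fun x => pow_ne_zero 2 (AB0 x)
  have S0 : ∀ x, A x * B x ≠ 0 := fun x => by have := A0 x; have := B0 x; positivity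
  -- the expansion of `A B`
  obtain ⟨h₁, hh₁⟩ : ∃ f : X → ℝ, ∀ x, f x = ((a x + b x) * (a x - b x) ^ 2 - 1 / 4 * d x * (a x - b x) ^ 4)
    / (A x * B x + T x) := ⟨_, fun _ => rfl⟩
  have sT : ContDiff ℝ ∞ T := by rw [funext hT]; fun_prop
  have sh₁ : ContDiff ℝ ∞ h₁ := by
    rw [funext hh₁]; exact ContDiff.div (by fun_prop) (by fun_prop) ST0
  have eS : ∀ x, A x * B x = T x + d x ^ 3 * h₁ x := fun x => by
    -- A²B² and T² are polynomials in d that agree through order 2, so their difference carries an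
    -- explicit factor d³.
    have h1 : (A x * B x - T x) * (A x * B x + T x)
        = d x ^ 3 * ((a x + b x) * (a x - b x) ^ 2 - 1 / 4 * d x * (a x - b x) ^ 4) := by
      have : A x ^ 2 * B x ^ 2 = (1 + 2 * d x * a x) * (1 + 2 * d x * b x) := by rw [A2, B2]
      simp only [hT]
      linear_combination this
    have h2 := ST0 x
    simp only [hh₁]
    rw [mul_div_assoc', ← h1]
    field_simp
    ring
  -- the expansion of `v`
  obtain ⟨s₁, hs₁⟩ : ∃ f : X → ℝ, ∀ x, f x = (a x + b x) - 1 / 2 * d x * (a x - b x) ^ 2 + d x ^ 2 * h₁ x := ⟨_, fun _ => rfl⟩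
  have ss₁ : ContDiff ℝ ∞ s₁ := by rw [funext hs₁]; fun_prop
  have eS1 : ∀ x, A x * B x = 1 + d x * s₁ x := fun x => by
    rw [eS]; simp only [hT, hs₁]; ring
  obtain ⟨g₂, hg₂⟩ : ∃ f : X → ℝ, ∀ x, f x = (-2 * (a x + b x) - 2 * s₁ x) / (A x + B x) ^ 2 := ⟨_, fun _ => rfl⟩
  have sg₂ : ContDiff ℝ ∞ g₂ := by
    rw [funext hg₂]; exact ContDiff.div (by fun_prop) (by fun_prop) AB0'
  have eg₂ : ∀ x, 4 / (A x + B x) ^ 2 = 1 + d x * g₂ x := fun x => by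
    simp only [hg₂]
    have h1 := AB0 x
    have h2 : (A x + B x) ^ 2 = 2 + 2 * d x * (a x + b x) + 2 * (1 + d x * s₁ x) := by
      rw [← eS1]; linear_combination A2 x + B2 x
    have h3 := AB0' x
    rw [mul_div_assoc', eq_comm, add_div' _ _ _ h3, one_mul]
    congr 1
    rw [h2]; ring
  obtain ⟨x₂, hx₂⟩ : ∃ f : X → ℝ, ∀ x, f x = κ x - 1 / 2 * (a x - b x) ^ 2 + d x * (h₁ x + κ x * g₂ x) := ⟨_, fun _ => rfl⟩
  have sx₂ : ContDiff ℝ ∞ x₂ := by rw [funext hx₂]; fun_prop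
  obtain ⟨x₁, hx₁⟩ : ∃ f : X → ℝ, ∀ x, f x = (a x + b x) + d x * x₂ x := ⟨_, fun _ => rfl⟩
  have sx₁ : ContDiff ℝ ∞ x₁ := by rw [funext hx₁]; fun_prop
  have ev : ∀ x, A x * B x + 4 * d x ^ 2 * κ x / (A x + B x) ^ 2 = 1 + d x * x₁ x := fun x => by
    have : 4 * d x ^ 2 * κ x / (A x + B x) ^ 2 = d x ^ 2 * κ x * (4 / (A x + B x) ^ 2) := by ring
    rw [this, eg₂, eS]; simp only [hT, hx₁, hx₂]; ring
  have vpos : ∀ x, -1 < d x * x₁ x := fun x => by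
    have h1 := ev x
    have h2 := mul_pos (A0 x) (B0 x)
    have h3 := hκ x
    have h4 : 0 ≤ 4 * d x ^ 2 * κ x / (A x + B x) ^ 2 := by positivity
    linarith
  have sk : ContDiff ℝ ∞ fun x => logRem (d x * x₁ x) := contDiff_logRem_comp (by fun_prop) vpos
  -- The second order coefficient of the logarithm: κ - (a - b)²/2 from its argument, and -(a +
  -- b)²/2 from the square term of the logarithm.
  obtain ⟨l₂, hl₂⟩ : ∃ f : X → ℝ, ∀ x, f x = κ x - a x ^ 2 - b x ^ 2 := ⟨_, fun _ => rfl⟩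
  obtain ⟨l₃, hl₃⟩ : ∃ f : X → ℝ, ∀ x, f x = (h₁ x + κ x * g₂ x) - (a x + b x) * x₂ x - 1 / 2 * d x * x₂ x ^ 2
    + x₁ x ^ 3 * logRem (d x * x₁ x) := ⟨_, fun _ => rfl⟩
  have sl₃ : ContDiff ℝ ∞ l₃ := by rw [funext hl₃]; fun_prop
  have sl₂ : ContDiff ℝ ∞ l₂ := by rw [funext hl₂]; fun_prop
  have elog : ∀ x, Real.log (A x * B x + 4 * d x ^ 2 * κ x / (A x + B x) ^ 2)
      = d x * (a x + b x) + d x ^ 2 * l₂ x + d x ^ 3 * l₃ x := fun x => by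
    rw [ev, log_one_add_eq (vpos x)]
    simp only [hl₃, hl₂]
    generalize logRem (d x * x₁ x) = k
    simp only [hx₁, hx₂]; ring
  -- the expansion of the weight
  obtain ⟨g₃, hg₃⟩ : ∃ f : X → ℝ, ∀ x, f x = (2 * a x - s₁ x) / (A x * B x) := ⟨_, fun _ => rfl⟩
  have sg₃ : ContDiff ℝ ∞ g₃ := by
    rw [funext hg₃]; exact ContDiff.div (by fun_prop) (by fun_prop) S0
  obtain ⟨w₁, hw₁⟩ : ∃ f : X → ℝ, ∀ x, f x = 2 * b x - (a x + b x) * C x - b' x * S x := ⟨_, fun _ => rfl⟩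
  obtain ⟨w₂, hw₂⟩ : ∃ f : X → ℝ, ∀ x, f x = 1 / 2 * (a x - b x) ^ 2 * C x - d x * h₁ x * C x
    - b' x * g₃ x * S x := ⟨_, fun _ => rfl⟩
  have sw₁ : ContDiff ℝ ∞ w₁ := by rw [funext hw₁]; fun_prop
  have sw₂ : ContDiff ℝ ∞ w₂ := by rw [funext hw₂]; fun_prop
  have eAB : ∀ x, A x / B x = 1 + d x * g₃ x := fun x => by
    simp only [hg₃]
    have h1 := S0 x
    rw [mul_div_assoc', eq_comm, one_add_div h1]
    have h2 : A x * B x + d x * (2 * a x - s₁ x) = A x ^ 2 := by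
      rw [A2]; linear_combination eS1 x
    rw [h2]
    have := (A0 x).ne'
    have := (B0 x).ne'
    field_simp
  have eW : ∀ x, B x ^ 2 - A x * (d x * b' x / B x * S x + B x * C x)
      = (1 - C x) + d x * w₁ x + d x ^ 2 * w₂ x := fun x => by
    have h1 : A x * (d x * b' x / B x * S x + B x * C x)
        = d x * b' x * S x * (A x / B x) + A x * B x * C x := by ring
    rw [h1, eAB, eS, B2]; simp only [hT, hw₁, hw₂]; ring
  refine ⟨fun x => (1 + C x) * h₁ x + (1 - C x) * l₃ x + w₁ x * (l₂ x + d x * l₃ x)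
    + w₂ x * ((a x + b x) + d x * l₂ x + d x ^ 2 * l₃ x), by fun_prop, fun x => ?_⟩
  have e1 := eW x
  have e2 := elog x
  have e3 := eS x
  rw [hA, hB] at e1 e2 e3
  rw [e1, e2, e3]
  simp only [hT, hw₁, hl₂]
  -- At order d² the quotient κ occurs only as (1 - C)κ = (a - b)²/2, so it drops out of the
  -- explicit part.
  linear_combination d x ^ 2 / 2 * hκC x

/-! ### Boundary perturbations with three harmonics -/

@[fun_prop]
theorem contDiff_cis {n : WithTop ℕ∞} : ContDiff ℝ n cis := by
  unfold cis
  exact (contDiff_const.mul Complex.ofRealCLM.contDiff).cexp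

@[fun_prop]
theorem contDiff_re {n : WithTop ℕ∞} : ContDiff ℝ n Complex.re := Complex.reCLM.contDiff

@[fun_prop]
theorem contDiff_im {n : WithTop ℕ∞} : ContDiff ℝ n Complex.im := Complex.imCLM.contDiff

@[fun_prop]
theorem contDiff_ofReal {n : WithTop ℕ∞} : ContDiff ℝ n Complex.ofReal :=
  Complex.ofRealCLM.contDiff

/-- `Re (a e^{2iθ} + b e^{3iθ} + c e^{4iθ})`. -/
noncomputable def shape (a b c : ℂ) (θ : ℝ) : ℝ :=
  (a * cis (2 * θ) + b * cis (3 * θ) + c * cis (4 * θ)).re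

theorem contDiff_shape {E : Type} [NormedAddCommGroup E] [NormedSpace ℝ E] {a b c : E → ℂ}
    {θ : E → ℝ} (ha : ContDiff ℝ ∞ a) (hb : ContDiff ℝ ∞ b) (hc : ContDiff ℝ ∞ c)
    (hθ : ContDiff ℝ ∞ θ) : ContDiff ℝ ∞ fun p => shape (a p) (b p) (c p) (θ p) := by
  unfold shape
  fun_prop

theorem hasDerivAt_re_mul_cis (a : ℂ) (k θ : ℝ) :
    HasDerivAt (fun θ => a * cis (k * θ)) (Complex.I * k * a * cis (k * θ)) θ := by
  have h1 : HasDerivAt (fun θ : ℝ => k * θ) k θ := by simpa using (hasDerivAt_id' θ).const_mul k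
  exact ((hasDerivAt_cis_comp h1).const_mul a).congr_deriv (by ring)

theorem hasDerivAt_re {f : ℝ → ℂ} {f' : ℂ} {x : ℝ} (h : HasDerivAt f f' x) :
    HasDerivAt (fun x => (f x).re) f'.re x :=
  Complex.reCLM.hasFDerivAt.comp_hasDerivAt x h

theorem hasDerivAt_shape (a b c : ℂ) (θ : ℝ) : HasDerivAt (shape a b c)
    (shape (Complex.I * 2 * a) (Complex.I * 3 * b) (Complex.I * 4 * c) θ) θ := by
  have h := ((hasDerivAt_re_mul_cis a 2 θ).fun_add (hasDerivAt_re_mul_cis b 3 θ)).fun_add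
    (hasDerivAt_re_mul_cis c 4 θ)
  refine (hasDerivAt_re h).congr_deriv ?_
  simp only [shape]; push_cast; rfl

theorem cis_nat_mul_add_two_pi (n : ℕ) (θ : ℝ) : cis (n * (θ + 2 * Real.pi)) = cis (n * θ) := by
  have h := cis_int_mul_two_pi n
  rw [mul_add, cis_add]
  push_cast at h
  rw [h, mul_one]

theorem shape_add_two_pi (a b c : ℂ) (θ : ℝ) : shape a b c (θ + 2 * Real.pi) = shape a b c θ := by
  have h2 := cis_nat_mul_add_two_pi 2 θ
  have h3 := cis_nat_mul_add_two_pi 3 θ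
  have h4 := cis_nat_mul_add_two_pi 4 θ
  push_cast at h2 h3 h4
  rw [shape, h2, h3, h4, shape]

theorem abs_shape_le (a b c : ℂ) (θ : ℝ) : |shape a b c θ| ≤ ‖a‖ + ‖b‖ + ‖c‖ := by
  refine (Complex.abs_re_le_norm _).trans ((norm_add₃_le).trans (le_of_eq ?_))
  simp [norm_cis]

theorem shape_add (a b c : ℂ) (θ u : ℝ) : shape a b c (θ + u)
    = (a * cis (2 * θ)).re * Real.cos (2 * u) - (a * cis (2 * θ)).im * Real.sin (2 * u)
    + ((b * cis (3 * θ)).re * Real.cos (3 * u) - (b * cis (3 * θ)).im * Real.sin (3 * u))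
    + ((c * cis (4 * θ)).re * Real.cos (4 * u) - (c * cis (4 * θ)).im * Real.sin (4 * u)) := by
  have h : ∀ (z : ℂ) (x : ℝ), (z * cis x).re = z.re * Real.cos x - z.im * Real.sin x := by
    intro z x
    rw [cis_eq]
    simp only [Complex.add_re, Complex.add_im, Complex.mul_re, Complex.mul_im, Complex.ofReal_re,
      Complex.ofReal_im, Complex.I_re, Complex.I_im]
    ring
  rw [shape, mul_add, mul_add, mul_add, cis_add, cis_add, cis_add, ← mul_assoc, ← mul_assoc,
    ← mul_assoc, Complex.add_re, Complex.add_re, h (a * cis (2 * θ)) (2 * u),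
    h (b * cis (3 * θ)) (3 * u), h (c * cis (4 * θ)) (4 * u)]

theorem integral_shape_add (a b c : ℂ) (θ : ℝ) :
    ∫ u in (0)..(2 * Real.pi), shape a b c (θ + u) = 0 := by
  have c2 := integral_cos_nat_mul two_ne_zero
  have c3 := integral_cos_nat_mul three_ne_zero
  have c4 := integral_cos_nat_mul four_ne_zero
  have s2 := integral_sin_nat_mul 2
  have s3 := integral_sin_nat_mul 3
  have s4 := integral_sin_nat_mul 4
  push_cast at c2 c3 c4 s2 s3 s4
  have ii : ∀ {f : ℝ → ℝ}, Continuous f → IntervalIntegrable f volume 0 (2 * Real.pi) :=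
    fun h => h.intervalIntegrable _ _
  simp only [shape_add]
  rw [intervalIntegral.integral_add (ii (by fun_prop)) (ii (by fun_prop)),
    intervalIntegral.integral_add (ii (by fun_prop)) (ii (by fun_prop)),
    intervalIntegral.integral_sub (ii (by fun_prop)) (ii (by fun_prop)),
    intervalIntegral.integral_sub (ii (by fun_prop)) (ii (by fun_prop)),
    intervalIntegral.integral_sub (ii (by fun_prop)) (ii (by fun_prop))]
  simp only [intervalIntegral.integral_const_mul, c2, c3, c4, s2, s3, s4]
  simp

/-- The sine parts vanish by symmetry and cos(ju) contributes -2π/j. The chord logarithm therefore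
acts on the j-th harmonic as multiplication by -2π/j. -/
theorem integral_shape_add_mul_log_chord (a b c : ℂ) (θ : ℝ) :
    ∫ u in (0)..(2 * Real.pi), shape a b c (θ + u) * Real.log (2 - 2 * Real.cos u)
      = -(2 * Real.pi) * shape (a / 2) (b / 3) (c / 4) θ := by
  have c2 := integral_cos_two_mul_log_chord
  have c3 := integral_cos_three_mul_log_chord
  have c4 := integral_cos_four_mul_log_chord
  have s2 := integral_sin_nat_mul_mul_log_chord 2
  have s3 := integral_sin_nat_mul_mul_log_chord 3
  have s4 := integral_sin_nat_mul_mul_log_chord 4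
  push_cast at s2 s3 s4
  have hl := intervalIntegrable_log_chord 0 (2 * Real.pi)
  have ic : ∀ (z k : ℝ), IntervalIntegrable
      (fun u => z * (Real.cos (k * u) * Real.log (2 - 2 * Real.cos u))) volume 0 (2 * Real.pi) :=
    fun z k => (hl.continuousOn_mul (Continuous.continuousOn (by fun_prop))).const_mul z
  have is : ∀ (z k : ℝ), IntervalIntegrable
      (fun u => z * (Real.sin (k * u) * Real.log (2 - 2 * Real.cos u))) volume 0 (2 * Real.pi) :=
    fun z k => (hl.continuousOn_mul (Continuous.continuousOn (by fun_prop))).const_mul z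
  simp only [shape_add, add_mul, sub_mul, mul_assoc]
  rw [intervalIntegral.integral_add (((ic _ _).sub (is _ _)).add ((ic _ _).sub (is _ _)))
      ((ic _ _).sub (is _ _)),
    intervalIntegral.integral_add ((ic _ _).sub (is _ _)) ((ic _ _).sub (is _ _)),
    intervalIntegral.integral_sub (ic _ _) (is _ _),
    intervalIntegral.integral_sub (ic _ _) (is _ _),
    intervalIntegral.integral_sub (ic _ _) (is _ _)]
  simp only [intervalIntegral.integral_const_mul, c2, c3, c4, s2, s3, s4]
  have h2 : (a / 2 * cis (2 * θ)).re = (a * cis (2 * θ)).re / 2 := by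
    rw [div_mul_eq_mul_div, Complex.div_ofNat_re]
  have h3 : (b / 3 * cis (3 * θ)).re = (b * cis (3 * θ)).re / 3 := by
    rw [div_mul_eq_mul_div, Complex.div_ofNat_re]
  have h4 : (c / 4 * cis (4 * θ)).re = (c * cis (4 * θ)).re / 4 := by
    rw [div_mul_eq_mul_div, Complex.div_ofNat_re]
  rw [shape, Complex.add_re, Complex.add_re, h2, h3, h4]
  ring

/-- The square of the difference quotient of `shape a b c` with respect to the chord length. -/
noncomputable def sqQuot (a b c : ℂ) (θ u : ℝ) : ℝ :=
  (cis (u / 2) * (a * cis (2 * θ) * (1 + cis u) + b * cis (3 * θ) * (1 + cis u + cis (2 * u))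
    + c * cis (4 * θ) * (1 + cis u + cis (2 * u) + cis (3 * u)))).im ^ 2

/-- Geometric sums give 1 - e^{iju} = (1 - e^{iu})(1 + … + e^{i(j-1)u}), and 1 - e^{iu} = -2i
sin(u/2)e^{iu/2}. The quotient is therefore a trigonometric expression, smooth also where the chord
vanishes. -/
theorem mul_sqQuot (a b c : ℂ) (θ u : ℝ) :
    (2 - 2 * Real.cos u) * sqQuot a b c θ u = (shape a b c θ - shape a b c (θ + u)) ^ 2 := by
  set D := a * cis (2 * θ) * (1 + cis u) + b * cis (3 * θ) * (1 + cis u + cis (2 * u))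
    + c * cis (4 * θ) * (1 + cis u + cis (2 * u) + cis (3 * u)) with hD
  have h2 : cis (2 * u) = cis u ^ 2 := by rw [two_mul, cis_add, sq]
  have h3 : cis (3 * u) = cis u ^ 3 := by
    rw [show 3 * u = 2 * u + u by ring, cis_add, h2]; ring
  have h4 : cis (4 * u) = cis u ^ 4 := by
    rw [show 4 * u = 2 * u + 2 * u by ring, cis_add, h2]; ring
  have h1 : shape a b c θ - shape a b c (θ + u) = ((1 - cis u) * D).re := by
    rw [shape, shape, ← Complex.sub_re]
    congr 1
    rw [hD, mul_add, mul_add, mul_add, cis_add, cis_add, cis_add, h2, h3, h4]; ring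
  have hc : Real.cos u = 1 - 2 * Real.sin (u / 2) ^ 2 := by
    rw [Real.sin_sq_eq_half_sub]; ring_nf
  have hs : Real.sin u = 2 * Real.sin (u / 2) * Real.cos (u / 2) := by
    rw [← Real.sin_two_mul]; ring_nf
  have h5 : 1 - cis u = -(Complex.I * ((2 * Real.sin (u / 2) : ℝ) : ℂ)) * cis (u / 2) := by
    rw [cis_eq, cis_eq, hc, hs]
    push_cast
    linear_combination (2 * Complex.sin (↑u / 2) ^ 2) * Complex.I_sq
  have h6 : ((1 - cis u) * D).re = 2 * Real.sin (u / 2) * (cis (u / 2) * D).im := by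
    rw [h5, mul_assoc, neg_mul, mul_assoc, Complex.neg_re, Complex.I_mul_re, Complex.im_ofReal_mul]
    ring
  rw [h1, h6, hc, sqQuot, ← hD]; ring

/-- The logarithmic potential is rotation invariant. Turning by -θ moves the evaluation point to the
positive real axis, as Green's formula requires. -/
theorem polarIntegral_rotate {ρ : ℝ → ℝ} (hρ : ∀ η, ρ (η + 2 * Real.pi) = ρ η) (θ : ℝ) :
    polarIntegral ρ (fun l η => Real.log ‖((ρ θ : ℝ) : ℂ) * cis θ - (l : ℂ) * cis η‖)
      = 1 / (2 * Real.pi) * ∫ u in (0)..(2 * Real.pi), ∫ l in (0)..(ρ (θ + u)),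
        Real.log ‖((ρ θ : ℝ) : ℂ) - (l : ℂ) * cis u‖ * l := by
  unfold polarIntegral
  congr 1
  set f : ℝ → ℝ := fun η => ∫ l in (0)..(ρ η),
    Real.log ‖((ρ θ : ℝ) : ℂ) * cis θ - (l : ℂ) * cis η‖ * l with hf
  have hper : Function.Periodic f (2 * Real.pi) := fun η => by
    have := cis_nat_mul_add_two_pi 1 η
    simp only [Nat.cast_one, one_mul] at this
    simp only [hf, hρ, this]
  have h1 := hper.intervalIntegral_add_eq 0 θ
  rw [zero_add] at h1
  have h2 := intervalIntegral.integral_comp_add_left (a := 0) (b := 2 * Real.pi) f θ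
  rw [add_zero] at h2
  rw [h1, ← h2]
  congr 1
  ext u
  simp only [hf]
  congr 1
  ext l
  congr 2
  rw [cis_add, show ((ρ θ : ℝ) : ℂ) * cis θ - (l : ℂ) * (cis θ * cis u)
    = cis θ * (((ρ θ : ℝ) : ℂ) - (l : ℂ) * cis u) by ring, norm_mul, norm_cis, one_mul]

/-! ### The stream function of a patch at its own boundary -/

theorem integral_sq_shape_add (a b c : ℂ) (θ : ℝ) :
    ∫ u in (0)..(2 * Real.pi), shape a b c (θ + u) ^ 2
      = ∫ u in (0)..(2 * Real.pi), shape a b c u ^ 2 := by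
  have hper : Function.Periodic (fun u => shape a b c u ^ 2) (2 * Real.pi) := fun u => by
    simp only [shape_add_two_pi]
  have h1 := hper.intervalIntegral_add_eq 0 θ
  have h2 := intervalIntegral.integral_comp_add_left (a := 0) (b := 2 * Real.pi)
    (fun u => shape a b c u ^ 2) θ
  rw [zero_add] at h1
  rw [add_zero] at h2
  rw [h1, ← h2]

theorem continuous_shape (a b c : ℂ) : Continuous (shape a b c) :=
  continuous_iff_continuousAt.2 fun u => (hasDerivAt_shape a b c u).continuousAt

theorem hasDerivAt_shape_add (a b c : ℂ) (θ u : ℝ) : HasDerivAt (fun u => shape a b c (θ + u))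
    (shape (Complex.I * 2 * a) (Complex.I * 3 * b) (Complex.I * 4 * c) (θ + u)) u := by
  simpa using (hasDerivAt_shape a b c (θ + u)).comp_const_add θ u

/-- The integrand is the derivative of (1/2)(m + r)² sin u. This removes the second order terms of
the chord expansion that contain sin u and cos u. -/
theorem integral_shape_flux (a b c : ℂ) (θ m : ℝ) :
    ∫ u in (0)..(2 * Real.pi), ((m + shape a b c (θ + u))
        * shape (Complex.I * 2 * a) (Complex.I * 3 * b) (Complex.I * 4 * c) (θ + u) * Real.sin u
      + 1 / 2 * (m + shape a b c (θ + u)) ^ 2 * Real.cos u) = 0 := by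
  have c1 : Continuous fun u => shape a b c (θ + u) := (continuous_shape a b c).comp (by fun_prop)
  have c2 : Continuous fun u =>
      shape (Complex.I * 2 * a) (Complex.I * 3 * b) (Complex.I * 4 * c) (θ + u) :=
    (continuous_shape _ _ _).comp (by fun_prop)
  rw [intervalIntegral.integral_eq_sub_of_hasDerivAt
    (f := fun u => 1 / 2 * (m + shape a b c (θ + u)) ^ 2 * Real.sin u)]
  · simp
  · intro u _
    exact ((((hasDerivAt_shape_add a b c θ u).const_add m).fun_pow 2).const_mul (1 / 2)
      |>.fun_mul (Real.hasDerivAt_sin u)).congr_deriv (by push_cast; ring)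
  · exact Continuous.intervalIntegrable (by fun_prop) _ _

theorem contDiff_sqQuot {E : Type} [NormedAddCommGroup E] [NormedSpace ℝ E] {a b c : E → ℂ}
    {θ u : E → ℝ} (ha : ContDiff ℝ ∞ a) (hb : ContDiff ℝ ∞ b) (hc : ContDiff ℝ ∞ c)
    (hθ : ContDiff ℝ ∞ θ) (hu : ContDiff ℝ ∞ u) :
    ContDiff ℝ ∞ fun p => sqQuot (a p) (b p) (c p) (θ p) (u p) := by
  unfold sqQuot
  have : ContDiff ℝ ∞ fun p => u p / 2 := hu.div_const 2
  fun_prop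

/-- The logarithmic potential of the disc perturbed by `δ` times three harmonics, evaluated on the
boundary, to second order in `δ`. -/
theorem exists_self_expansion {E : Type} [NormedAddCommGroup E] [NormedSpace ℝ E] {δ : E → ℝ}
    {a b c : E → ℂ} (sδ : ContDiff ℝ ∞ δ) (sa : ContDiff ℝ ∞ a) (sb : ContDiff ℝ ∞ b)
    (sc : ContDiff ℝ ∞ c) (hsmall : ∀ p, |δ p| * (‖a p‖ + ‖b p‖ + ‖c p‖) ≤ 1 / 16) :
    ∃ (K : E → ℝ) (H : E × ℝ → ℝ), ContDiff ℝ ∞ H ∧ ∀ p θ,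
      polarIntegral (fun η => √(1 + 2 * δ p * shape (a p) (b p) (c p) η)) (fun l η =>
        Real.log ‖((√(1 + 2 * δ p * shape (a p) (b p) (c p) θ) : ℝ) : ℂ) * cis θ
          - (l : ℂ) * cis η‖)
      = K p + δ p * shape (a p / 4) (b p / 3) (3 * c p / 8) θ
        - δ p ^ 2 / 4 * shape (a p) (b p) (c p) θ ^ 2 + δ p ^ 3 * H (p, θ) := by
  have hsm : ∀ p θ, |δ p * shape (a p) (b p) (c p) θ| ≤ 1 / 16 := fun p θ => by
    rw [abs_mul]
    exact (mul_le_mul_of_nonneg_left (abs_shape_le _ _ _ _) (abs_nonneg _)).trans (hsmall p)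
  obtain ⟨h, sh, hh⟩ := exists_chord_expansion (X := (E × ℝ) × ℝ)
    (d := fun x => δ x.1.1) (a := fun x => shape (a x.1.1) (b x.1.1) (c x.1.1) x.1.2)
    (b := fun x => shape (a x.1.1) (b x.1.1) (c x.1.1) (x.1.2 + x.2))
    (b' := fun x => shape (Complex.I * 2 * a x.1.1) (Complex.I * 3 * b x.1.1)
      (Complex.I * 4 * c x.1.1) (x.1.2 + x.2))
    (κ := fun x => sqQuot (a x.1.1) (b x.1.1) (c x.1.1) x.1.2 x.2)
    (C := fun x => Real.cos x.2) (S := fun x => Real.sin x.2)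
    (by fun_prop) (contDiff_shape (by fun_prop) (by fun_prop) (by fun_prop) (by fun_prop))
    (contDiff_shape (by fun_prop) (by fun_prop) (by fun_prop) (by fun_prop))
    (contDiff_shape (by fun_prop) (by fun_prop) (by fun_prop) (by fun_prop))
    (contDiff_sqQuot (by fun_prop) (by fun_prop) (by fun_prop) (by fun_prop) (by fun_prop))
    (by fun_prop) (by fun_prop) (fun x => hsm _ _) (fun x => hsm _ _) (fun x => sq_nonneg _)
    (fun x => mul_sqQuot _ _ _ _ _)
  -- The factor 1/(8π) combines the normalised measure 1/(2π) with the 1/4 of Green's formula. The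
  -- second order term that is independent of θ goes into K.
  refine ⟨fun p => 1 / (8 * Real.pi) * ((∫ u in (0)..(2 * Real.pi), Real.log (2 - 2 * Real.cos u))
      + δ p ^ 2 * ∫ u in (0)..(2 * Real.pi), shape (a p) (b p) (c p) u ^ 2),
    fun x => 1 / (8 * Real.pi) * ∫ u in (0)..(2 * Real.pi), h (x, u),
    contDiff_const.mul (contDiff_intervalIntegral (f := fun x u => h (x, u)) sh), fun p θ => ?_⟩
  have hx : ∀ u, _ := fun u => hh ((p, θ), u)
  dsimp only at hx
  have shu : Continuous fun u => h ((p, θ), u) := sh.continuous.comp (by fun_prop)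
  clear hh sh
  beta_reduce
  generalize hδ : δ p = d at *
  have hs : ∀ η, |d * shape (a p) (b p) (c p) η| ≤ 1 / 16 := fun η => hδ ▸ hsm p η
  generalize a p = a at *
  generalize b p = b at *
  generalize c p = c at *
  have hpos : ∀ η, 0 < 1 + 2 * d * shape a b c η := fun η => by linarith [(abs_le.1 (hs η)).1]
  have c1 : Continuous fun u => shape a b c (θ + u) := (continuous_shape a b c).comp (by fun_prop)
  have c2 : Continuous fun u =>
      shape (Complex.I * 2 * a) (Complex.I * 3 * b) (Complex.I * 4 * c) (θ + u) :=
    (continuous_shape _ _ _).comp (by fun_prop)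
  rw [polarIntegral_rotate (ρ := fun η => √(1 + 2 * d * shape a b c η))
    (fun η => by simp only [shape_add_two_pi]) θ]
  have hd : ∀ u, HasDerivAt (fun u => √(1 + 2 * d * shape a b c (θ + u)))
      (d * shape (Complex.I * 2 * a) (Complex.I * 3 * b) (Complex.I * 4 * c) (θ + u)
        / √(1 + 2 * d * shape a b c (θ + u))) u := fun u => by
    refine ((((hasDerivAt_shape_add a b c θ u).const_mul (2 * d)).const_add 1).sqrt
      (hpos _).ne').congr_deriv ?_
    have := (Real.sqrt_pos.2 (hpos (θ + u))).ne'
    field_simp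
  have hB0 : ∀ η, 0 < √(1 + 2 * d * shape a b c η) := fun η => Real.sqrt_pos.2 (hpos η)
  have hB2 : ∀ η, √(1 + 2 * d * shape a b c η) ^ 2 = 1 + 2 * d * shape a b c η :=
    fun η => Real.sq_sqrt (hpos η).le
  have hc' : Continuous fun u =>
      d * shape (Complex.I * 2 * a) (Complex.I * 3 * b) (Complex.I * 4 * c) (θ + u)
        / √(1 + 2 * d * shape a b c (θ + u)) :=
    Continuous.div (by fun_prop) (by fun_prop) fun u => (hB0 _).ne'
  rw [(integral_log_eq_boundary (hB0 θ) (fun u => hB0 _) (by simp)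
    (by simp only [shape_add_two_pi]) hd hc').2]
  have cq : Continuous fun u => sqQuot a b c θ u := (contDiff_sqQuot (E := ℝ) contDiff_const
    contDiff_const contDiff_const contDiff_const contDiff_id).continuous
  -- Here |A - B e^{iu}|² = AB(2 - 2cos u) + (A - B)², and A - B = 2d(r(θ) - r(θ + u))/(A + B).
  rw [boundary_integral_eq (v := fun u => √(1 + 2 * d * shape a b c θ)
      * √(1 + 2 * d * shape a b c (θ + u)) + 4 * d ^ 2 * sqQuot a b c θ u
        / (√(1 + 2 * d * shape a b c θ) + √(1 + 2 * d * shape a b c (θ + u))) ^ 2) hd hc'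
    ((by fun_prop : Continuous fun u => √(1 + 2 * d * shape a b c θ)
      * √(1 + 2 * d * shape a b c (θ + u))).add (Continuous.div (by fun_prop) (by fun_prop)
        fun u => (pow_pos (add_pos (hB0 _) (hB0 _)) 2).ne'))
    (fun u => add_pos_of_pos_of_nonneg (mul_pos (hB0 _) (hB0 _))
      (div_nonneg (mul_nonneg (by positivity) (sq_nonneg _)) (sq_nonneg _)))
    (fun u => ?_)]
  · simp only [hx]
    simp only [hB2]
    have ii : ∀ {f : ℝ → ℝ}, Continuous f → IntervalIntegrable f volume 0 (2 * Real.pi) :=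
      fun h => h.intervalIntegrable _ _
    have hlog := intervalIntegrable_log_chord 0 (2 * Real.pi)
    have e1 : ∫ u in (0)..(2 * Real.pi), (1 + 2 * d * shape a b c (θ + u))
          * Real.log (2 - 2 * Real.cos u)
        = (∫ u in (0)..(2 * Real.pi), Real.log (2 - 2 * Real.cos u))
          + 2 * d * (-(2 * Real.pi) * shape (a / 2) (b / 3) (c / 4) θ) := by
      rw [← integral_shape_add_mul_log_chord, ← intervalIntegral.integral_const_mul,
        ← intervalIntegral.integral_add hlog
          ((hlog.continuousOn_mul c1.continuousOn).const_mul _)]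
      congr 1; ext u; ring
    have e2 : ∫ u in (0)..(2 * Real.pi), (1 + 2 * d * shape a b c (θ + u)) = 2 * Real.pi := by
      rw [intervalIntegral.integral_add (ii (by fun_prop)) (ii (by fun_prop)),
        intervalIntegral.integral_const_mul, integral_shape_add]
      simp
    have hcos : ∫ u in (0)..(2 * Real.pi), Real.cos u = 0 := by simp
    have e3 : ∫ u in (0)..(2 * Real.pi), ((1 + Real.cos u)
          + 2 * d * (shape a b c θ + shape a b c (θ + u))
          + d ^ 2 * ((2 * shape a b c θ * shape a b c (θ + u) + shape a b c (θ + u) ^ 2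
            - shape a b c θ ^ 2) - ((shape a b c θ + shape a b c (θ + u))
              * shape (Complex.I * 2 * a) (Complex.I * 3 * b) (Complex.I * 4 * c) (θ + u)
                * Real.sin u + 1 / 2 * (shape a b c θ + shape a b c (θ + u)) ^ 2 * Real.cos u))
          + d ^ 3 * h ((p, θ), u))
        = 2 * Real.pi + 2 * d * (2 * Real.pi * shape a b c θ)
          + d ^ 2 * ((∫ u in (0)..(2 * Real.pi), shape a b c u ^ 2)
            - 2 * Real.pi * shape a b c θ ^ 2)
          + d ^ 3 * ∫ u in (0)..(2 * Real.pi), h ((p, θ), u) := by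
      rw [intervalIntegral.integral_add (ii (by fun_prop)) ((ii shu).const_mul _),
        intervalIntegral.integral_add (ii (by fun_prop)) (ii (by fun_prop)),
        intervalIntegral.integral_add (ii (by fun_prop)) (ii (by fun_prop)),
        intervalIntegral.integral_add (ii (by fun_prop)) (ii (by fun_prop)),
        intervalIntegral.integral_const_mul, intervalIntegral.integral_const_mul,
        intervalIntegral.integral_const_mul,
        intervalIntegral.integral_sub (ii (by fun_prop)) (ii (by fun_prop)),
        intervalIntegral.integral_sub (ii (by fun_prop)) (ii (by fun_prop)),
        intervalIntegral.integral_add (ii (by fun_prop)) (ii (by fun_prop)),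
        intervalIntegral.integral_add (ii (by fun_prop)) (ii (by fun_prop)),
        intervalIntegral.integral_const_mul, integral_shape_flux, integral_shape_add,
        integral_sq_shape_add, hcos]
      simp
    rw [e1, e2, e3]
    -- The multiplier 1/2 - 1/(2j) at j = 2, 3, 4: the first part comes from the regular integral,
    -- the second from the chord logarithm.
    have h2 : shape (a / 4) (b / 3) (3 * c / 8) θ
        = 1 / 2 * shape a b c θ - 1 / 2 * shape (a / 2) (b / 3) (c / 4) θ := by
      have key : ∀ (x : ℝ) (z : ℂ), x * z.re = ((x : ℂ) * z).re := fun x z => by simp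
      simp only [shape]
      rw [key, key, ← Complex.sub_re]
      congr 1
      push_cast
      ring
    rw [h2]
    have := Real.pi_pos.ne'
    field_simp
    ring
  · have q := mul_sqQuot a b c θ u
    have hA := hB2 θ
    have hB := hB2 (θ + u)
    have hA0 := hB0 θ
    have hBp := hB0 (θ + u)
    generalize √(1 + 2 * d * shape a b c θ) = A at *
    generalize √(1 + 2 * d * shape a b c (θ + u)) = B at *
    generalize shape a b c θ = x at *
    generalize shape a b c (θ + u) = y at *
    generalize sqQuot a b c θ u = κ at *
    have h3 : (A ^ 2 - B ^ 2) ^ 2 = 4 * d ^ 2 * ((2 - 2 * Real.cos u) * κ) := by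
      rw [q, hA, hB]; ring
    have : A + B ≠ 0 := by positivity
    unfold sqGap
    field_simp
    linear_combination h3

/-! ### Logarithmic interaction of distant patches -/

/-- The fifth order remainder of the logarithm. -/
noncomputable def clogRem (z : ℂ) : ℂ := ∫ t in (0 : ℝ)..1, (t : ℂ) ^ 4 / (1 + (t : ℂ) * z)

theorem one_add_mul_mem_slitPlane {z : ℂ} (hz : ‖z‖ < 1) {t : ℝ} (ht : t ∈ Icc (0 : ℝ) 1) :
    1 + (t : ℂ) * z ∈ Complex.slitPlane := by
  refine Complex.mem_slitPlane_of_norm_lt_one (lt_of_le_of_lt ?_ hz)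
  rw [norm_mul, Complex.norm_real, Real.norm_of_nonneg ht.1]
  exact mul_le_of_le_one_left (norm_nonneg _) ht.2

theorem contDiffAt_clogRem {z : ℂ} (hz : ‖z‖ < 1) : ContDiffAt ℝ ∞ clogRem z := by
  refine contDiffAt_intervalIntegral (f := fun (z : ℂ) (t : ℝ) =>
    (t : ℂ) ^ 4 / (1 + (t : ℂ) * z)) fun t ht => ?_
  rw [uIcc_of_le zero_le_one] at ht
  have h1 : ContDiffAt ℝ ∞ (fun x : ℂ × ℝ => (x.2 : ℂ) ^ 4) (z, t) :=
    ContDiff.contDiffAt (by fun_prop)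
  have h2 : ContDiffAt ℝ ∞ (fun x : ℂ × ℝ => 1 + (x.2 : ℂ) * x.1) (z, t) :=
    ContDiff.contDiffAt (by fun_prop)
  simp only [div_eq_mul_inv]
  exact h1.mul (h2.inv (Complex.slitPlane_ne_zero (one_add_mul_mem_slitPlane hz ht)))

theorem log_norm_one_add_eq {z : ℂ} (hz : ‖z‖ < 1) : Real.log ‖1 + z‖
    = (z - z ^ 2 / 2 + z ^ 3 / 3 - z ^ 4 / 4 + z ^ 5 * clogRem z).re := by
  have hne : ∀ t ∈ uIcc (0 : ℝ) 1, 1 + (t : ℂ) * z ≠ 0 := fun t ht =>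
    Complex.slitPlane_ne_zero (one_add_mul_mem_slitPlane hz (uIcc_of_le zero_le_one (α := ℝ) ▸ ht))
  have hof : ∀ t : ℝ, HasDerivAt (fun t : ℝ => (t : ℂ)) 1 t := fun t =>
    (hasDerivAt_id (t : ℂ)).comp_ofReal
  have hcont : ContinuousOn (fun t : ℝ => (t : ℂ) ^ 4 / (1 + (t : ℂ) * z)) (uIcc 0 1) :=
    ContinuousOn.div (by fun_prop) (by fun_prop) hne
  have key : z ^ 5 * clogRem z
      = Complex.log (1 + z) - (z - z ^ 2 / 2 + z ^ 3 / 3 - z ^ 4 / 4) := by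
    rw [clogRem, ← intervalIntegral.integral_const_mul,
      intervalIntegral.integral_eq_sub_of_hasDerivAt (f := fun t : ℝ => Complex.log (1 + (t : ℂ) * z)
        - ((t : ℂ) * z - (t : ℂ) ^ 2 * (z ^ 2 / 2) + (t : ℂ) ^ 3 * (z ^ 3 / 3)
          - (t : ℂ) ^ 4 * (z ^ 4 / 4)))]
    · simp
    · intro t ht
      have hs := one_add_mul_mem_slitPlane hz (uIcc_of_le zero_le_one (α := ℝ) ▸ ht)
      have h1 := (((hof t).mul_const z).const_add 1).clog_real hs
      have h2 := (((((hof t).mul_const z).fun_sub (((hof t).fun_pow 2).mul_const (z ^ 2 / 2))).fun_add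
        (((hof t).fun_pow 3).mul_const (z ^ 3 / 3))).fun_sub
        (((hof t).fun_pow 4).mul_const (z ^ 4 / 4)))
      refine (h1.fun_sub h2).congr_deriv ?_
      have := hne t ht
      rw [eq_comm, mul_div_assoc', div_eq_iff this, sub_mul, div_mul_cancel₀ _ this]
      push_cast
      ring
    · exact ((continuousOn_const.mul hcont)).intervalIntegrable
  rw [key, ← Complex.log_re]
  congr 1
  ring

/-- Subtracting e Re z removes the uniform velocity that one patch induces on another, so the
expansion starts with the strain term of order e². -/
theorem logKernel_eq {e : ℝ} {z : ℂ} (hz : ‖(e : ℂ) * z‖ < 1) : logKernel e z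
    = (-(e : ℂ) ^ 2 / 2 * z ^ 2 + (e : ℂ) ^ 3 / 3 * z ^ 3 - (e : ℂ) ^ 4 / 4 * z ^ 4
      + (e : ℂ) ^ 5 * (z ^ 5 * clogRem (e * z))).re := by
  have h : e * z.re = ((e : ℂ) * z).re := by simp
  rw [logKernel, log_norm_one_add_eq hz, h, ← Complex.sub_re]
  congr 1
  ring

theorem integral_re_mul_cis {k : ℤ} (hk : k ≠ 0) (z : ℂ) :
    ∫ η in (0)..(2 * Real.pi), (z * cis (k * η)).re = 0 := by
  have hk' : (k : ℂ) ≠ 0 := by exact_mod_cast hk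
  have c : Continuous fun η : ℝ => (z * cis (k * η)).re := by
    have := (contDiff_cis (n := 0)).continuous
    have := Complex.continuous_re
    fun_prop
  rw [intervalIntegral.integral_eq_sub_of_hasDerivAt
    (f := fun η => (z / (Complex.I * k) * cis (k * η)).re) (fun η _ => ?_)
    (c.intervalIntegrable _ _)]
  · rw [cis_int_mul_two_pi]
    simp [cis]
  · refine (hasDerivAt_re (hasDerivAt_re_mul_cis (z / (Complex.I * k)) k η)).congr_deriv ?_
    congr 1
    have := Complex.I_ne_zero
    push_cast
    field_simp

theorem re_mul_re (u v : ℂ) :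
    u.re * v.re = 1 / 2 * (u * v).re + 1 / 2 * (u * (starRingEnd ℂ) v).re := by
  simp; ring

theorem conj_cis (x : ℝ) : (starRingEnd ℂ) (cis x) = cis (-x) := by
  simp only [cis, ← Complex.exp_conj]; simp

theorem integral_re_mul_cis_mul_re_mul_cis {j k : ℤ} (h1 : j + k ≠ 0) (h2 : j - k ≠ 0) (z w : ℂ) :
    ∫ η in (0)..(2 * Real.pi), (z * cis (j * η)).re * (w * cis (k * η)).re = 0 := by
  have c : ∀ (z : ℂ) (k : ℤ), IntervalIntegrable (fun η : ℝ => (z * cis (k * η)).re) volume 0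
      (2 * Real.pi) := fun z k => by
    have := (contDiff_cis (n := 0)).continuous
    have := Complex.continuous_re
    exact Continuous.intervalIntegrable (by fun_prop) _ _
  have h : ∀ η : ℝ, (z * cis (j * η)).re * (w * cis (k * η)).re
      = 1 / 2 * (z * w * cis ((j + k : ℤ) * η)).re
        + 1 / 2 * (z * (starRingEnd ℂ) w * cis ((j - k : ℤ) * η)).re := fun η => by
    rw [re_mul_re, map_mul, conj_cis, show ((j + k : ℤ) : ℝ) * η = j * η + k * η by push_cast; ring,
      show ((j - k : ℤ) : ℝ) * η = j * η + -(k * η) by push_cast; ring, cis_add, cis_add]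
    congr 3 <;> ring
  simp only [h]
  rw [intervalIntegral.integral_add ((c _ _).const_mul _) ((c _ _).const_mul _),
    intervalIntegral.integral_const_mul, intervalIntegral.integral_const_mul,
    integral_re_mul_cis h1, integral_re_mul_cis h2]
  simp

/-- The profile contains no harmonic of order 0 or 1. The perturbation thus has zero mean and no
linear effect on the centroid. -/
theorem integral_re_mul_cis_mul_shape {k : ℤ} (hk : |k| ≤ 1) (z a b c : ℂ) :
    ∫ η in (0)..(2 * Real.pi), (z * cis (k * η)).re * shape a b c η = 0 := by
  obtain ⟨hk1, hk2⟩ := abs_le.1 hk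
  have cc : ∀ (w : ℂ) (n : ℤ), IntervalIntegrable
      (fun η : ℝ => (z * cis (k * η)).re * (w * cis (n * η)).re) volume 0
      (2 * Real.pi) := fun w n => by
    have := (contDiff_cis (n := 0)).continuous
    have := Complex.continuous_re
    exact Continuous.intervalIntegrable (by fun_prop) _ _
  have h2 := integral_re_mul_cis_mul_re_mul_cis (j := k) (k := 2) (by omega) (by omega) z a
  have h3 := integral_re_mul_cis_mul_re_mul_cis (j := k) (k := 3) (by omega) (by omega) z b
  have h4 := integral_re_mul_cis_mul_re_mul_cis (j := k) (k := 4) (by omega) (by omega) z c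
  have i2 := cc a 2
  have i3 := cc b 3
  have i4 := cc c 4
  push_cast at h2 h3 h4 i2 i3 i4
  simp only [shape, Complex.add_re, mul_add]
  rw [intervalIntegral.integral_add (i2.add i3) i4, intervalIntegral.integral_add i2 i3, h2, h3, h4]
  simp

/-- The result is sorted by powers of c, which later stands for e^{iση}. The terms with a positive
power of c, or linear in ρ, are exactly those that vanish under the η-integral. -/
theorem integral_re_radial_polynomial (U V W₃ W₄ z β c : ℂ) (d ρ : ℝ) :
    ∫ t in (0 : ℝ)..1, (U * t * (1 + 2 * d * ρ) + V * c * t ^ 2 * (1 + 3 * d * ρ)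
        + W₃ * t * (z + β * t * c) ^ 3 + W₄ * t * (z + β * t * c) ^ 4).re
      = (U / 2 + W₃ / 2 * z ^ 3 + W₄ / 2 * z ^ 4).re
        + (((V / 3 + W₃ * z ^ 2 * β + 4 / 3 * W₄ * z ^ 3 * β) * c).re
          + ((3 / 4 * W₃ * z * β ^ 2 + 6 / 4 * W₄ * z ^ 2 * β ^ 2) * c ^ 2).re
          + ((W₃ / 5 * β ^ 3 + 4 / 5 * W₄ * z * β ^ 3) * c ^ 3).re
          + (W₄ / 6 * β ^ 4 * c ^ 4).re)
        + ((d * U).re * ρ + (d * V * c).re * ρ) := by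
  have hof : ∀ t : ℝ, HasDerivAt (fun t : ℝ => (t : ℂ)) 1 t := fun t =>
    (hasDerivAt_id (t : ℂ)).comp_ofReal
  have hp : ∀ (n : ℕ) (w : ℂ) (t : ℝ), HasDerivAt (fun t : ℝ => (t : ℂ) ^ (n + 1) * w)
      ((n + 1) * (t : ℂ) ^ n * w) t := fun n w t =>
    (((hof t).fun_pow (n + 1)).mul_const w).congr_deriv (by push_cast; simp)
  rw [intervalIntegral.integral_eq_sub_of_hasDerivAt (f := fun t : ℝ =>
    ((t : ℂ) ^ (1 + 1) * (U / 2 * (1 + 2 * d * ρ) + W₃ / 2 * z ^ 3 + W₄ / 2 * z ^ 4)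
      + (t : ℂ) ^ (2 + 1) * ((V / 3 * (1 + 3 * d * ρ) + W₃ * z ^ 2 * β + 4 / 3 * W₄ * z ^ 3 * β) * c)
      + (t : ℂ) ^ (3 + 1) * ((3 / 4 * W₃ * z * β ^ 2 + 6 / 4 * W₄ * z ^ 2 * β ^ 2) * c ^ 2)
      + (t : ℂ) ^ (4 + 1) * ((W₃ / 5 * β ^ 3 + 4 / 5 * W₄ * z * β ^ 3) * c ^ 3)
      + (t : ℂ) ^ (5 + 1) * (W₄ / 6 * β ^ 4 * c ^ 4)).re)]
  · have h1 : (d * U).re * ρ = (d * U * ρ).re := by simp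
    have h2 : (d * V * c).re * ρ = (d * V * c * ρ).re := (Complex.re_mul_ofReal _ _).symm
    rw [h1, h2]
    simp only [← Complex.add_re, ← Complex.sub_re]
    congr 1
    push_cast
    ring
  · intro t _
    refine (hasDerivAt_re (((((hp 1 _ t).fun_add (hp 2 _ t)).fun_add (hp 3 _ t)).fun_add
      (hp 4 _ t)).fun_add (hp 5 _ t))).congr_deriv ?_
    congr 1
    push_cast
    ring
  · have := Complex.continuous_re
    exact Continuous.intervalIntegrable (by fun_prop) _ _

/-- Only the part free of e^{iση} survives. To this order a distant perturbed disc acts like a point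
vortex at its centre. -/
theorem integral_re_angular_polynomial {σ : ℤ} (hσ : |σ| = 1) (U V W₃ W₄ z β a b c : ℂ) (d : ℝ) :
    ∫ η in (0)..(2 * Real.pi), ∫ t in (0 : ℝ)..1, (U * t * (1 + 2 * d * shape a b c η)
        + V * cis (σ * η) * t ^ 2 * (1 + 3 * d * shape a b c η)
        + W₃ * t * (z + β * t * cis (σ * η)) ^ 3 + W₄ * t * (z + β * t * cis (σ * η)) ^ 4).re
      = 2 * Real.pi * (U / 2 + W₃ / 2 * z ^ 3 + W₄ / 2 * z ^ 4).re := by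
  have hσ0 : σ ≠ 0 := by rintro rfl; simp at hσ
  have hpow : ∀ (n : ℕ) (η : ℝ), cis (σ * η) ^ n = cis ((n * σ : ℤ) * η) := fun n η => by
    simp only [cis, ← Complex.exp_nat_mul]
    congr 1; push_cast; ring
  have hI : ∀ (w : ℂ) (n : ℕ), n ≠ 0 →
      ∫ η in (0)..(2 * Real.pi), (w * cis (σ * η) ^ n).re = 0 := fun w n hn => by
    simp only [hpow]
    exact integral_re_mul_cis (mul_ne_zero (by exact_mod_cast hn) hσ0) w
  have hI1 := fun w => hI w 1 one_ne_zero
  simp only [pow_one] at hI1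
  have hS := fun w => integral_re_mul_cis_mul_shape hσ.le w a b c
  have h0 : ∫ η in (0)..(2 * Real.pi), (d * U).re * shape a b c η = 0 := by
    have := integral_re_mul_cis_mul_shape (k := 0) (by simp) (d * U) a b c
    simpa [cis] using this
  have := (contDiff_cis (n := 0)).continuous
  have := Complex.continuous_re
  have := continuous_shape a b c
  have ii : ∀ {f : ℝ → ℝ}, Continuous f → IntervalIntegrable f volume 0 (2 * Real.pi) :=
    fun h => h.intervalIntegrable _ _
  simp only [integral_re_radial_polynomial]
  rw [intervalIntegral.integral_add (ii (by fun_prop)) (ii (by fun_prop)),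
    intervalIntegral.integral_add (ii (by fun_prop)) (ii (by fun_prop)),
    intervalIntegral.integral_add (ii (by fun_prop)) (ii (by fun_prop)),
    intervalIntegral.integral_add (ii (by fun_prop)) (ii (by fun_prop)),
    intervalIntegral.integral_add (ii (by fun_prop)) (ii (by fun_prop)),
    intervalIntegral.integral_add (ii (by fun_prop)) (ii (by fun_prop)),
    hI1, hI _ 2 (by simp), hI _ 3 (by simp), hI _ 4 (by simp), hS, h0]
  simp
  ring

/-- Second order expansion of `√(1 + 2x)` in `x = d a`. -/
theorem exists_sqrt_expansion {X : Type} [NormedAddCommGroup X] [NormedSpace ℝ X]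
    {d a : X → ℝ} (sd : ContDiff ℝ ∞ d) (sa : ContDiff ℝ ∞ a) (h : ∀ x, |d x * a x| ≤ 1 / 16) :
    ∃ S T : X → ℝ, ContDiff ℝ ∞ S ∧ ContDiff ℝ ∞ T ∧
      (∀ x, √(1 + 2 * d x * a x) = 1 + d x * S x) ∧ ∀ x, S x = a x + d x * T x := by
  have pa : ∀ x, 0 < 1 + 2 * d x * a x := fun x => by linarith [(abs_le.1 (h x)).1]
  obtain ⟨A, hA⟩ : ∃ f : X → ℝ, ∀ x, f x = √(1 + 2 * d x * a x) := ⟨_, fun _ => rfl⟩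
  have sA : ContDiff ℝ ∞ A := by
    rw [funext hA]; exact ContDiff.sqrt (by fun_prop) fun x => (pa x).ne'
  have A0 : ∀ x, 0 < A x := fun x => by rw [hA]; exact Real.sqrt_pos.2 (pa x)
  have A2 : ∀ x, A x ^ 2 = 1 + 2 * d x * a x := fun x => by rw [hA]; exact Real.sq_sqrt (pa x).le
  have hne : ∀ x, 1 + A x ≠ 0 := fun x => by linarith [A0 x]
  refine ⟨fun x => 2 * a x / (1 + A x), fun x => -(2 * a x ^ 2) / (1 + A x) ^ 2,
    ContDiff.div (by fun_prop) (by fun_prop) hne,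
    ContDiff.div (by fun_prop) (by fun_prop) fun x => pow_ne_zero 2 (hne x), fun x => ?_,
    fun x => ?_⟩
  · rw [← hA]
    have := hne x
    field_simp
    linear_combination A2 x
  · have := hne x
    field_simp
    linear_combination -(a x) * A2 x

theorem polarIntegral_eq_integral_unit (ρ : ℝ → ℝ) (f : ℝ → ℝ → ℝ) : polarIntegral ρ f
    = 1 / (2 * Real.pi) * ∫ η in (0)..(2 * Real.pi), ∫ t in (0 : ℝ)..1,
        f (ρ η * t) η * (ρ η ^ 2 * t) := by
  unfold polarIntegral
  congr 2
  ext η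
  have h := intervalIntegral.mul_integral_comp_mul_left (a := 0) (b := 1)
    (f := fun l => f l η * l) (ρ η)
  rw [mul_zero, mul_one] at h
  rw [← h, ← intervalIntegral.integral_const_mul]
  congr 1
  ext t
  ring

/-- The algebra behind `exists_interaction_expansion`: the integrand is a polynomial with explicit
angular structure, up to terms of fifth order in `e`. -/
theorem interaction_integrand_eq {e t r' S S' T' : ℝ} {α β ζ c : ℂ} (hS' : S' = r' + e ^ 2 * T')
    (hR' : (1 + e ^ 2 * S') ^ 2 = 1 + 2 * e ^ 2 * r') (L : ℂ) :
    (-(e : ℂ) ^ 2 / 2 * (α * (1 + e ^ 2 * S) * ζ + β * ((1 + e ^ 2 * S') * t) * c) ^ 2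
      + (e : ℂ) ^ 3 / 3 * (α * (1 + e ^ 2 * S) * ζ + β * ((1 + e ^ 2 * S') * t) * c) ^ 3
      - (e : ℂ) ^ 4 / 4 * (α * (1 + e ^ 2 * S) * ζ + β * ((1 + e ^ 2 * S') * t) * c) ^ 4
      + (e : ℂ) ^ 5 * L) * ((1 + e ^ 2 * S') ^ 2 * t)
    = (-(e : ℂ) ^ 2 / 2 * (α * (1 + e ^ 2 * S) * ζ) ^ 2 * t * (1 + 2 * (e ^ 2) * r')
        + -(e : ℂ) ^ 2 * (α * (1 + e ^ 2 * S) * ζ) * β * c * t ^ 2 * (1 + 3 * (e ^ 2) * r')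
        + (e : ℂ) ^ 3 / 3 * t * (α * ζ + β * t * c) ^ 3
        + -(e : ℂ) ^ 4 / 4 * t * (α * ζ + β * t * c) ^ 4)
      + -(e : ℂ) ^ 2 / 2 * β ^ 2 * c ^ 2 * (1 + 2 * e ^ 2 * r') ^ 2 * t ^ 3
      + (e : ℂ) ^ 5 * (-e * α * (1 + e ^ 2 * S) * ζ * β * c * t ^ 2
            * (3 * T' + 3 * S' ^ 2 + e ^ 2 * S' ^ 3)
          + t / 3 * ((α * S * ζ + β * S' * t * c)
            * ((α * (1 + e ^ 2 * S) * ζ + β * ((1 + e ^ 2 * S') * t) * c) ^ 2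
              + (α * (1 + e ^ 2 * S) * ζ + β * ((1 + e ^ 2 * S') * t) * c) * (α * ζ + β * t * c)
              + (α * ζ + β * t * c) ^ 2)
            + 2 * r' * (α * (1 + e ^ 2 * S) * ζ + β * ((1 + e ^ 2 * S') * t) * c) ^ 3)
          - e * t / 4 * ((α * S * ζ + β * S' * t * c)
            * ((α * (1 + e ^ 2 * S) * ζ + β * ((1 + e ^ 2 * S') * t) * c) ^ 3
              + (α * (1 + e ^ 2 * S) * ζ + β * ((1 + e ^ 2 * S') * t) * c) ^ 2 * (α * ζ + β * t * c)
              + (α * (1 + e ^ 2 * S) * ζ + β * ((1 + e ^ 2 * S') * t) * c) * (α * ζ + β * t * c) ^ 2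
              + (α * ζ + β * t * c) ^ 3)
            + 2 * r' * (α * (1 + e ^ 2 * S) * ζ + β * ((1 + e ^ 2 * S') * t) * c) ^ 4)
          + L * (1 + 2 * e ^ 2 * r') * t) := by
  have hR : (1 + (e : ℂ) ^ 2 * S') ^ 2 = 1 + 2 * (e : ℂ) ^ 2 * r' := by exact_mod_cast hR'
  have hT : (S' : ℂ) = r' + (e : ℂ) ^ 2 * T' := by exact_mod_cast hS'
  -- The radii differ from 1 by O(e²), so z = z₀ + e²y. The cubic and quartic terms may use z₀ at
  -- the cost of O(e⁵). In the quadratic term the R² factors are kept exact and R'³ is expanded to 1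
  -- + 3e²r'.
  obtain ⟨z, hz⟩ : ∃ z, z = α * (1 + e ^ 2 * S) * ζ + β * ((1 + e ^ 2 * S') * t) * c := ⟨_, rfl⟩
  obtain ⟨z₀, hz₀⟩ : ∃ z₀, z₀ = α * ζ + β * t * c := ⟨_, rfl⟩
  obtain ⟨y, hy⟩ : ∃ y, y = α * S * ζ + β * S' * t * c := ⟨_, rfl⟩
  have hzy : z = z₀ + e ^ 2 * y := by rw [hz, hz₀, hy]; ring
  have h3 : t * (z ^ 3 * (1 + 2 * e ^ 2 * r')) = t * z₀ ^ 3
      + e ^ 2 * (t * (y * (z ^ 2 + z * z₀ + z₀ ^ 2) + 2 * r' * z ^ 3)) := by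
    rw [hzy]; ring
  have h4 : t * (z ^ 4 * (1 + 2 * e ^ 2 * r')) = t * z₀ ^ 4
      + e ^ 2 * (t * (y * (z ^ 3 + z ^ 2 * z₀ + z * z₀ ^ 2 + z₀ ^ 3) + 2 * r' * z ^ 4)) := by
    rw [hzy]; ring
  have hR3 : (1 + (e : ℂ) ^ 2 * S') * (1 + 2 * (e : ℂ) ^ 2 * r') = 1 + 3 * e ^ 2 * r'
      + e ^ 4 * (3 * T' + 3 * S' ^ 2 + e ^ 2 * S' ^ 3) := by
    rw [← hR, hT]; ring
  have h2 : z ^ 2 * (1 + 2 * e ^ 2 * r') = (α * (1 + e ^ 2 * S) * ζ) ^ 2 * (1 + 2 * e ^ 2 * r')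
      + 2 * (α * (1 + e ^ 2 * S) * ζ) * β * c * t * (1 + 3 * e ^ 2 * r'
        + e ^ 4 * (3 * T' + 3 * S' ^ 2 + e ^ 2 * S' ^ 3))
      + β ^ 2 * c ^ 2 * t ^ 2 * (1 + 2 * e ^ 2 * r') ^ 2 := by
    rw [← hR3, hz]
    linear_combination (β ^ 2 * c ^ 2 * t ^ 2 * (1 + 2 * e ^ 2 * r')) * hR
  rw [← hz, ← hz₀, ← hy, hR]
  linear_combination (-(e : ℂ) ^ 2 / 2 * t) * h2 + (e : ℂ) ^ 3 / 3 * h3 - (e : ℂ) ^ 4 / 4 * h4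

theorem sqrt_one_add_le {x : ℝ} (hx : |x| ≤ 1 / 16) : √(1 + 2 * x) ≤ 3 / 2 :=
  Real.sqrt_le_iff.2 ⟨by norm_num, by linarith [(abs_le.1 hx).2]⟩

/-- The logarithmic potential of a distant perturbed disc, evaluated on the boundary of another
perturbed disc; `e` is the ratio of scales. -/
theorem exists_interaction_expansion {E : Type} [NormedAddCommGroup E] [NormedSpace ℝ E]
    {e : E → ℝ} {α β a b c a' b' c' : E → ℂ} (se : ContDiff ℝ ∞ e) (sα : ContDiff ℝ ∞ α)
    (sβ : ContDiff ℝ ∞ β) (sa : ContDiff ℝ ∞ a) (sb : ContDiff ℝ ∞ b) (sc : ContDiff ℝ ∞ c)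
    (sa' : ContDiff ℝ ∞ a') (sb' : ContDiff ℝ ∞ b') (sc' : ContDiff ℝ ∞ c')
    {σ : ℤ} (hσ : |σ| = 1) (h1 : ∀ p, e p ^ 2 * (‖a p‖ + ‖b p‖ + ‖c p‖) ≤ 1 / 16)
    (h2 : ∀ p, e p ^ 2 * (‖a' p‖ + ‖b' p‖ + ‖c' p‖) ≤ 1 / 16)
    (h3 : ∀ p, |e p| * (‖α p‖ + ‖β p‖) ≤ 1 / 4) :
    ∃ (K : E → ℝ) (H : E × ℝ → ℝ), ContDiff ℝ ∞ H ∧ ∀ p θ,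
      polarIntegral (fun η => √(1 + 2 * e p ^ 2 * shape (a' p) (b' p) (c' p) η)) (fun l η =>
        logKernel (e p) (α p * ((√(1 + 2 * e p ^ 2 * shape (a p) (b p) (c p) θ) : ℝ) : ℂ) * cis θ
          + β p * (l : ℂ) * cis (σ * η)))
      = K p + (-(e p : ℂ) ^ 2 / 4 * α p ^ 2 * (1 + 2 * (e p) ^ 2 * shape (a p) (b p) (c p) θ)
          * cis (2 * θ) + (e p : ℂ) ^ 3 / 6 * α p ^ 3 * cis (3 * θ)
          - (e p : ℂ) ^ 4 / 8 * α p ^ 4 * cis (4 * θ)).re + e p ^ 5 * H (p, θ) := by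
  have hsm : ∀ {a b c : E → ℂ}, (∀ p, e p ^ 2 * (‖a p‖ + ‖b p‖ + ‖c p‖) ≤ 1 / 16) →
      ∀ p θ, |e p ^ 2 * shape (a p) (b p) (c p) θ| ≤ 1 / 16 := fun h p θ => by
    rw [abs_mul, abs_of_nonneg (sq_nonneg _)]
    exact (mul_le_mul_of_nonneg_left (abs_shape_le _ _ _ _) (sq_nonneg _)).trans (h p)
  obtain ⟨S, T, sS, -, hS, -⟩ := exists_sqrt_expansion (X := (E × ℝ) × ℝ)
    (d := fun y => e y.1.1 ^ 2) (a := fun y => shape (a y.1.1) (b y.1.1) (c y.1.1) y.1.2)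
    (by fun_prop) (contDiff_shape (by fun_prop) (by fun_prop) (by fun_prop) (by fun_prop))
    fun y => hsm h1 _ _
  obtain ⟨S', T', sS', sT', hR', hS'⟩ := exists_sqrt_expansion (X := (E × ℝ) × ℝ)
    (d := fun y => e y.1.1 ^ 2) (a := fun y => shape (a' y.1.1) (b' y.1.1) (c' y.1.1) y.2)
    (by fun_prop) (contDiff_shape (by fun_prop) (by fun_prop) (by fun_prop) (by fun_prop))
    fun y => hsm h2 _ _
  obtain ⟨r', hr'⟩ : ∃ r' : (E × ℝ) × ℝ → ℝ,
      ∀ y, r' y = shape (a' y.1.1) (b' y.1.1) (c' y.1.1) y.2 := ⟨_, fun _ => rfl⟩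
  have sr' : ContDiff ℝ ∞ r' := by
    rw [funext hr']
    exact contDiff_shape (by fun_prop) (by fun_prop) (by fun_prop) (by fun_prop)
  obtain ⟨z, hz⟩ : ∃ z : ((E × ℝ) × ℝ) × ℝ → ℂ, ∀ x, z x
      = α x.1.1.1 * (1 + e x.1.1.1 ^ 2 * S x.1) * cis x.1.1.2
        + β x.1.1.1 * ((1 + e x.1.1.1 ^ 2 * S' x.1) * x.2) * cis (σ * x.1.2) := ⟨_, fun _ => rfl⟩
  have sz : ContDiff ℝ ∞ z := by rw [funext hz]; fun_prop
  obtain ⟨z₀, hz₀⟩ : ∃ z : ((E × ℝ) × ℝ) × ℝ → ℂ, ∀ x, z x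
      = α x.1.1.1 * cis x.1.1.2 + β x.1.1.1 * x.2 * cis (σ * x.1.2) := ⟨_, fun _ => rfl⟩
  have sz₀ : ContDiff ℝ ∞ z₀ := by rw [funext hz₀]; fun_prop
  obtain ⟨w, hw⟩ : ∃ z : ((E × ℝ) × ℝ) × ℝ → ℂ, ∀ x, z x
      = α x.1.1.1 * S x.1 * cis x.1.1.2 + β x.1.1.1 * S' x.1 * x.2 * cis (σ * x.1.2) :=
    ⟨_, fun _ => rfl⟩
  have sw : ContDiff ℝ ∞ w := by rw [funext hw]; fun_prop
  -- Both radii are at most 3/2, so |e z| ≤ (3/2)(1/4) < 1 and the logarithm stays in its disc of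
  -- expansion.
  have hzlt : ∀ x, x.2 ∈ Icc (0 : ℝ) 1 → ‖(e x.1.1.1 : ℂ) * z x‖ < 1 := fun x hx => by
    have n1 : ‖(1 : ℂ) + e x.1.1.1 ^ 2 * S x.1‖ ≤ 3 / 2 := by
      have : (1 : ℂ) + e x.1.1.1 ^ 2 * S x.1 = ((1 + e x.1.1.1 ^ 2 * S x.1 : ℝ) : ℂ) := by
        push_cast; rfl
      rw [this, ← hS, Complex.norm_real, Real.norm_of_nonneg (Real.sqrt_nonneg _), mul_assoc]
      exact sqrt_one_add_le (hsm h1 _ _)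
    have n2 : ‖(1 : ℂ) + e x.1.1.1 ^ 2 * S' x.1‖ ≤ 3 / 2 := by
      have : (1 : ℂ) + e x.1.1.1 ^ 2 * S' x.1 = ((1 + e x.1.1.1 ^ 2 * S' x.1 : ℝ) : ℂ) := by
        push_cast; rfl
      rw [this, ← hR', Complex.norm_real, Real.norm_of_nonneg (Real.sqrt_nonneg _), mul_assoc]
      exact sqrt_one_add_le (hsm h2 _ _)
    have n3 : ‖(x.2 : ℂ)‖ ≤ 1 := by
      rw [Complex.norm_real, Real.norm_of_nonneg hx.1]; exact hx.2
    have n4 : ‖z x‖ ≤ ‖α x.1.1.1‖ * (3 / 2) + ‖β x.1.1.1‖ * (3 / 2 * 1) := by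
      rw [hz]
      refine (norm_add_le _ _).trans (add_le_add ?_ ?_)
      · rw [norm_mul, norm_mul, norm_cis, mul_one]; gcongr
      · rw [norm_mul, norm_mul, norm_mul, norm_cis, mul_one]; gcongr
    rw [norm_mul, Complex.norm_real, Real.norm_eq_abs]
    have := mul_le_mul_of_nonneg_left n4 (abs_nonneg (e x.1.1.1))
    linarith [h3 x.1.1.1]
  -- The real part of the factor of e⁵ in `interaction_integrand_eq`.
  obtain ⟨h, hh⟩ : ∃ h : (E × ℝ) × ℝ → ℝ → ℝ, ∀ y t, h y t
      = (-e y.1.1 * α y.1.1 * (1 + e y.1.1 ^ 2 * S y) * cis y.1.2 * β y.1.1 * cis (σ * y.2) * t ^ 2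
            * (3 * T' y + 3 * S' y ^ 2 + e y.1.1 ^ 2 * S' y ^ 3)
          + t / 3 * (w (y, t) * (z (y, t) ^ 2 + z (y, t) * z₀ (y, t) + z₀ (y, t) ^ 2)
            + 2 * r' y * z (y, t) ^ 3)
          - e y.1.1 * t / 4 * (w (y, t) * (z (y, t) ^ 3 + z (y, t) ^ 2 * z₀ (y, t)
              + z (y, t) * z₀ (y, t) ^ 2 + z₀ (y, t) ^ 3) + 2 * r' y * z (y, t) ^ 4)
          + z (y, t) ^ 5 * clogRem (e y.1.1 * z (y, t)) * (1 + 2 * e y.1.1 ^ 2 * r' y) * t).re :=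
    ⟨_, fun _ _ => rfl⟩
  -- Smoothness is claimed only for t in [0, 1], since the logarithmic remainder is controlled only
  -- where |e z| < 1.
  have sh : ∀ y, ∀ t ∈ uIcc (0 : ℝ) 1, ContDiffAt ℝ ∞ (Function.uncurry h) (y, t) := by
    intro y t ht
    rw [uIcc_of_le zero_le_one] at ht
    have hun : Function.uncurry h = fun x => h x.1 x.2 := rfl
    rw [hun]
    simp only [hh]
    have hl : ContDiffAt ℝ ∞ (fun x : ((E × ℝ) × ℝ) × ℝ => clogRem (e x.1.1.1 * z (x.1, x.2)))
        (y, t) := by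
      refine ContDiffAt.comp (y, t) (contDiffAt_clogRem (hzlt (y, t) ht)) ?_
      exact ContDiff.contDiffAt (by fun_prop)
    refine contDiff_re.contDiffAt.comp (y, t) (ContDiffAt.add ?_ (ContDiffAt.mul (ContDiffAt.mul
      (ContDiffAt.mul ?_ hl) ?_) ?_))
    · have : ContDiff ℝ ∞ fun x : ((E × ℝ) × ℝ) × ℝ => (x.2 : ℂ) / 3 := by
        simp only [div_eq_mul_inv]; fun_prop
      have : ContDiff ℝ ∞ fun x : ((E × ℝ) × ℝ) × ℝ => (e x.1.1.1 : ℂ) * x.2 / 4 := by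
        simp only [div_eq_mul_inv]; fun_prop
      exact ContDiff.contDiffAt (by fun_prop)
    all_goals exact ContDiff.contDiffAt (by fun_prop)
  have sI : ContDiff ℝ ∞ fun y => ∫ t in (0 : ℝ)..1, h y t :=
    contDiff_iff_contDiffAt.2 fun y => contDiffAt_intervalIntegral (sh y)
  have sIc : ContDiff ℝ ∞ fun x => ∫ η in (0)..(2 * Real.pi), ∫ t in (0 : ℝ)..1, h (x, η) t :=
    contDiff_intervalIntegral (f := fun x η => ∫ t in (0 : ℝ)..1, h (x, η) t) sI
  -- The quadratic term in the source variable alone is independent of θ and forms K.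
  refine ⟨fun p => 1 / (2 * Real.pi) * ∫ η in (0)..(2 * Real.pi), ∫ t in (0 : ℝ)..1,
      (-(e p : ℂ) ^ 2 / 2 * β p ^ 2 * cis (σ * η) ^ 2
        * (1 + 2 * e p ^ 2 * shape (a' p) (b' p) (c' p) η) ^ 2 * t ^ 3).re,
    fun x => 1 / (2 * Real.pi) * ∫ η in (0)..(2 * Real.pi), ∫ t in (0 : ℝ)..1, h (x, η) t,
    contDiff_const.mul sIc, fun p θ => ?_⟩
  have hR2 : ∀ η, (1 + e p ^ 2 * S' ((p, θ), η)) ^ 2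
      = 1 + 2 * e p ^ 2 * shape (a' p) (b' p) (c' p) η := fun η => by
    rw [← hR' ((p, θ), η)]
    exact Real.sq_sqrt (by linarith [(abs_le.1 (hsm h2 p η)).1])
  have hRθ : ∀ η, (1 + e p ^ 2 * S ((p, θ), η)) = √(1 + 2 * e p ^ 2 * shape (a p) (b p) (c p) θ) :=
    fun η => (hS ((p, θ), η)).symm
  have hρ : ∀ η, √(1 + 2 * e p ^ 2 * shape (a' p) (b' p) (c' p) η) = 1 + e p ^ 2 * S' ((p, θ), η) :=
    fun η => hR' ((p, θ), η)
  have key : ∀ η, ∀ t ∈ uIcc (0 : ℝ) 1, logKernel (e p)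
      (α p * ((√(1 + 2 * e p ^ 2 * shape (a p) (b p) (c p) θ) : ℝ) : ℂ) * cis θ
        + β p * ((√(1 + 2 * e p ^ 2 * shape (a' p) (b' p) (c' p) η) * t : ℝ) : ℂ) * cis (σ * η))
        * (√(1 + 2 * e p ^ 2 * shape (a' p) (b' p) (c' p) η) ^ 2 * t)
      = (-(e p : ℂ) ^ 2 / 2 * (α p * ((√(1 + 2 * e p ^ 2 * shape (a p) (b p) (c p) θ) : ℝ) : ℂ)
            * cis θ) ^ 2 * t * (1 + 2 * ((e p ^ 2 : ℝ) : ℂ) * shape (a' p) (b' p) (c' p) η)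
          + -(e p : ℂ) ^ 2 * (α p * ((√(1 + 2 * e p ^ 2 * shape (a p) (b p) (c p) θ) : ℝ) : ℂ)
            * cis θ) * β p * cis (σ * η) * t ^ 2
              * (1 + 3 * ((e p ^ 2 : ℝ) : ℂ) * shape (a' p) (b' p) (c' p) η)
          + (e p : ℂ) ^ 3 / 3 * t * (α p * cis θ + β p * t * cis (σ * η)) ^ 3
          + -(e p : ℂ) ^ 4 / 4 * t * (α p * cis θ + β p * t * cis (σ * η)) ^ 4).re
        + (-(e p : ℂ) ^ 2 / 2 * β p ^ 2 * cis (σ * η) ^ 2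
          * (1 + 2 * e p ^ 2 * shape (a' p) (b' p) (c' p) η) ^ 2 * t ^ 3).re
        + e p ^ 5 * h ((p, θ), η) t := by
    intro η t ht
    rw [uIcc_of_le zero_le_one] at ht
    have hz' := hz (((p, θ), η), t)
    have hlt := hzlt (((p, θ), η), t) ht
    dsimp only at hz' hlt
    rw [hρ, ← hRθ η]
    push_cast
    rw [← hz', logKernel_eq hlt, ← Complex.re_mul_ofReal, hh]
    have e5 : ∀ Z : ℂ, e p ^ 5 * Z.re = ((e p : ℂ) ^ 5 * Z).re := fun Z => by
      rw [← Complex.re_ofReal_mul]; push_cast; rfl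
    rw [e5, ← Complex.add_re, ← Complex.add_re]
    congr 1
    have main := interaction_integrand_eq (e := e p) (t := t) (S := S ((p, θ), η)) (α := α p)
      (β := β p) (ζ := cis θ) (c := cis (σ * η)) (hS' ((p, θ), η)) (hR2 η)
      (z (((p, θ), η), t) ^ 5 * clogRem (e p * z (((p, θ), η), t)))
    rw [← hz'] at main
    dsimp only
    rw [hw, hz₀, hr']
    push_cast
    exact main
  rw [polarIntegral_eq_integral_unit]
  have c1 := (contDiff_cis (n := 0)).continuous
  have c2 := Complex.continuous_re
  have c3 := continuous_shape (a' p) (b' p) (c' p)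
  have ii : ∀ {f : ℝ → ℝ} {a b : ℝ}, Continuous f → IntervalIntegrable f volume a b :=
    fun h => h.intervalIntegrable _ _
  have ch : ∀ η, IntervalIntegrable (fun t => h ((p, θ), η) t) volume 0 1 := fun η =>
    ContinuousOn.intervalIntegrable fun t ht =>
      ((sh ((p, θ), η) t ht).continuousAt.comp (f := fun t : ℝ => (((p, θ), η), t))
        (by fun_prop)).continuousWithinAt
  have cI : Continuous fun η => ∫ t in (0 : ℝ)..1, h ((p, θ), η) t :=
    sI.continuous.comp (by fun_prop)
  have hin : ∀ η, _ := fun η => intervalIntegral.integral_congr (μ := volume) (key η)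
  simp only [hin]
  have hsplit : ∀ η, ∫ t in (0 : ℝ)..1, ((-(e p : ℂ) ^ 2 / 2
            * (α p * ((√(1 + 2 * e p ^ 2 * shape (a p) (b p) (c p) θ) : ℝ) : ℂ)
            * cis θ) ^ 2 * t * (1 + 2 * ((e p ^ 2 : ℝ) : ℂ) * shape (a' p) (b' p) (c' p) η)
          + -(e p : ℂ) ^ 2 * (α p * ((√(1 + 2 * e p ^ 2 * shape (a p) (b p) (c p) θ) : ℝ) : ℂ)
            * cis θ) * β p * cis (σ * η) * t ^ 2
              * (1 + 3 * ((e p ^ 2 : ℝ) : ℂ) * shape (a' p) (b' p) (c' p) η)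
          + (e p : ℂ) ^ 3 / 3 * t * (α p * cis θ + β p * t * cis (σ * η)) ^ 3
          + -(e p : ℂ) ^ 4 / 4 * t * (α p * cis θ + β p * t * cis (σ * η)) ^ 4).re
        + (-(e p : ℂ) ^ 2 / 2 * β p ^ 2 * cis (σ * η) ^ 2
          * (1 + 2 * e p ^ 2 * shape (a' p) (b' p) (c' p) η) ^ 2 * t ^ 3).re
        + e p ^ 5 * h ((p, θ), η) t)
      = (∫ t in (0 : ℝ)..1, (-(e p : ℂ) ^ 2 / 2
            * (α p * ((√(1 + 2 * e p ^ 2 * shape (a p) (b p) (c p) θ) : ℝ) : ℂ)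
            * cis θ) ^ 2 * t * (1 + 2 * ((e p ^ 2 : ℝ) : ℂ) * shape (a' p) (b' p) (c' p) η)
          + -(e p : ℂ) ^ 2 * (α p * ((√(1 + 2 * e p ^ 2 * shape (a p) (b p) (c p) θ) : ℝ) : ℂ)
            * cis θ) * β p * cis (σ * η) * t ^ 2
              * (1 + 3 * ((e p ^ 2 : ℝ) : ℂ) * shape (a' p) (b' p) (c' p) η)
          + (e p : ℂ) ^ 3 / 3 * t * (α p * cis θ + β p * t * cis (σ * η)) ^ 3
          + -(e p : ℂ) ^ 4 / 4 * t * (α p * cis θ + β p * t * cis (σ * η)) ^ 4).re)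
        + (∫ t in (0 : ℝ)..1, (-(e p : ℂ) ^ 2 / 2 * β p ^ 2 * cis (σ * η) ^ 2
          * (1 + 2 * e p ^ 2 * shape (a' p) (b' p) (c' p) η) ^ 2 * t ^ 3).re)
        + e p ^ 5 * ∫ t in (0 : ℝ)..1, h ((p, θ), η) t := fun η => by
    rw [intervalIntegral.integral_add (ii (by fun_prop)) ((ch η).const_mul _),
      intervalIntegral.integral_add (ii (by fun_prop)) (ii (by fun_prop)),
      intervalIntegral.integral_const_mul]
  have cp : ∀ {f : ℝ → ℝ → ℝ}, Continuous (Function.uncurry f) →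
      Continuous fun η => ∫ t in (0 : ℝ)..1, f η t := fun hf =>
    intervalIntegral.continuous_parametric_intervalIntegral_of_continuous' hf _ _
  simp only [hsplit]
  rw [intervalIntegral.integral_add ((ii (cp (by fun_prop))).add (ii (cp (by fun_prop))))
      ((ii cI).const_mul _),
    intervalIntegral.integral_add (ii (cp (by fun_prop))) (ii (cp (by fun_prop))),
    intervalIntegral.integral_const_mul, integral_re_angular_polynomial hσ]
  have hsq : ((√(1 + 2 * e p ^ 2 * shape (a p) (b p) (c p) θ) : ℝ) : ℂ) ^ 2
      = 1 + 2 * (e p) ^ 2 * shape (a p) (b p) (c p) θ := by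
    rw [← Complex.ofReal_pow, Real.sq_sqrt (by linarith [(abs_le.1 (hsm h1 p θ)).1])]
    push_cast; rfl
  have hcis : ∀ n : ℕ, cis (n * θ) = cis θ ^ n := fun n => by
    simp only [cis, ← Complex.exp_nat_mul]
    congr 1; push_cast; ring
  have k2 := hcis 2
  have k3 := hcis 3
  have k4 := hcis 4
  push_cast at k2 k3 k4
  rw [k2, k3, k4, ← hsq]
  have hfin : ∀ {x x' k h5 : ℝ}, x = x' → 1 / (2 * Real.pi) * (2 * Real.pi * x + k + e p ^ 5 * h5)
      = 1 / (2 * Real.pi) * k + x' + e p ^ 5 * (1 / (2 * Real.pi) * h5) := by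
    rintro x _ k h5 rfl
    have := Real.pi_pos.ne'
    field_simp
    ring
  apply hfin
  congr 1
  ring

/-! ### The sum of the stream functions for the corrected profile -/

/-- The potential of a perturbed disc at its own boundary. -/
noncomputable def selfPotential (d : ℝ) (a b c : ℂ) (θ : ℝ) : ℝ :=
  polarIntegral (fun η => √(1 + 2 * d * shape a b c η)) (fun l η =>
    Real.log ‖((√(1 + 2 * d * shape a b c θ) : ℝ) : ℂ) * cis θ - (l : ℂ) * cis η‖)

/-- The renormalised potential of a distant perturbed disc with coefficients `a'`, `b'`, `c'` at
the boundary of the disc with coefficients `a`, `b`, `c`. -/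
noncomputable def pairPotential (e : ℝ) (α β : ℂ) (σ : ℤ) (a b c a' b' c' : ℂ) (θ : ℝ) : ℝ :=
  polarIntegral (fun η => √(1 + 2 * e ^ 2 * shape a' b' c' η)) (fun l η =>
    logKernel e (α * ((√(1 + 2 * e ^ 2 * shape a b c θ) : ℝ) : ℂ) * cis θ
      + β * (l : ℂ) * cis (σ * η)))

/-- The expansion is an exact identity with a right-hand side smooth in θ, so it also gives
differentiability despite the singular kernel. The same holds for the pair potential. -/
theorem differentiable_selfPotential {E : Type} [NormedAddCommGroup E] [NormedSpace ℝ E] {δ : E → ℝ}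
    {a b c : E → ℂ} (sδ : ContDiff ℝ ∞ δ) (sa : ContDiff ℝ ∞ a) (sb : ContDiff ℝ ∞ b)
    (sc : ContDiff ℝ ∞ c) (hsmall : ∀ p, |δ p| * (‖a p‖ + ‖b p‖ + ‖c p‖) ≤ 1 / 16) (p : E) :
    Differentiable ℝ (selfPotential (δ p) (a p) (b p) (c p)) := by
  obtain ⟨K, H, sH, h⟩ := exists_self_expansion sδ sa sb sc hsmall
  have h' := funext (h p)
  have d1 : ∀ a b c, ContDiff ℝ ∞ (shape a b c) := fun a b c =>
    contDiff_shape contDiff_const contDiff_const contDiff_const contDiff_id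
  have d2 := d1 (a p) (b p) (c p)
  have d3 := d1 (a p / 4) (b p / 3) (3 * c p / 8)
  have d4 : ContDiff ℝ ∞ (selfPotential (δ p) (a p) (b p) (c p)) := by
    unfold selfPotential
    rw [h']
    simp only [div_eq_mul_inv] at d3 ⊢
    fun_prop
  exact d4.differentiable (by simp)

theorem differentiable_pairPotential {E : Type} [NormedAddCommGroup E] [NormedSpace ℝ E]
    {e : E → ℝ} {α β a b c a' b' c' : E → ℂ} (se : ContDiff ℝ ∞ e) (sα : ContDiff ℝ ∞ α)
    (sβ : ContDiff ℝ ∞ β) (sa : ContDiff ℝ ∞ a) (sb : ContDiff ℝ ∞ b) (sc : ContDiff ℝ ∞ c)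
    (sa' : ContDiff ℝ ∞ a') (sb' : ContDiff ℝ ∞ b') (sc' : ContDiff ℝ ∞ c')
    {σ : ℤ} (hσ : |σ| = 1) (h1 : ∀ p, e p ^ 2 * (‖a p‖ + ‖b p‖ + ‖c p‖) ≤ 1 / 16)
    (h2 : ∀ p, e p ^ 2 * (‖a' p‖ + ‖b' p‖ + ‖c' p‖) ≤ 1 / 16)
    (h3 : ∀ p, |e p| * (‖α p‖ + ‖β p‖) ≤ 1 / 4) (p : E) :
    Differentiable ℝ
      (pairPotential (e p) (α p) (β p) σ (a p) (b p) (c p) (a' p) (b' p) (c' p)) := by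
  obtain ⟨K, H, sH, h⟩ :=
    exists_interaction_expansion se sα sβ sa sb sc sa' sb' sc' hσ h1 h2 h3
  have h' := funext (h p)
  have d1 : ContDiff ℝ ∞ (shape (a p) (b p) (c p)) :=
    contDiff_shape contDiff_const contDiff_const contDiff_const contDiff_id
  have d2 : ContDiff ℝ ∞ fun θ => H (p, θ) := sH.comp (by fun_prop)
  have d3 : ContDiff ℝ ∞ (pairPotential (e p) (α p) (β p) σ (a p) (b p) (c p) (a' p) (b' p)
      (c' p)) := by
    unfold pairPotential
    rw [h']
    fun_prop
  exact d3.differentiable (by simp)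

/-- The profile for which the sum of the four stream functions has, up to order `e⁵`, only the
second harmonic `e⁴ Re (c₂ e^{2iθ}) / 4`. -/
theorem exists_stream_expansion {E : Type} [NormedAddCommGroup E] [NormedSpace ℝ E]
    {e : E → ℝ} {α₂ α₃ α₄ β₂ β₃ β₄ c₂ a b c a' b' c' : E → ℂ} (se : ContDiff ℝ ∞ e)
    (sα₂ : ContDiff ℝ ∞ α₂) (sα₃ : ContDiff ℝ ∞ α₃) (sα₄ : ContDiff ℝ ∞ α₄)
    (sβ₂ : ContDiff ℝ ∞ β₂) (sβ₃ : ContDiff ℝ ∞ β₃) (sβ₄ : ContDiff ℝ ∞ β₄)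
    (sc₂ : ContDiff ℝ ∞ c₂) (sa' : ContDiff ℝ ∞ a') (sb' : ContDiff ℝ ∞ b')
    (sc' : ContDiff ℝ ∞ c')
    (ha : ∀ p, a p = α₂ p ^ 2 - α₃ p ^ 2 - α₄ p ^ 2 + e p ^ 2 * c₂ p)
    (hb : ∀ p, b p = e p * (-(α₂ p ^ 3 - α₃ p ^ 3 - α₄ p ^ 3) / 2))
    (hc : ∀ p, c p = e p ^ 2 * ((α₂ p ^ 2 - α₃ p ^ 2 - α₄ p ^ 2) ^ 2
      + (α₂ p ^ 4 - α₃ p ^ 4 - α₄ p ^ 4) / 3))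
    (h1 : ∀ p, e p ^ 2 * (‖a p‖ + ‖b p‖ + ‖c p‖) ≤ 1 / 16)
    (h2 : ∀ p, e p ^ 2 * (‖a' p‖ + ‖b' p‖ + ‖c' p‖) ≤ 1 / 16)
    (hα₂ : ∀ p, |e p| * (‖α₂ p‖ + ‖β₂ p‖) ≤ 1 / 4) (hα₃ : ∀ p, |e p| * (‖α₃ p‖ + ‖β₃ p‖) ≤ 1 / 4)
    (hα₄ : ∀ p, |e p| * (‖α₄ p‖ + ‖β₄ p‖) ≤ 1 / 4) :
    ∃ (K : E → ℝ) (H : E × ℝ → ℝ), ContDiff ℝ ∞ H ∧ ∀ p θ,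
      selfPotential (e p ^ 2) (a p) (b p) (c p) θ
        + pairPotential (e p) (α₂ p) (β₂ p) 1 (a p) (b p) (c p) (a' p) (b' p) (c' p) θ
        - pairPotential (e p) (α₃ p) (β₃ p) (-1) (a p) (b p) (c p) (a p) (b p) (c p) θ
        - pairPotential (e p) (α₄ p) (β₄ p) (-1) (a p) (b p) (c p) (a' p) (b' p) (c' p) θ
      = K p + e p ^ 4 / 4 * (c₂ p * cis (2 * θ)).re + e p ^ 5 * H (p, θ) := by
  have sa : ContDiff ℝ ∞ a := by rw [funext ha]; fun_prop
  have sb : ContDiff ℝ ∞ b := by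
    rw [funext hb]; simp only [div_eq_mul_inv]; fun_prop
  have sc : ContDiff ℝ ∞ c := by
    rw [funext hc]; simp only [div_eq_mul_inv]; fun_prop
  obtain ⟨K₁, H₁, sH₁, e₁⟩ := exists_self_expansion (δ := fun p => e p ^ 2) (by fun_prop) sa sb sc
    fun p => by rw [abs_of_nonneg (sq_nonneg (e p))]; exact h1 p
  obtain ⟨K₂, H₂, sH₂, e₂⟩ := exists_interaction_expansion se sα₂ sβ₂ sa sb sc sa' sb' sc'
    (σ := 1) (by simp) h1 h2 hα₂
  obtain ⟨K₃, H₃, sH₃, e₃⟩ := exists_interaction_expansion se sα₃ sβ₃ sa sb sc sa sb sc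
    (σ := -1) (by simp) h1 h1 hα₃
  obtain ⟨K₄, H₄, sH₄, e₄⟩ := exists_interaction_expansion se sα₄ sβ₄ sa sb sc sa' sb' sc'
    (σ := -1) (by simp) h1 h2 hα₄
  obtain ⟨A₂, hA₂⟩ : ∃ f : E → ℂ, ∀ p, f p = α₂ p ^ 2 - α₃ p ^ 2 - α₄ p ^ 2 := ⟨_, fun _ => rfl⟩
  have sA₂ : ContDiff ℝ ∞ A₂ := by rw [funext hA₂]; fun_prop
  obtain ⟨A₃, hA₃⟩ : ∃ f : E → ℂ, ∀ p, f p = α₂ p ^ 3 - α₃ p ^ 3 - α₄ p ^ 3 := ⟨_, fun _ => rfl⟩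
  have sA₃ : ContDiff ℝ ∞ A₃ := by rw [funext hA₃]; fun_prop
  obtain ⟨A₄, hA₄⟩ : ∃ f : E → ℂ, ∀ p, f p = α₂ p ^ 4 - α₃ p ^ 4 - α₄ p ^ 4 := ⟨_, fun _ => rfl⟩
  have sA₄ : ContDiff ℝ ∞ A₄ := by rw [funext hA₄]; fun_prop
  simp only [← hA₂, ← hA₃, ← hA₄] at ha hb hc
  obtain ⟨g₀, hg₀⟩ : ∃ f : E × ℝ → ℝ, ∀ x, f x = (A₂ x.1 * cis (2 * x.2)).re := ⟨_, fun _ => rfl⟩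
  have sg₀ : ContDiff ℝ ∞ g₀ := by rw [funext hg₀]; fun_prop
  obtain ⟨r₁, hr₁⟩ : ∃ f : E × ℝ → ℝ, ∀ x, f x = shape (e x.1 * c₂ x.1) (-A₃ x.1 / 2)
      (e x.1 * (A₂ x.1 ^ 2 + A₄ x.1 / 3)) x.2 := ⟨_, fun _ => rfl⟩
  have sr₁ : ContDiff ℝ ∞ r₁ := by
    rw [funext hr₁]
    simp only [div_eq_mul_inv]
    exact contDiff_shape (by fun_prop) (by fun_prop) (by fun_prop) (by fun_prop)
  -- The last constant is the mean of -(3/4)e⁴g₀². H collects the four remainders and the quadratic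
  -- terms that contain r₁, where r = g₀ + e r₁.
  refine ⟨fun p => K₁ p + K₂ p - K₃ p - K₄ p - 3 / 8 * e p ^ 4 * ‖A₂ p‖ ^ 2,
    fun x => -(1 / 4) * (2 * g₀ x + e x.1 * r₁ x) * r₁ x - 1 / 2 * g₀ x * r₁ x
      + e x.1 * H₁ x + H₂ x - H₃ x - H₄ x, by fun_prop, fun p θ => ?_⟩
  unfold selfPotential pairPotential
  rw [e₁, e₂, e₃, e₄]
  have hr : shape (a p) (b p) (c p) θ = g₀ (p, θ) + e p * r₁ (p, θ) := by
    rw [hg₀, hr₁, shape, shape, ← Complex.re_ofReal_mul, ← Complex.add_re, ha, hb, hc]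
    congr 1
    ring
  have hlin : shape (a p / 4) (b p / 3) (3 * c p / 8) θ
      = (1 / 4 * g₀ (p, θ)) + e p ^ 2 / 4 * (c₂ p * cis (2 * θ)).re
        - e p / 6 * (A₃ p * cis (3 * θ)).re
        + e p ^ 2 * (3 / 8 * (A₂ p ^ 2 * cis (4 * θ)).re + 1 / 8 * (A₄ p * cis (4 * θ)).re) := by
    rw [hg₀, shape, ha, hb, hc]
    simp only [← Complex.re_ofReal_mul, ← Complex.add_re, ← Complex.sub_re]
    congr 1
    push_cast
    ring
  -- The square of the second harmonic is a constant plus a fourth harmonic. The A₂² term in c is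
  -- there to cancel the latter.
  have hsq : g₀ (p, θ) ^ 2 = 1 / 2 * ‖A₂ p‖ ^ 2 + 1 / 2 * (A₂ p ^ 2 * cis (4 * θ)).re := by
    have h4 : cis (4 * θ) = cis (2 * θ) * cis (2 * θ) := by rw [← cis_add]; ring_nf
    have hn : A₂ p * cis (2 * θ) * (starRingEnd ℂ) (A₂ p * cis (2 * θ)) = ((‖A₂ p‖ ^ 2 : ℝ) : ℂ) := by
      rw [Complex.mul_conj, Complex.normSq_eq_norm_sq, norm_mul, norm_cis, mul_one]
    rw [hg₀, sq, re_mul_re, hn, Complex.ofReal_re, h4]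
    dsimp only
    rw [show A₂ p * cis (2 * θ) * (A₂ p * cis (2 * θ)) = A₂ p ^ 2 * (cis (2 * θ) * cis (2 * θ)) by
      ring]
    ring
  have hpair : ∀ α : ℂ, (-(e p : ℂ) ^ 2 / 4 * α ^ 2 * (1 + 2 * (e p) ^ 2 * shape (a p) (b p) (c p) θ)
          * cis (2 * θ) + (e p : ℂ) ^ 3 / 6 * α ^ 3 * cis (3 * θ)
          - (e p : ℂ) ^ 4 / 8 * α ^ 4 * cis (4 * θ)).re
      = -(e p ^ 2 / 4 * (1 + 2 * e p ^ 2 * shape (a p) (b p) (c p) θ)) * (α ^ 2 * cis (2 * θ)).re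
        + e p ^ 3 / 6 * (α ^ 3 * cis (3 * θ)).re - e p ^ 4 / 8 * (α ^ 4 * cis (4 * θ)).re := by
    intro α
    simp only [← Complex.re_ofReal_mul, ← Complex.add_re, ← Complex.sub_re]
    congr 1
    push_cast
    ring
  have s2 : g₀ (p, θ) = (α₂ p ^ 2 * cis (2 * θ)).re - (α₃ p ^ 2 * cis (2 * θ)).re
      - (α₄ p ^ 2 * cis (2 * θ)).re := by
    rw [hg₀, hA₂, sub_mul, sub_mul, Complex.sub_re, Complex.sub_re]
  have s3 : (A₃ p * cis (3 * θ)).re = (α₂ p ^ 3 * cis (3 * θ)).re - (α₃ p ^ 3 * cis (3 * θ)).re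
      - (α₄ p ^ 3 * cis (3 * θ)).re := by
    rw [hA₃, sub_mul, sub_mul, Complex.sub_re, Complex.sub_re]
  have s4 : (A₄ p * cis (4 * θ)).re = (α₂ p ^ 4 * cis (4 * θ)).re - (α₃ p ^ 4 * cis (4 * θ)).re
      - (α₄ p ^ 4 * cis (4 * θ)).re := by
    rw [hA₄, sub_mul, sub_mul, Complex.sub_re, Complex.sub_re]
  rw [hpair, hpair, hpair, hlin, hr]
  dsimp only
  -- The e² terms cancel through A₂, the e³ terms through A₃, and the fourth harmonic of order e⁴
  -- through A₄ and g₀². The coefficient -3/4 is -1/4 from the self-interaction and -1/2 from the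
  -- strain acting on r.
  linear_combination (e p ^ 2 / 4 * (1 + 2 * e p ^ 2 * (g₀ (p, θ) + e p * r₁ (p, θ)))) * s2
    - e p ^ 3 / 6 * s3 + e p ^ 4 / 8 * s4 - 3 / 4 * e p ^ 4 * hsq

/-! ### The functional on profiles with three harmonics -/

theorem cis_neg_mul (x y : ℝ) : cis (-(x + y)) = cis (-y) * cis (((-1 : ℤ) : ℝ) * x) := by
  rw [← cis_add]; congr 1; push_cast; ring

theorem radius_mul (ε : ℝ) (r : ℝ → ℝ → ℝ) (φ θ : ℝ) :
    radius ε (fun φ θ => ε * r φ θ) φ θ = √(1 + 2 * ε ^ 2 * r φ θ) := by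
  unfold radius; congr 1; ring

section

variable (y ξ ε : ℝ) (a b c : ℝ → ℂ) (φ : ℝ)

theorem Psi₁_shape : Psi₁ ε (fun φ θ => ε * shape (a φ) (b φ) (c φ) θ) φ
    = selfPotential (ε ^ 2) (a φ) (b φ) (c φ) := by
  ext θ
  have h : radius ε (fun φ θ => ε * shape (a φ) (b φ) (c φ) θ) φ
      = fun θ => √(1 + 2 * ε ^ 2 * shape (a φ) (b φ) (c φ) θ) :=
    funext (radius_mul ε (fun φ => shape (a φ) (b φ) (c φ)) φ)
  simp only [Psi₁, h, selfPotential]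

theorem Psi₂_shape : Psi₂ y ξ ε (fun φ θ => ε * shape (a φ) (b φ) (c φ) θ) φ
    = pairPotential ε (1 / (√(q y ξ φ) : ℂ)) (1 / (√(q y ξ φ) : ℂ)) 1 (a φ) (b φ) (c φ)
      (a (φ + Real.pi)) (b (φ + Real.pi)) (c (φ + Real.pi)) := by
  ext θ
  have h : ∀ φ, radius ε (fun φ θ => ε * shape (a φ) (b φ) (c φ) θ) φ
      = fun θ => √(1 + 2 * ε ^ 2 * shape (a φ) (b φ) (c φ) θ) := fun φ =>
    funext (radius_mul ε (fun φ => shape (a φ) (b φ) (c φ)) φ)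
  simp only [Psi₂, h, pairPotential]
  congr 1
  ext l η
  congr 1
  push_cast
  rw [one_mul]
  ring

/-- Reflection reverses the orientation of the source angle, hence σ = -1, and its phase e^{-iΘ} is
absorbed into β. -/
theorem Psi₃_shape : Psi₃ y ξ ε (fun φ θ => ε * shape (a φ) (b φ) (c φ) θ) φ
    = fun θ => -pairPotential ε (cis (Theta y ξ φ) / w₃ y ξ φ) (-cis (-Theta y ξ φ) / w₃ y ξ φ) (-1)
      (a φ) (b φ) (c φ) (a φ) (b φ) (c φ) θ := by
  ext θ
  have h : ∀ φ, radius ε (fun φ θ => ε * shape (a φ) (b φ) (c φ) θ) φ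
      = fun θ => √(1 + 2 * ε ^ 2 * shape (a φ) (b φ) (c φ) θ) := fun φ =>
    funext (radius_mul ε (fun φ => shape (a φ) (b φ) (c φ)) φ)
  simp only [Psi₃, h, pairPotential]
  congr 2
  ext l η
  congr 1
  rw [cis_add, cis_neg_mul]
  ring

theorem Psi₄_shape : Psi₄ y ξ ε (fun φ θ => ε * shape (a φ) (b φ) (c φ) θ) φ
    = fun θ => -pairPotential ε (cis (Theta y ξ φ) / w₄ y ξ φ) (cis (-Theta y ξ φ) / w₄ y ξ φ) (-1)
      (a φ) (b φ) (c φ) (a (φ + Real.pi)) (b (φ + Real.pi)) (c (φ + Real.pi)) θ := by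
  ext θ
  have h : ∀ φ, radius ε (fun φ θ => ε * shape (a φ) (b φ) (c φ) θ) φ
      = fun θ => √(1 + 2 * ε ^ 2 * shape (a φ) (b φ) (c φ) θ) := fun φ =>
    funext (radius_mul ε (fun φ => shape (a φ) (b φ) (c φ)) φ)
  simp only [Psi₄, h, pairPotential]
  congr 2
  ext l η
  congr 1
  rw [cis_add, cis_neg_mul]
  ring

end

theorem cis_add_two_pi (x : ℝ) : cis (x + 2 * Real.pi) = cis x := by
  simpa using cis_nat_mul_add_two_pi 1 x

theorem deriv_add_period {f : ℝ → ℝ} {T : ℝ} (hf : ∀ x, f (x + T) = f x) (x : ℝ) :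
    deriv f (x + T) = deriv f x := by
  rw [← deriv_comp_add_const f T x]
  simp only [hf]

/-- The remainder of G is obtained from existence statements that say nothing about periodicity. It
inherits periodicity from G after division by ε⁵. -/
theorem isPeriodic_G {y ξ : ℝ} (hq : ∀ φ, q y ξ (φ + 2 * Real.pi) = q y ξ φ)
    (hT : ∀ φ, Theta y ξ (φ + 2 * Real.pi) = Theta y ξ φ + 2 * Real.pi) (ε : ℝ) {r : ℝ → ℝ → ℝ}
    (hr : IsPeriodic r) : IsPeriodic (G y ξ ε r) := by
  have hl : ∀ φ, r (φ + 2 * Real.pi) = r φ := fun φ => funext (hr.1 φ)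
  have hR : ∀ φ, radius ε r (φ + 2 * Real.pi) = radius ε r φ := fun φ => by
    ext θ; simp only [radius, hl]
  have hR' : ∀ φ, radius ε r (φ + 2 * Real.pi + Real.pi) = radius ε r (φ + Real.pi) := fun φ => by
    rw [add_right_comm, hR]
  have hθ : ∀ φ θ, radius ε r φ (θ + 2 * Real.pi) = radius ε r φ θ := fun φ θ => by
    simp only [radius, hr.2]
  have hw₃ : ∀ φ, w₃ y ξ (φ + 2 * Real.pi) = w₃ y ξ φ := fun φ => by
    simp only [w₃, hq, hT, Real.sin_add_two_pi]
  have hw₄ : ∀ φ, w₄ y ξ (φ + 2 * Real.pi) = w₄ y ξ φ := fun φ => by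
    simp only [w₄, hq, hT, Real.cos_add_two_pi]
  have hc : ∀ x φ, cis (x + Theta y ξ (φ + 2 * Real.pi)) = cis (x + Theta y ξ φ) := fun x φ => by
    rw [hT, ← add_assoc, cis_add_two_pi]
  have hc' : ∀ x φ, cis (-(x + Theta y ξ (φ + 2 * Real.pi))) = cis (-(x + Theta y ξ φ)) :=
    fun x φ => by rw [← conj_cis, hc, conj_cis]
  have hdT : ∀ φ, deriv (Theta y ξ) (φ + 2 * Real.pi) = deriv (Theta y ξ) φ := fun φ => by
    rw [← deriv_comp_add_const (Theta y ξ) (2 * Real.pi) φ]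
    simp only [hT, deriv_add_const]
  have hc2 : ∀ θ x, cis (θ + 2 * Real.pi + x) = cis (θ + x) := fun θ x => by
    rw [add_right_comm, cis_add_two_pi]
  constructor
  · intro φ θ
    have p1 : Psi₁ ε r (φ + 2 * Real.pi) = Psi₁ ε r φ := by
      ext θ; simp only [Psi₁, hR]
    have p2 : Psi₂ y ξ ε r (φ + 2 * Real.pi) = Psi₂ y ξ ε r φ := by
      ext θ; simp only [Psi₂, hR, hR', hq]
    have p3 : Psi₃ y ξ ε r (φ + 2 * Real.pi) = Psi₃ y ξ ε r φ := by
      ext θ; simp only [Psi₃, hR, hw₃, hc, hc']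
    have p4 : Psi₄ y ξ ε r (φ + 2 * Real.pi) = Psi₄ y ξ ε r φ := by
      ext θ; simp only [Psi₄, hR, hR', hw₄, hc, hc']
    rw [G, G, p1, p2, p3, p4, hdT, hl, deriv_add_period fun x => hr.1 x θ]
  · intro φ θ
    have p1 : ∀ θ, Psi₁ ε r φ (θ + 2 * Real.pi) = Psi₁ ε r φ θ := fun θ => by
      simp only [Psi₁, hθ, cis_add_two_pi]
    have p2 : ∀ θ, Psi₂ y ξ ε r φ (θ + 2 * Real.pi) = Psi₂ y ξ ε r φ θ := fun θ => by
      simp only [Psi₂, hθ, cis_add_two_pi]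
    have p3 : ∀ θ, Psi₃ y ξ ε r φ (θ + 2 * Real.pi) = Psi₃ y ξ ε r φ θ := fun θ => by
      simp only [Psi₃, hθ, hc2]
    have p4 : ∀ θ, Psi₄ y ξ ε r φ (θ + 2 * Real.pi) = Psi₄ y ξ ε r φ θ := fun θ => by
      simp only [Psi₄, hθ, hc2]
    simp only [G, hr.2, deriv_add_period p1, deriv_add_period p2, deriv_add_period p3,
      deriv_add_period p4, deriv_add_period (hr.2 φ)]

theorem exists_bound_of_periodic {f : ℝ × ℝ → ℝ} (hf : Continuous f)
    (hp : ∀ ξ φ, f (ξ, φ + 2 * Real.pi) = f (ξ, φ)) (lo hi : ℝ) :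
    ∃ M, 0 < M ∧ ∀ ξ ∈ Icc lo hi, ∀ φ, |f (ξ, φ)| ≤ M := by
  obtain ⟨M, hM⟩ := (isCompact_Icc.prod isCompact_Icc).exists_bound_of_continuousOn
    (s := Icc lo hi ×ˢ Icc 0 (2 * Real.pi)) hf.continuousOn
  refine ⟨|M| + 1, by positivity, fun ξ hξ φ => ?_⟩
  have hper : Function.Periodic (fun φ => f (ξ, φ)) (2 * Real.pi) := hp ξ
  obtain ⟨ψ, hψ, h⟩ := hper.exists_mem_Ico₀ Real.two_pi_pos φ
  rw [show f (ξ, φ) = f (ξ, ψ) from h]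
  exact (hM (ξ, ψ) ⟨hξ, hψ.1, hψ.2.le⟩).trans (by linarith [le_abs_self M])

/-! ### Smooth coefficients along the family of orbits -/

theorem hasDerivAt_snd {F : Type} [NormedAddCommGroup F] [NormedSpace ℝ F] {f : ℝ × ℝ → F}
    (hf : ContDiff ℝ ∞ f) (ξ φ : ℝ) :
    HasDerivAt (fun φ => f (ξ, φ)) (fderiv ℝ f (ξ, φ) (0, 1)) φ :=
  ((hf.differentiable (by simp)) (ξ, φ)).hasFDerivAt.comp_hasDerivAt φ
    ((hasDerivAt_const φ ξ).prodMk (hasDerivAt_id' φ))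

theorem contDiff_fderiv_snd {F : Type} [NormedAddCommGroup F] [NormedSpace ℝ F] {f : ℝ × ℝ → F}
    (hf : ContDiff ℝ ∞ f) : ContDiff ℝ ∞ fun x => fderiv ℝ f x (0, 1) :=
  (hf.fderiv_right (m := ∞) (by simp)).clm_apply contDiff_const

theorem fderiv_snd_add_two_pi {F : Type} [NormedAddCommGroup F] [NormedSpace ℝ F] {f : ℝ × ℝ → F}
    (hf : ContDiff ℝ ∞ f) (v : F) (hp : ∀ ξ φ, f (ξ, φ + 2 * Real.pi) = f (ξ, φ) + v) (ξ φ : ℝ) :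
    fderiv ℝ f (ξ, φ + 2 * Real.pi) (0, 1) = fderiv ℝ f (ξ, φ) (0, 1) := by
  have h1 := (hasDerivAt_snd hf ξ (φ + 2 * Real.pi)).comp_add_const φ (2 * Real.pi)
  have h2 := (hasDerivAt_snd hf ξ φ).add_const v
  simp only [hp] at h1
  exact h1.unique h2

theorem norm_neg_cis_neg_div (x : ℝ) (w : ℂ) : ‖-cis (-x) / w‖ = ‖cis x / w‖ := by
  rw [norm_div, norm_div, norm_neg, norm_cis, norm_cis]

theorem norm_cis_neg_div (x : ℝ) (w : ℂ) : ‖cis (-x) / w‖ = ‖cis x / w‖ := by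
  rw [norm_div, norm_div, norm_cis, norm_cis]

theorem contDiff_complex_div {E : Type} [NormedAddCommGroup E] [NormedSpace ℝ E] {f g : E → ℂ}
    (hf : ContDiff ℝ ∞ f) (hg : ContDiff ℝ ∞ g) (h : ∀ x, g x ≠ 0) :
    ContDiff ℝ ∞ fun x => f x / g x := by
  simp only [div_eq_mul_inv]
  exact hf.mul (hg.inv h)

/-- The coefficients of the interaction with the three other patches as smooth functions of
`(ξ, φ)`, with `c₂` the second order correction that balances the transport terms. -/
theorem exists_smooth_coefficients {y lo hi : ℝ} (hy : 0 < y) (hlo : 0 < lo) (hlt : lo < hi)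
    (hhi : hi < y / √2) :
    ∃ (α₂ α₃ α₄ β₃ β₄ A' c₂ : ℝ × ℝ → ℂ) (Om : ℝ → ℝ) (Th' : ℝ × ℝ → ℝ),
      (ContDiff ℝ ∞ α₂ ∧ ContDiff ℝ ∞ α₃ ∧ ContDiff ℝ ∞ α₄ ∧ ContDiff ℝ ∞ β₃ ∧ ContDiff ℝ ∞ β₄ ∧
        ContDiff ℝ ∞ c₂ ∧ ContDiff ℝ ∞ Om ∧ ContDiff ℝ ∞ Th') ∧
      (∀ ξ φ, α₂ (ξ, φ + 2 * Real.pi) = α₂ (ξ, φ) ∧ α₃ (ξ, φ + 2 * Real.pi) = α₃ (ξ, φ) ∧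
        α₄ (ξ, φ + 2 * Real.pi) = α₄ (ξ, φ) ∧ c₂ (ξ, φ + 2 * Real.pi) = c₂ (ξ, φ)) ∧
      (∀ x, ‖β₃ x‖ = ‖α₃ x‖ ∧ ‖β₄ x‖ = ‖α₄ x‖) ∧
      (∀ ξ φ, HasDerivAt (fun φ => α₂ (ξ, φ) ^ 2 - α₃ (ξ, φ) ^ 2 - α₄ (ξ, φ) ^ 2) (A' (ξ, φ)) φ) ∧
      (∀ ξ φ, c₂ (ξ, φ) = 2 * Complex.I * Om ξ * (A' (ξ, φ) - 2 * Complex.I * Th' (ξ, φ)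
        * (α₂ (ξ, φ) ^ 2 - α₃ (ξ, φ) ^ 2 - α₄ (ξ, φ) ^ 2))) ∧
      ∀ ξ ∈ Icc lo hi, freq y ξ = Om ξ ∧ ∀ φ, 1 / (√(q y ξ φ) : ℂ) = α₂ (ξ, φ) ∧
        cis (Theta y ξ φ) / w₃ y ξ φ = α₃ (ξ, φ) ∧ cis (Theta y ξ φ) / w₄ y ξ φ = α₄ (ξ, φ) ∧
        -cis (-Theta y ξ φ) / w₃ y ξ φ = β₃ (ξ, φ) ∧ cis (-Theta y ξ φ) / w₄ y ξ φ = β₄ (ξ, φ) ∧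
        a₂ y ξ φ = α₂ (ξ, φ) ^ 2 - α₃ (ξ, φ) ^ 2 - α₄ (ξ, φ) ^ 2 ∧
        deriv (Theta y ξ) φ = Th' (ξ, φ) ∧ q y ξ (φ + 2 * Real.pi) = q y ξ φ ∧
        Theta y ξ (φ + 2 * Real.pi) = Theta y ξ φ + 2 * Real.pi := by
  obtain ⟨Q, Th, Om, sQ, sTh, sOm, Q0, hQ, pQ, pTh, horb⟩ := exists_smooth_orbit hy hlo hlt hhi
  obtain ⟨rt, hrt⟩ : ∃ f : ℝ × ℝ → ℝ, ∀ x, f x = √(Q x) := ⟨_, fun _ => rfl⟩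
  have srt : ContDiff ℝ ∞ rt := by rw [funext hrt]; exact sQ.sqrt fun x => (Q0 x).ne'
  have rt0 : ∀ x, 0 < rt x := fun x => by rw [hrt]; exact Real.sqrt_pos.2 (Q0 x)
  have prt : ∀ ξ φ, rt (ξ, φ + 2 * Real.pi) = rt (ξ, φ) := fun ξ φ => by rw [hrt, hrt, pQ]
  obtain ⟨W₃, hW₃⟩ : ∃ f : ℝ × ℝ → ℂ, ∀ x, f x
    = Complex.I * ((rt x * Real.sin (Th x) : ℝ) : ℂ) + Complex.I * (y : ℂ) := ⟨_, fun _ => rfl⟩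
  have sW₃ : ContDiff ℝ ∞ W₃ := by rw [funext hW₃]; fun_prop
  -- A zero would give Q sin²Th = y², which the absence of collisions excludes.
  have W₃0 : ∀ x, W₃ x ≠ 0 := fun x h => by
    have h1 : (W₃ x).im = rt x * Real.sin (Th x) + y := by
      rw [hW₃, Complex.add_im, Complex.I_mul_im, Complex.I_mul_im, Complex.ofReal_re,
        Complex.ofReal_re]
    rw [h, Complex.zero_im] at h1
    have h2 := hQ x
    have h3 : rt x ^ 2 = Q x := by rw [hrt, Real.sq_sqrt (Q0 x).le]
    rw [← h3, ← mul_pow, show rt x * Real.sin (Th x) = -y by linarith, neg_sq] at h2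
    exact lt_irrefl _ h2
  obtain ⟨W₄, hW₄⟩ : ∃ f : ℝ × ℝ → ℂ, ∀ x, f x
    = ((rt x * Real.cos (Th x) : ℝ) : ℂ) + Complex.I * (y : ℂ) := ⟨_, fun _ => rfl⟩
  have sW₄ : ContDiff ℝ ∞ W₄ := by rw [funext hW₄]; fun_prop
  have W₄0 : ∀ x, W₄ x ≠ 0 := fun x h => by
    have h1 : (W₄ x).im = y := by
      rw [hW₄, Complex.add_im, Complex.ofReal_im]; simp
    rw [h, Complex.zero_im] at h1
    exact hy.ne h1
  have pW₃ : ∀ ξ φ, W₃ (ξ, φ + 2 * Real.pi) = W₃ (ξ, φ) := fun ξ φ => by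
    rw [hW₃, hW₃, prt, pTh, Real.sin_add_two_pi]
  have pW₄ : ∀ ξ φ, W₄ (ξ, φ + 2 * Real.pi) = W₄ (ξ, φ) := fun ξ φ => by
    rw [hW₄, hW₄, prt, pTh, Real.cos_add_two_pi]
  obtain ⟨α₂, hα₂⟩ : ∃ f : ℝ × ℝ → ℂ, ∀ x, f x = 1 / (rt x : ℂ) := ⟨_, fun _ => rfl⟩
  obtain ⟨α₃, hα₃⟩ : ∃ f : ℝ × ℝ → ℂ, ∀ x, f x = cis (Th x) / W₃ x := ⟨_, fun _ => rfl⟩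
  obtain ⟨α₄, hα₄⟩ : ∃ f : ℝ × ℝ → ℂ, ∀ x, f x = cis (Th x) / W₄ x := ⟨_, fun _ => rfl⟩
  have sα₂ : ContDiff ℝ ∞ α₂ := by
    rw [funext hα₂]
    exact contDiff_complex_div (by fun_prop) (by fun_prop)
      fun x => Complex.ofReal_ne_zero.2 (rt0 x).ne'
  have sα₃ : ContDiff ℝ ∞ α₃ := by
    rw [funext hα₃]; exact contDiff_complex_div (by fun_prop) sW₃ W₃0
  have sα₄ : ContDiff ℝ ∞ α₄ := by
    rw [funext hα₄]; exact contDiff_complex_div (by fun_prop) sW₄ W₄0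
  have pα₂ : ∀ ξ φ, α₂ (ξ, φ + 2 * Real.pi) = α₂ (ξ, φ) := fun ξ φ => by rw [hα₂, hα₂, prt]
  have pα₃ : ∀ ξ φ, α₃ (ξ, φ + 2 * Real.pi) = α₃ (ξ, φ) := fun ξ φ => by
    rw [hα₃, hα₃, pW₃, pTh, cis_add_two_pi]
  have pα₄ : ∀ ξ φ, α₄ (ξ, φ + 2 * Real.pi) = α₄ (ξ, φ) := fun ξ φ => by
    rw [hα₄, hα₄, pW₄, pTh, cis_add_two_pi]
  obtain ⟨A, hA⟩ : ∃ f : ℝ × ℝ → ℂ, ∀ x, f x = α₂ x ^ 2 - α₃ x ^ 2 - α₄ x ^ 2 := ⟨_, fun _ => rfl⟩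
  have sA : ContDiff ℝ ∞ A := by rw [funext hA]; fun_prop
  have pA : ∀ ξ φ, A (ξ, φ + 2 * Real.pi) = A (ξ, φ) := fun ξ φ => by
    rw [hA, hA, pα₂, pα₃, pα₄]
  have sA' := contDiff_fderiv_snd sA
  have sTh' := contDiff_fderiv_snd sTh
  -- Chosen so that ∂_θ of Re(c₂e^{2iθ})/4 equals -Om · (∂_φ - Th' ∂_θ) Re(A e^{2iθ}), since (i/2) ·
  -- 2i = -1.
  obtain ⟨c₂, hc₂⟩ : ∃ f : ℝ × ℝ → ℂ, ∀ x, f x = 2 * Complex.I * Om x.1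
    * (fderiv ℝ A x (0, 1) - 2 * Complex.I * ((fderiv ℝ Th x (0, 1) : ℝ) : ℂ) * A x) :=
    ⟨_, fun _ => rfl⟩
  refine ⟨α₂, α₃, α₄, fun x => -cis (-Th x) / W₃ x, fun x => cis (-Th x) / W₄ x,
    fun x => fderiv ℝ A x (0, 1), c₂, Om, fun x => fderiv ℝ Th x (0, 1),
    ⟨sα₂, sα₃, sα₄, contDiff_complex_div (by fun_prop) sW₃ W₃0,
      contDiff_complex_div (by fun_prop) sW₄ W₄0, ?_, sOm, sTh'⟩,
    fun ξ φ => ⟨pα₂ ξ φ, pα₃ ξ φ, pα₄ ξ φ, ?_⟩, fun x => ⟨?_, ?_⟩, fun ξ φ => ?_, fun ξ φ => ?_,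
    fun ξ hξ => ⟨(horb ξ hξ).1, fun φ => ?_⟩⟩
  · rw [funext hc₂]
    have h1 : ContDiff ℝ ∞ fun x => ((fderiv ℝ Th x (0, 1) : ℝ) : ℂ) := contDiff_ofReal.comp sTh'
    have h2 : ContDiff ℝ ∞ fun x : ℝ × ℝ => (2 * Complex.I * Om x.1 : ℂ) := by fun_prop
    exact h2.mul (sA'.sub ((contDiff_const.mul h1).mul sA))
  · rw [hc₂, hc₂, pA, fderiv_snd_add_two_pi sA 0 (fun ξ φ => by rw [pA, add_zero]),
      fderiv_snd_add_two_pi sTh (2 * Real.pi) pTh]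
  · rw [hα₃]; exact norm_neg_cis_neg_div _ _
  · rw [hα₄]; exact norm_cis_neg_div _ _
  · have := hasDerivAt_snd sA ξ φ
    simp only [hA] at this
    exact this
  · rw [hc₂, hA]
  · obtain ⟨-, h⟩ := horb ξ hξ
    have hq : ∀ φ, q y ξ φ = Q (ξ, φ) := fun φ => (h φ).1
    have hT : ∀ φ, Theta y ξ φ = Th (ξ, φ) := fun φ => (h φ).2
    have e2 : 1 / (√(q y ξ φ) : ℂ) = α₂ (ξ, φ) := by rw [hα₂, hrt, hq]
    have k3 : w₃ y ξ φ = W₃ (ξ, φ) := by rw [w₃, hW₃, hrt, hq, hT]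
    have k4 : w₄ y ξ φ = W₄ (ξ, φ) := by rw [w₄, hW₄, hrt, hq, hT]
    have e3 : cis (Theta y ξ φ) / w₃ y ξ φ = α₃ (ξ, φ) := by rw [hα₃, k3, hT]
    have e4 : cis (Theta y ξ φ) / w₄ y ξ φ = α₄ (ξ, φ) := by rw [hα₄, k4, hT]
    refine ⟨e2, e3, e4, by rw [k3, hT], by rw [k4, hT], ?_, ?_, by rw [hq, hq, pQ],
      by rw [hT, hT, pTh]⟩
    · have hc : cis (2 * Theta y ξ φ) = cis (Theta y ξ φ) ^ 2 := by rw [two_mul, cis_add, sq]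
      have hs : (√(q y ξ φ) : ℂ) ^ 2 = q y ξ φ := by
        rw [← Complex.ofReal_pow, Real.sq_sqrt]
        rw [hq]; exact (Q0 _).le
      rw [← e2, ← e3, ← e4, a₂, div_pow, div_pow, div_pow, hc, hs, one_pow]
    · rw [show Theta y ξ = fun φ => Th (ξ, φ) from funext hT]
      exact (hasDerivAt_snd sTh ξ φ).deriv

/-! ### Construction of the approximate solution. -/

/-- The approximate solution, with residual and correction written as smooth functions of the
parameters and variables. -/
theorem exists_approximate_solution (y lo hi : ℝ) (hy : 0 < y) (hlo : 0 < lo) (hlt : lo < hi)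
    (hhi : hi < y / √2) :
    ∃ ε₀ : ℝ, 0 < ε₀ ∧ ∃ (r : ℝ → ℝ → ℝ → ℝ → ℝ) (R r₁ h : (ℝ × ℝ × ℝ) × ℝ → ℝ),
      ContDiff ℝ ∞ R ∧ ContDiff ℝ ∞ r₁ ∧ ContDiff ℝ ∞ h ∧
      ∀ ε ∈ Ioo 0 ε₀, ∀ ξ ∈ Icc lo hi, IsSmoothZeroMean (r ε ξ) ∧
        Admissible y ξ ε (fun φ θ => ε * r ε ξ φ θ) ∧
        IsPeriodic (slice R ε ξ) ∧ IsPeriodic (slice r₁ ε ξ) ∧ IsPeriodic (slice h ε ξ) ∧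
        ∀ φ θ, r ε ξ φ θ = R ((ε, ξ, φ), θ) ∧ r ε ξ φ θ - g y ξ φ θ = ε * r₁ ((ε, ξ, φ), θ) ∧
          G y ξ ε (fun φ θ => ε * r ε ξ φ θ) φ θ = ε ^ 5 * h ((ε, ξ, φ), θ) := by
  obtain ⟨α₂, α₃, α₄, β₃, β₄, A', c₂, Om, Th', ⟨sα₂, sα₃, sα₄, sβ₃, sβ₄, sc₂, sOm, sTh'⟩, hper, hβ,
    hA', hc₂, horb⟩ := exists_smooth_coefficients hy hlo hlt hhi
  -- The coefficients are smooth for all ξ, but bounds are available only on compact sets. Confining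
  -- ξ to (lo - 1, hi + 1) makes one constant M serve everywhere.
  obtain ⟨χ, sχ, hχ, hχr⟩ := exists_smooth_cutoff (sub_one_lt lo) hlt (lt_add_one hi)
  obtain ⟨A, hA⟩ : ∃ f : ℝ × ℝ → ℂ, ∀ x, f x = α₂ x ^ 2 - α₃ x ^ 2 - α₄ x ^ 2 := ⟨_, fun _ => rfl⟩
  have sA : ContDiff ℝ ∞ A := by rw [funext hA]; fun_prop
  obtain ⟨a₃, ha₃⟩ : ∃ f : ℝ × ℝ → ℂ, ∀ x, f x = -(α₂ x ^ 3 - α₃ x ^ 3 - α₄ x ^ 3) / 2 :=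
    ⟨_, fun _ => rfl⟩
  have sa₃ : ContDiff ℝ ∞ a₃ := by rw [funext ha₃]; simp only [div_eq_mul_inv]; fun_prop
  obtain ⟨c₄, hc₄⟩ : ∃ f : ℝ × ℝ → ℂ, ∀ x, f x = (α₂ x ^ 2 - α₃ x ^ 2 - α₄ x ^ 2) ^ 2
    + (α₂ x ^ 4 - α₃ x ^ 4 - α₄ x ^ 4) / 3 := ⟨_, fun _ => rfl⟩
  have sc₄ : ContDiff ℝ ∞ c₄ := by rw [funext hc₄]; simp only [div_eq_mul_inv]; fun_prop
  have pA : ∀ ξ φ, A (ξ, φ + 2 * Real.pi) = A (ξ, φ) := fun ξ φ => by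
    rw [hA, hA, (hper ξ φ).1, (hper ξ φ).2.1, (hper ξ φ).2.2.1]
  have pa₃ : ∀ ξ φ, a₃ (ξ, φ + 2 * Real.pi) = a₃ (ξ, φ) := fun ξ φ => by
    rw [ha₃, ha₃, (hper ξ φ).1, (hper ξ φ).2.1, (hper ξ φ).2.2.1]
  have pc₄ : ∀ ξ φ, c₄ (ξ, φ + 2 * Real.pi) = c₄ (ξ, φ) := fun ξ φ => by
    rw [hc₄, hc₄, (hper ξ φ).1, (hper ξ φ).2.1, (hper ξ φ).2.2.1]
  have pc₂ : ∀ ξ φ, c₂ (ξ, φ + 2 * Real.pi) = c₂ (ξ, φ) := fun ξ φ => (hper ξ φ).2.2.2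
  obtain ⟨M, hM, hMb⟩ := exists_bound_of_periodic
    (f := fun x => ‖α₂ x‖ + ‖α₃ x‖ + ‖α₄ x‖ + ‖A x‖ + ‖c₂ x‖ + ‖a₃ x‖ + ‖c₄ x‖)
    (((((((sα₂.continuous.norm).add sα₃.continuous.norm).add sα₄.continuous.norm).add
      sA.continuous.norm).add sc₂.continuous.norm).add sa₃.continuous.norm).add
      sc₄.continuous.norm)
    (fun ξ φ => by
      simp only [(hper ξ φ).1, (hper ξ φ).2.1, (hper ξ φ).2.2.1, pc₂, pA, pa₃, pc₄])
    (lo - 1) (hi + 1)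
  have hMx : ∀ ξ φ, ‖α₂ (χ ξ, φ)‖ + ‖α₃ (χ ξ, φ)‖ + ‖α₄ (χ ξ, φ)‖ + ‖A (χ ξ, φ)‖ + ‖c₂ (χ ξ, φ)‖
      + ‖a₃ (χ ξ, φ)‖ + ‖c₄ (χ ξ, φ)‖ ≤ M := fun ξ φ =>
    (le_abs_self _).trans (hMb (χ ξ) ⟨(hχr ξ).1.le, (hχr ξ).2.le⟩ φ)
  -- Small enough that e₁M ≤ 1/16 and e₁ ≤ 1, which gives all smallness hypotheses of the
  -- expansions.
  obtain ⟨e₁, he₁⟩ : ∃ e₁ : ℝ, e₁ = 1 / (16 * (M + 1)) := ⟨_, rfl⟩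
  have he₁0 : 0 < e₁ := by rw [he₁]; positivity
  have he₁1 : e₁ ≤ 1 := by
    rw [he₁, div_le_one (by positivity)]; linarith
  have he₁M : e₁ * M ≤ 1 / 16 := by
    rw [he₁, div_mul_eq_mul_div, one_mul, div_le_div_iff₀ (by positivity) (by norm_num)]
    linarith
  -- Replacing ε by k(ε) with |k| ≤ e₁ makes these hypotheses hold for all real ε. On (0, e₁/2), the
  -- range finally used, k(ε) = ε.
  obtain ⟨k, sk, hk, hkr⟩ := exists_smooth_cutoff (a := -e₁) (lo := -(e₁ / 2)) (hi := e₁ / 2)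
    (b := e₁) (by linarith) (by linarith) (by linarith)
  have hkabs : ∀ ε, |k ε| ≤ e₁ := fun ε => abs_le.2 ⟨(hkr ε).1.le, (hkr ε).2.le⟩
  have hk2 : ∀ ε, k ε ^ 2 ≤ e₁ := fun ε => by
    rw [← sq_abs]
    calc |k ε| ^ 2 ≤ e₁ ^ 2 := pow_le_pow_left₀ (abs_nonneg _) (hkabs ε) 2
      _ ≤ e₁ := by rw [sq]; exact mul_le_of_le_one_left he₁0.le he₁1
  have hkid : ∀ ε ∈ Ioo 0 (e₁ / 2), k ε = ε := fun ε hε => hk ε ⟨by linarith [hε.1], hε.2.le⟩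
  obtain ⟨a, ha⟩ : ∃ f : ℝ × ℝ × ℝ → ℂ, ∀ p, f p = A (χ p.2.1, p.2.2)
    + (k p.1 : ℂ) ^ 2 * c₂ (χ p.2.1, p.2.2) := ⟨_, fun _ => rfl⟩
  obtain ⟨b, hb⟩ : ∃ f : ℝ × ℝ × ℝ → ℂ, ∀ p, f p = (k p.1 : ℂ) * a₃ (χ p.2.1, p.2.2) :=
    ⟨_, fun _ => rfl⟩
  obtain ⟨c, hc⟩ : ∃ f : ℝ × ℝ × ℝ → ℂ, ∀ p, f p = (k p.1 : ℂ) ^ 2 * c₄ (χ p.2.1, p.2.2) :=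
    ⟨_, fun _ => rfl⟩
  have sa : ContDiff ℝ ∞ a := by rw [funext ha]; fun_prop
  have sb : ContDiff ℝ ∞ b := by rw [funext hb]; fun_prop
  have sc : ContDiff ℝ ∞ c := by rw [funext hc]; fun_prop
  have hsm : ∀ p, k p.1 ^ 2 * (‖a p‖ + ‖b p‖ + ‖c p‖) ≤ 1 / 16 := fun p => by
    have n0 : ‖(k p.1 : ℂ)‖ ≤ 1 := by
      rw [Complex.norm_real, Real.norm_eq_abs]; exact (hkabs _).trans he₁1
    have n2 : ‖(k p.1 : ℂ) ^ 2‖ ≤ 1 := by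
      rw [norm_pow]; exact pow_le_one₀ (norm_nonneg _) n0
    have na : ‖a p‖ ≤ ‖A (χ p.2.1, p.2.2)‖ + ‖c₂ (χ p.2.1, p.2.2)‖ := by
      rw [ha]
      refine (norm_add_le _ _).trans (add_le_add le_rfl ?_)
      rw [norm_mul]
      exact mul_le_of_le_one_left (norm_nonneg _) n2
    have nb : ‖b p‖ ≤ ‖a₃ (χ p.2.1, p.2.2)‖ := by
      rw [hb, norm_mul]; exact mul_le_of_le_one_left (norm_nonneg _) n0
    have nc : ‖c p‖ ≤ ‖c₄ (χ p.2.1, p.2.2)‖ := by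
      rw [hc, norm_mul]; exact mul_le_of_le_one_left (norm_nonneg _) n2
    have nM : ‖a p‖ + ‖b p‖ + ‖c p‖ ≤ M := by
      have := hMx p.2.1 p.2.2
      linarith [norm_nonneg (α₂ (χ p.2.1, p.2.2)), norm_nonneg (α₃ (χ p.2.1, p.2.2)),
        norm_nonneg (α₄ (χ p.2.1, p.2.2))]
    exact (mul_le_mul (hk2 p.1) nM (by positivity) he₁0.le).trans he₁M
  have hsα : ∀ (p : ℝ × ℝ × ℝ), |k p.1| * (‖α₂ (χ p.2.1, p.2.2)‖ + ‖α₂ (χ p.2.1, p.2.2)‖) ≤ 1 / 4 ∧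
      |k p.1| * (‖α₃ (χ p.2.1, p.2.2)‖ + ‖β₃ (χ p.2.1, p.2.2)‖) ≤ 1 / 4 ∧
      |k p.1| * (‖α₄ (χ p.2.1, p.2.2)‖ + ‖β₄ (χ p.2.1, p.2.2)‖) ≤ 1 / 4 := fun p => by
    have key : ∀ {s : ℝ}, 0 ≤ s → s ≤ M → |k p.1| * (s + s) ≤ 1 / 4 := fun {s} h0 h => by
      have := mul_le_mul (hkabs p.1) h h0 he₁0.le
      linarith
    have h := hMx p.2.1 p.2.2
    have g1 := norm_nonneg (α₂ (χ p.2.1, p.2.2))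
    have g2 := norm_nonneg (α₃ (χ p.2.1, p.2.2))
    have g3 := norm_nonneg (α₄ (χ p.2.1, p.2.2))
    have g4 := norm_nonneg (A (χ p.2.1, p.2.2))
    have g5 := norm_nonneg (c₂ (χ p.2.1, p.2.2))
    have g6 := norm_nonneg (a₃ (χ p.2.1, p.2.2))
    have g7 := norm_nonneg (c₄ (χ p.2.1, p.2.2))
    rw [(hβ _).1, (hβ _).2]
    exact ⟨key g1 (by linarith), key g2 (by linarith), key g3 (by linarith)⟩
  have sX : ContDiff ℝ ∞ fun p : ℝ × ℝ × ℝ => (χ p.2.1, p.2.2) := by fun_prop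
  have sshift : ContDiff ℝ ∞ fun p : ℝ × ℝ × ℝ => (p.1, p.2.1, p.2.2 + Real.pi) := by fun_prop
  obtain ⟨K, H, sH, hH⟩ := exists_stream_expansion (E := ℝ × ℝ × ℝ) (e := fun p => k p.1)
    (a := a) (b := b) (c := c) (a' := fun p => a (p.1, p.2.1, p.2.2 + Real.pi))
    (b' := fun p => b (p.1, p.2.1, p.2.2 + Real.pi))
    (c' := fun p => c (p.1, p.2.1, p.2.2 + Real.pi)) (by fun_prop) (sα₂.comp sX) (sα₃.comp sX)
    (sα₄.comp sX) (sα₂.comp sX) (sβ₃.comp sX) (sβ₄.comp sX) (sc₂.comp sX) (sa.comp sshift)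
    (sb.comp sshift) (sc.comp sshift) (fun p => by rw [ha, hA]; rfl) (fun p => by rw [hb, ha₃]; rfl)
    (fun p => by rw [hc, hc₄]; rfl) hsm (fun p => hsm (p.1, p.2.1, p.2.2 + Real.pi))
    (fun p => (hsα p).1) (fun p => (hsα p).2.1) (fun p => (hsα p).2.2)
  obtain ⟨r₁, hr₁⟩ : ∃ f : (ℝ × ℝ × ℝ) × ℝ → ℝ, ∀ x, f x
    = shape (k x.1.1 * c₂ (χ x.1.2.1, x.1.2.2)) (a₃ (χ x.1.2.1, x.1.2.2))
      (k x.1.1 * c₄ (χ x.1.2.1, x.1.2.2)) x.2 := ⟨_, fun _ => rfl⟩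
  have sr₁ : ContDiff ℝ ∞ r₁ := by
    rw [funext hr₁]
    exact contDiff_shape (by fun_prop) (by fun_prop) (by fun_prop) (by fun_prop)
  -- The residual coefficient is the θ-derivative of the stream remainder plus the transport of r₁,
  -- which enters G with the factor ε³ · ε · ε.
  refine ⟨e₁ / 2, by linarith, fun ε ξ φ θ => shape (a (ε, ξ, φ)) (b (ε, ξ, φ)) (c (ε, ξ, φ)) θ,
    fun x => shape (a x.1) (b x.1) (c x.1) x.2, r₁,
    fun x => dirDeriv ((0, 0, 0), 1) H x + Om (χ x.1.2.1) * (dirDeriv ((0, 0, 1), 0) r₁ x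
      - Th' (χ x.1.2.1, x.1.2.2) * dirDeriv ((0, 0, 0), 1) r₁ x),
    contDiff_shape (by fun_prop) (by fun_prop) (by fun_prop) (by fun_prop), sr₁, ?_, ?_⟩
  · have d1 := contDiff_dirDeriv sH ((0, 0, 0), 1)
    have d2 := contDiff_dirDeriv sr₁ ((0, 0, 1), 0)
    have d3 := contDiff_dirDeriv sr₁ ((0, 0, 0), 1)
    fun_prop
  intro ε hε ξ hξ
  have kε := hkid ε hε
  have χξ := hχ ξ hξ
  obtain ⟨hOm, horbφ⟩ := horb ξ hξ
  have hq : ∀ φ, 1 / (√(q y ξ φ) : ℂ) = α₂ (ξ, φ) := fun φ => (horbφ φ).1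
  have hw₃ : ∀ φ, cis (Theta y ξ φ) / w₃ y ξ φ = α₃ (ξ, φ) := fun φ => (horbφ φ).2.1
  have hw₄ : ∀ φ, cis (Theta y ξ φ) / w₄ y ξ φ = α₄ (ξ, φ) := fun φ => (horbφ φ).2.2.1
  have hw₃' : ∀ φ, -cis (-Theta y ξ φ) / w₃ y ξ φ = β₃ (ξ, φ) := fun φ => (horbφ φ).2.2.2.1
  have hw₄' : ∀ φ, cis (-Theta y ξ φ) / w₄ y ξ φ = β₄ (ξ, φ) := fun φ => (horbφ φ).2.2.2.2.1
  have ha₂ : ∀ φ, a₂ y ξ φ = A (ξ, φ) := fun φ => by rw [hA]; exact (horbφ φ).2.2.2.2.2.1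
  have hTh' : ∀ φ, deriv (Theta y ξ) φ = Th' (ξ, φ) := fun φ => (horbφ φ).2.2.2.2.2.2.1
  have hqp : ∀ φ, q y ξ (φ + 2 * Real.pi) = q y ξ φ := fun φ => (horbφ φ).2.2.2.2.2.2.2.1
  have hTp : ∀ φ, Theta y ξ (φ + 2 * Real.pi) = Theta y ξ φ + 2 * Real.pi :=
    fun φ => (horbφ φ).2.2.2.2.2.2.2.2
  have pa : ∀ φ, a (ε, ξ, φ + 2 * Real.pi) = a (ε, ξ, φ) := fun φ => by
    rw [ha, ha]; simp only [pA, pc₂]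
  have pb : ∀ φ, b (ε, ξ, φ + 2 * Real.pi) = b (ε, ξ, φ) := fun φ => by
    rw [hb, hb]; simp only [pa₃]
  have pc : ∀ φ, c (ε, ξ, φ + 2 * Real.pi) = c (ε, ξ, φ) := fun φ => by
    rw [hc, hc]; simp only [pc₄]
  have hper_r : IsPeriodic fun φ θ => shape (a (ε, ξ, φ)) (b (ε, ξ, φ)) (c (ε, ξ, φ)) θ :=
    ⟨fun φ θ => by simp only [pa, pb, pc], fun φ θ => shape_add_two_pi _ _ _ _⟩
  have hper_εr : IsPeriodic fun φ θ => ε * shape (a (ε, ξ, φ)) (b (ε, ξ, φ)) (c (ε, ξ, φ)) θ :=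
    ⟨fun φ θ => by simp only [pa, pb, pc], fun φ θ => by simp only [shape_add_two_pi]⟩
  have hsplit : ∀ φ θ, shape (a (ε, ξ, φ)) (b (ε, ξ, φ)) (c (ε, ξ, φ)) θ
      = (A (ξ, φ) * cis (2 * θ)).re + ε * r₁ ((ε, ξ, φ), θ) := fun φ θ => by
    rw [hr₁, shape, shape, ← Complex.re_ofReal_mul, ← Complex.add_re, ha, hb, hc]
    dsimp only
    rw [kε, χξ]
    congr 1
    ring
  have P₁ := fun φ => Psi₁_shape ε (fun φ => a (ε, ξ, φ)) (fun φ => b (ε, ξ, φ))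
    (fun φ => c (ε, ξ, φ)) φ
  have P₂ := fun φ => Psi₂_shape y ξ ε (fun φ => a (ε, ξ, φ)) (fun φ => b (ε, ξ, φ))
    (fun φ => c (ε, ξ, φ)) φ
  have P₃ := fun φ => Psi₃_shape y ξ ε (fun φ => a (ε, ξ, φ)) (fun φ => b (ε, ξ, φ))
    (fun φ => c (ε, ξ, φ)) φ
  have P₄ := fun φ => Psi₄_shape y ξ ε (fun φ => a (ε, ξ, φ)) (fun φ => b (ε, ξ, φ))
    (fun φ => c (ε, ξ, φ)) φ
  simp only [hq, hw₃, hw₃', hw₄, hw₄'] at P₂ P₃ P₄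
  have D₁ : ∀ φ, Differentiable ℝ (Psi₁ ε
      (fun φ θ => ε * shape (a (ε, ξ, φ)) (b (ε, ξ, φ)) (c (ε, ξ, φ)) θ) φ) := fun φ => by
    have := differentiable_selfPotential (δ := fun p : ℝ × ℝ × ℝ => k p.1 ^ 2) (by fun_prop) sa sb
      sc (fun p => by rw [abs_of_nonneg (sq_nonneg _)]; exact hsm p) (ε, ξ, φ)
    rw [kε] at this
    rw [P₁]
    exact this
  have D₂ : ∀ φ, Differentiable ℝ (Psi₂ y ξ ε
      (fun φ θ => ε * shape (a (ε, ξ, φ)) (b (ε, ξ, φ)) (c (ε, ξ, φ)) θ) φ) := fun φ => by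
    have := differentiable_pairPotential (e := fun p : ℝ × ℝ × ℝ => k p.1) (by fun_prop)
      (sα₂.comp sX) (sα₂.comp sX) sa sb sc (sa.comp sshift) (sb.comp sshift) (sc.comp sshift)
      (σ := 1) (by simp) hsm (fun p => hsm (p.1, p.2.1, p.2.2 + Real.pi)) (fun p => (hsα p).1)
      (ε, ξ, φ)
    simp only [Function.comp_apply, kε, χξ] at this
    rw [P₂]
    exact this
  have D₃ : ∀ φ, Differentiable ℝ (Psi₃ y ξ ε
      (fun φ θ => ε * shape (a (ε, ξ, φ)) (b (ε, ξ, φ)) (c (ε, ξ, φ)) θ) φ) := fun φ => by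
    have := differentiable_pairPotential (e := fun p : ℝ × ℝ × ℝ => k p.1) (by fun_prop)
      (sα₃.comp sX) (sβ₃.comp sX) sa sb sc sa sb sc
      (σ := -1) (by simp) hsm hsm (fun p => (hsα p).2.1) (ε, ξ, φ)
    simp only [Function.comp_apply, kε, χξ] at this
    rw [P₃]
    exact this.fun_neg
  have D₄ : ∀ φ, Differentiable ℝ (Psi₄ y ξ ε
      (fun φ θ => ε * shape (a (ε, ξ, φ)) (b (ε, ξ, φ)) (c (ε, ξ, φ)) θ) φ) := fun φ => by
    have := differentiable_pairPotential (e := fun p : ℝ × ℝ × ℝ => k p.1) (by fun_prop)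
      (sα₄.comp sX) (sβ₄.comp sX) sa sb sc (sa.comp sshift) (sb.comp sshift) (sc.comp sshift)
      (σ := -1) (by simp) hsm (fun p => hsm (p.1, p.2.1, p.2.2 + Real.pi)) (fun p => (hsα p).2.2)
      (ε, ξ, φ)
    simp only [Function.comp_apply, kε, χξ] at this
    rw [P₄]
    exact this.fun_neg
  have hG : ∀ φ θ, G y ξ ε (fun φ θ => ε * shape (a (ε, ξ, φ)) (b (ε, ξ, φ)) (c (ε, ξ, φ)) θ) φ θ
      = ε ^ 5 * (dirDeriv ((0, 0, 0), 1) H ((ε, ξ, φ), θ)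
        + Om ξ * (dirDeriv ((0, 0, 1), 0) r₁ ((ε, ξ, φ), θ)
          - Th' (ξ, φ) * dirDeriv ((0, 0, 0), 1) r₁ ((ε, ξ, φ), θ))) := fun φ θ => by
    have hsum := hH (ε, ξ, φ)
    simp only [Function.comp_apply, kε, χξ] at hsum
    have hΨ : ∀ θ, Psi₁ ε (fun φ θ => ε * shape (a (ε, ξ, φ)) (b (ε, ξ, φ)) (c (ε, ξ, φ)) θ) φ θ
        + Psi₂ y ξ ε (fun φ θ => ε * shape (a (ε, ξ, φ)) (b (ε, ξ, φ)) (c (ε, ξ, φ)) θ) φ θ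
        + Psi₃ y ξ ε (fun φ θ => ε * shape (a (ε, ξ, φ)) (b (ε, ξ, φ)) (c (ε, ξ, φ)) θ) φ θ
        + Psi₄ y ξ ε (fun φ θ => ε * shape (a (ε, ξ, φ)) (b (ε, ξ, φ)) (c (ε, ξ, φ)) θ) φ θ
        = K (ε, ξ, φ) + ε ^ 4 / 4 * (c₂ (ξ, φ) * cis (2 * θ)).re + ε ^ 5 * H ((ε, ξ, φ), θ) :=
      fun θ => by
        rw [← hsum θ, P₁, P₂, P₃, P₄]; ring
    have d1 := (((D₁ φ θ).hasDerivAt.fun_add (D₂ φ θ).hasDerivAt).fun_add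
      (D₃ φ θ).hasDerivAt).fun_add (D₄ φ θ).hasDerivAt
    simp only [hΨ] at d1
    have d2 := (((hasDerivAt_re (hasDerivAt_re_mul_cis (c₂ (ξ, φ)) 2 θ)).const_mul
      (ε ^ 4 / 4)).const_add (K (ε, ξ, φ))).fun_add
        ((hasDerivAt_family_θ sH ε ξ φ θ).const_mul (ε ^ 5))
    have d3 := (((hasDerivAt_re_mul_cis (A (ξ, φ)) 2 θ |> hasDerivAt_re).fun_add
      ((hasDerivAt_family_θ sr₁ ε ξ φ θ).const_mul ε)).const_mul ε).deriv
    have hAd : HasDerivAt (fun φ => A (ξ, φ)) (A' (ξ, φ)) φ := by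
      simp only [hA]; exact hA' ξ φ
    have d4 := (((hAd.mul_const (cis (2 * θ)) |> hasDerivAt_re).fun_add
      ((hasDerivAt_family_φ sr₁ ε ξ φ θ).const_mul ε)).const_mul ε).deriv
    rw [G, d1.unique d2, hOm, hTh']
    simp only [hsplit]
    rw [d3, d4, hc₂, ← hA]
    -- The second harmonic of order ε⁴ left by the stream functions is minus the transport of g, so
    -- the two cancel in G.
    have hre : (Complex.I * (2 : ℝ) * (2 * Complex.I * Om ξ * (A' (ξ, φ) - 2 * Complex.I * Th' (ξ, φ)
          * A (ξ, φ))) * cis (2 * θ)).re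
        = -4 * Om ξ * (A' (ξ, φ) * cis (2 * θ)).re
          + 4 * Om ξ * Th' (ξ, φ) * (Complex.I * (2 : ℝ) * A (ξ, φ) * cis (2 * θ)).re := by
      simp only [← Complex.re_ofReal_mul, ← Complex.add_re]
      congr 1
      push_cast
      linear_combination (4 * Om ξ * (A' (ξ, φ) - 2 * Complex.I * Th' (ξ, φ) * A (ξ, φ))
        * cis (2 * θ)) * Complex.I_sq
    rw [hre]
    ring
  refine ⟨⟨?_, hper_r.1, hper_r.2, fun φ => ?_⟩, ⟨fun φ θ => ?_, D₁, D₂, D₃, D₄⟩, hper_r, ?_, ?_,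
    fun φ θ => ⟨rfl, ?_, ?_⟩⟩
  · exact contDiff_shape (E := ℝ × ℝ) (a := fun x => a (ε, ξ, x.1)) (b := fun x => b (ε, ξ, x.1))
      (c := fun x => c (ε, ξ, x.1)) (by fun_prop) (by fun_prop) (by fun_prop) contDiff_snd
  · simpa using integral_shape_add (a (ε, ξ, φ)) (b (ε, ξ, φ)) (c (ε, ξ, φ)) 0
  -- The bound |ε²r| ≤ 1/16 keeps 1 + 2ε²r at least 7/8.
  · have h1 := hsm (ε, ξ, φ)
    dsimp only at h1
    rw [kε] at h1
    have h2 := mul_le_mul_of_nonneg_left (abs_shape_le (a (ε, ξ, φ)) (b (ε, ξ, φ)) (c (ε, ξ, φ)) θ)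
      (sq_nonneg ε)
    have h3 := mul_le_mul_of_nonneg_left (neg_abs_le (shape (a (ε, ξ, φ)) (b (ε, ξ, φ))
      (c (ε, ξ, φ)) θ)) (sq_nonneg ε)
    nlinarith
  · constructor <;> intro φ θ <;> simp only [slice, hr₁, pc₂, pa₃, pc₄, shape_add_two_pi]
  · have hε0 : ε ^ 5 ≠ 0 := pow_ne_zero 5 hε.1.ne'
    have hp := isPeriodic_G hqp hTp ε hper_εr
    constructor
    · intro φ θ
      have := hp.1 φ θ
      rw [hG, hG] at this
      simp only [slice, χξ]
      exact mul_left_cancel₀ hε0 this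
    · intro φ θ
      have := hp.2 φ θ
      rw [hG, hG] at this
      simp only [slice, χξ]
      exact mul_left_cancel₀ hε0 this
  · beta_reduce
    rw [hsplit, g, ha₂]
    ring
  · rw [hG]; simp only [χξ]

end Leapfrog

/-! ### Weighted Lipschitz bounds for the approximate solution. -/

theorem lemma3p3 (y₀ ξlo ξhi : ℝ) (hy₀ : 0 < y₀) (hlo : 0 < ξlo) (hlt : ξlo < ξhi)
    (hhi : ξhi < y₀ / √2) :
    ∃ ε₀ : ℝ, 0 < ε₀ ∧ ∃ r : ℝ → ℝ → ℝ → ℝ → ℝ,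
      (∀ ε ∈ Set.Ioo 0 ε₀,
        (∀ ξ₀ ∈ Set.Icc ξlo ξhi,
          Leapfrog.IsSmoothZeroMean (r ε ξ₀) ∧
          Leapfrog.Admissible y₀ ξ₀ ε (fun φ θ => ε * r ε ξ₀ φ θ)) ∧
        ∀ lam ∈ Set.Ioo (0 : ℝ) 1, ∀ s : ℝ,
          Leapfrog.lipNorm (Set.Icc ξlo ξhi) lam s (r ε) < ⊤) ∧
      ∀ s : ℝ, 0 < s → ∃ C : ℝ, 0 < C ∧ ∀ ε ∈ Set.Ioo 0 ε₀, ∀ lam ∈ Set.Ioo (0 : ℝ) 1,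
        Leapfrog.lipNorm (Set.Icc ξlo ξhi) lam s
            (fun ξ₀ φ θ => r ε ξ₀ φ θ - Leapfrog.g y₀ ξ₀ φ θ) ≤ ENNReal.ofReal (C * ε) ∧
        Leapfrog.lipNorm (Set.Icc ξlo ξhi) lam s
            (fun ξ₀ => Leapfrog.G y₀ ξ₀ ε (fun φ θ => ε * r ε ξ₀ φ θ))
          ≤ ENNReal.ofReal (C * ε ^ 5) := by
  obtain ⟨ε₀, hε₀, r, R, r₁, h, sR, sr₁, sh, H⟩ :=
    Leapfrog.exists_approximate_solution y₀ ξlo ξhi hy₀ hlo hlt hhi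
  refine ⟨ε₀, hε₀, r, fun ε hε => ⟨fun ξ hξ => ⟨(H ε hε ξ hξ).1, (H ε hε ξ hξ).2.1⟩,
    fun lam hlam s => ?_⟩, fun s _ => ?_⟩
  · obtain ⟨C, -, hC⟩ := Leapfrog.exists_lipNorm_le sR
      (fun ε hε ξ hξ => (H ε hε ξ hξ).2.2.1) s
    refine (hC ε hε lam hlam 1 (r ε) zero_le_one fun ξ hξ φ θ => ?_).trans_lt ENNReal.ofReal_lt_top
    rw [one_mul]
    exact ((H ε hε ξ hξ).2.2.2.2.2 φ θ).1
  · obtain ⟨C₁, hC₁, h₁⟩ := Leapfrog.exists_lipNorm_le sr₁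
      (fun ε hε ξ hξ => (H ε hε ξ hξ).2.2.2.1) s
    obtain ⟨C₂, -, h₂⟩ := Leapfrog.exists_lipNorm_le sh
      (fun ε hε ξ hξ => (H ε hε ξ hξ).2.2.2.2.1) s
    refine ⟨max C₁ C₂, lt_max_of_lt_left hC₁, fun ε hε lam hlam => ⟨?_, ?_⟩⟩
    · refine (h₁ ε hε lam hlam ε _ hε.1.le fun ξ hξ φ θ =>
        ((H ε hε ξ hξ).2.2.2.2.2 φ θ).2.1).trans (ENNReal.ofReal_le_ofReal ?_)
      exact mul_le_mul_of_nonneg_right (le_max_left _ _) hε.1.le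
    · refine (h₂ ε hε lam hlam (ε ^ 5) _ (pow_nonneg hε.1.le 5) fun ξ hξ φ θ =>
        ((H ε hε ξ hξ).2.2.2.2.2 φ θ).2.2).trans (ENNReal.ofReal_le_ofReal ?_)
      exact mul_le_mul_of_nonneg_right (le_max_right _ _) (pow_nonneg hε.1.le 5)
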